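/- Conventions. Let $\Delta\subset\mathbb R^2$ be a compact convex quadrilateral (the convex hull of four points in strictly convex position) and let $\lambda$ be Lebesgue measure. *Affine normals* of $\Delta$ are four affine functions ${\bf L}=(L_1,\dots,L_4)$ with $\Delta=\{\xi: L_j(\xi)\ge 0,\ j=1,\dots,4\}$, one vanishing on each side $F_j$; they are unique up to order and positive rescaling of each $L_j$. Given a lattice $\Lambda\subset(\mathbb R^2)^*$, $(\Delta,{\bf L})$ is *rational Delzant with respect to $\Lambda$* if all normals $u_j=dL_j$ lie in $\Lambda$. Let $\nu$ be the positive measure on $\partial\Delta$ with $|u_j\wedge d\nu|=d\lambda$ on $F_j$ (length measure divided by $|u_j|$). The *extremal affine function* $\zeta$ is the unique affine function with $\int_\Delta \zeta a\,d\lambda=2\int_{\partial\Delta}a\,d\nu$ for all affine $a$, and the *relative Futaki invariant* of a continuous function $f$ on $\Delta$ is $$\mathcal F_{\Delta,{\bf L}}(f)=\int_{\partial\Delta} f\,d\nu-\tfrac12\int_\Delta \zeta f\,d\lambda .$$ A *PL convex function* on $\Delta$ is a maximum of finitely many affine functions; it is *simple* if it has the form $\max(0,a)$ with $a$ affine. $(\Delta,{\bf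 L})$ is *K-polystable* if $\mathcal F_{\Delta,{\bf L}}(f)\ge 0$ for every PL convex $f$, with equality if and only if $f$ is affine on $\Delta$; it is *K-unstable* if $\mathcal F_{\Delta,{\bf L}}(f)<0$ for some PL convex $f$. **Proposition B.1.** Let $\Delta$ be a compact convex quadrilateral. 1. If $\Delta$ is a parallelogram, then $(\Delta,{\bf L})$ is K-polystable for every choice of affine normals ${\bf L}$. 2. If $\Delta$ is not a parallelogram, then there are affine normals ${\bf L}$ such that $(\Delta,{\bf L})$ is K-polystable, and there are affine normals ${\bf L}$ such that $(\Delta,{\bf L})$ is K-unstable; in the latter case ${\bf L}$ can be chosen so that $\mathcal F_{\Delta,{\bf L}}(f)<0$ for a simple PL convex function $f$. Moreover, if $\Delta$ admits affine normals that are rational Delzant with respect to a lattice $\Lambda$, then normals of both kinds can be chosen to be rational Delzant with respect to the same $\Lambda$. -/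

import Mathlib

namespace LabelledPolygon

/-- The affine plane, in coordinates, with its Lebesgue measure. -/
abbrev Plane : Type := EuclideanSpace ℝ (Fin 2)

/-- Real affine functions on the plane. The linear part `a.linear` is the differential of `a`. -/
abbrev AffFun : Type := Plane →ᵃ[ℝ] ℝ

/-- The length of the differential of an affine function. -/
noncomputable def gradNorm (a : AffFun) : ℝ :=
  ‖LinearMap.toContinuousLinearMap a.linear‖

/-- A convex quadrilateral: the convex hull of four points in strictly convex position
(none of them lies in the convex hull of the others). It is automatically compact. -/
def IsConvexQuadrilateral (Δ : Set Plane) : Prop :=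
  ∃ v : Fin 4 → Plane, ConvexIndependent ℝ v ∧ Δ = convexHull ℝ (Set.range v)

/-- A (nondegenerate) parallelogram. -/
def IsParallelogram (Δ : Set Plane) : Prop :=
  ∃ p a b : Plane, LinearIndependent ℝ ![a, b] ∧
    Δ = convexHull ℝ {p, p + a, p + b, p + a + b}

/-- `L` is a system of affine normals of `Δ`: `Δ` is cut out by the inequalities `0 ≤ L j`,
every `L j` vanishes somewhere on `Δ`, and at every point of `Δ` the differentials of those
`L j` that vanish there are linearly independent. -/
structure IsAffineNormals {n : ℕ} (Δ : Set Plane) (L : Fin n → AffFun) : Prop where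
  eq_setOf : Δ = {x | ∀ j, 0 ≤ L j x}
  exists_zero : ∀ j, ∃ x ∈ Δ, L j x = 0
  linearIndependent : ∀ x ∈ Δ,
    LinearIndependent ℝ (fun j : {j // L j x = 0} => (L j).linear)

/-- A lattice in the dual plane (in which the differentials live): the integral span of a real
basis. -/
def IsDualLattice (Λ : Submodule ℤ (Module.Dual ℝ Plane)) : Prop :=
  ∃ b : Module.Basis (Fin 2) ℝ (Module.Dual ℝ Plane), Λ = Submodule.span ℤ (Set.range b)

/-- `(Δ, L)` is a rational Delzant polygon with respect to `Λ`: the differentials of the affine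
normals belong to `Λ`. -/
structure IsRationalDelzant {n : ℕ} (Λ : Submodule ℤ (Module.Dual ℝ Plane))
    (Δ : Set Plane) (L : Fin n → AffFun) : Prop where
  isAffineNormals : IsAffineNormals Δ L
  mem_lattice : ∀ j, (L j).linear ∈ Λ

/-- The facet of `Δ` on which `a` vanishes. -/
def facet (Δ : Set Plane) (a : AffFun) : Set Plane := Δ ∩ {x | a x = 0}

/-- The measure `ν` on the boundary of `Δ`. On the facet where `L j` vanishes it is determined up
to sign by `d(L j) ∧ dν = dλ`, with `λ` the Lebesgue measure; that is, it is the length measure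
divided by the length of the differential of `L j`. -/
noncomputable def boundaryMeasure {n : ℕ} (Δ : Set Plane) (L : Fin n → AffFun) :
    MeasureTheory.Measure Plane :=
  ∑ j, ENNReal.ofReal (gradNorm (L j))⁻¹ •
    (MeasureTheory.Measure.hausdorffMeasure 1 : MeasureTheory.Measure Plane).restrict
      (facet Δ (L j))

/-- `ζ` is an extremal affine function of `(Δ, L)`: `∫_Δ ζ a dλ = 2 ∫_∂Δ a dν` for every affine
function `a`. -/
def IsExtremalAffine {n : ℕ} (Δ : Set Plane) (L : Fin n → AffFun) (ζ : AffFun) : Prop :=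
  ∀ a : AffFun, ∫ x in Δ, ζ x * a x = 2 * ∫ x, a x ∂(boundaryMeasure Δ L)

open Classical in
/-- The extremal affine function of `(Δ, L)`; it exists and is unique as soon as `Δ` is compact
with nonempty interior and `L` is a system of affine normals, see
`existsUnique_isExtremalAffine`. -/
noncomputable def extremalAffine {n : ℕ} (Δ : Set Plane) (L : Fin n → AffFun) : AffFun :=
  if h : ∃ ζ, IsExtremalAffine Δ L ζ then h.choose else 0

/-- The relative Futaki invariant `∫_∂Δ f dν - (1/2) ∫_Δ ζ f dλ`. -/
noncomputable def futaki {n : ℕ} (Δ : Set Plane) (L : Fin n → AffFun) (f : Plane → ℝ) : ℝ :=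
  ∫ x, f x ∂(boundaryMeasure Δ L) - (1 / 2) * ∫ x in Δ, extremalAffine Δ L x * f x

/-- `f` is a piecewise linear convex function on `Δ`: the maximum of a finite nonempty collection
of affine functions. -/
def IsPLConvexOn (Δ : Set Plane) (f : Plane → ℝ) : Prop :=
  ∃ (s : Finset AffFun) (hs : s.Nonempty), ∀ x ∈ Δ, f x = s.sup' hs (fun a => a x)

/-- `f` agrees on `Δ` with an affine function. -/
def IsAffineOn (Δ : Set Plane) (f : Plane → ℝ) : Prop :=
  ∃ a : AffFun, ∀ x ∈ Δ, f x = a x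

/-- (Analytic, relative, toric) K-polystability. -/
def IsKPolystable {n : ℕ} (Δ : Set Plane) (L : Fin n → AffFun) : Prop :=
  ∀ f : Plane → ℝ, IsPLConvexOn Δ f →
    0 ≤ futaki Δ L f ∧ (futaki Δ L f = 0 ↔ IsAffineOn Δ f)

/-- K-instability: the Futaki invariant of some PL convex function is negative. -/
def IsKUnstable {n : ℕ} (Δ : Set Plane) (L : Fin n → AffFun) : Prop :=
  ∃ f : Plane → ℝ, IsPLConvexOn Δ f ∧ futaki Δ L f < 0

/-- The simple PL convex function `max 0 a`, with crease along the line where `a` vanishes. -/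
noncomputable def simplePL (a : AffFun) : Plane → ℝ := fun x => max 0 (a x)

lemma continuous_affFun (a : AffFun) : Continuous a := a.continuous_of_finiteDimensional

lemma IsAffineNormals.linear_ne_zero {n : ℕ} {Δ : Set Plane} {L : Fin n → AffFun}
    (h : IsAffineNormals Δ L) (j : Fin n) : (L j).linear ≠ 0 := by
  obtain ⟨x, hx, hj⟩ := h.exists_zero j
  exact (h.linearIndependent x hx).ne_zero ⟨j, hj⟩

/-- A bounded part of the zero line of a nonconstant affine function has finite length. -/
lemma hausdorffMeasure_facet_lt_top {Δ : Set Plane} (hΔ : IsCompact Δ) {a : AffFun}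
    (ha : a.linear ≠ 0) :
    (MeasureTheory.Measure.hausdorffMeasure 1 : MeasureTheory.Measure Plane) (facet Δ a) < ⊤ := by
  rcases (facet Δ a).eq_empty_or_nonempty with he | ⟨p, hp⟩
  · rw [he]; simp
  have hker : Module.finrank ℝ (LinearMap.ker a.linear) = 1 := by
    have h1 := LinearMap.finrank_range_add_finrank_ker a.linear
    have h2 : LinearMap.range a.linear = ⊤ :=
      LinearMap.range_eq_top.2 (LinearMap.surjective ha)
    rw [h2, finrank_top, Module.finrank_self, finrank_euclideanSpace_fin] at h1
    omega
  obtain ⟨w, hw0, hw⟩ := finrank_eq_one_iff'.1 hker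
  have hwn : (0 : ℝ) < ‖(w : Plane)‖ := by
    rw [norm_pos_iff]; exact fun h => hw0 (Subtype.ext h)
  obtain ⟨R, hR⟩ := hΔ.isBounded.subset_closedBall p
  have hsub : facet Δ a ⊆
      segment ℝ (p - (R / ‖(w : Plane)‖) • (w : Plane)) (p + (R / ‖(w : Plane)‖) • (w : Plane)) := by
    intro x hx
    have hxk : a.linear (x - p) = 0 := by
      have h3 := a.linearMap_vsub x p
      rw [vsub_eq_sub, vsub_eq_sub] at h3
      rw [h3, show a x = 0 from hx.2, show a p = 0 from hp.2, sub_zero]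
    obtain ⟨c, hc⟩ := hw ⟨x - p, hxk⟩
    have hc' : c • (w : Plane) = x - p := congrArg Subtype.val hc
    have hxR : ‖x - p‖ ≤ R := by simpa [dist_eq_norm] using hR hx.1
    rw [← hc', norm_smul, Real.norm_eq_abs] at hxR
    have hcR : |c| ≤ R / ‖(w : Plane)‖ := (le_div_iff₀ hwn).2 hxR
    set T := R / ‖(w : Plane)‖ with hT
    have hx' : x = p + c • (w : Plane) := by rw [hc']; abel
    rw [hx']
    rcases (abs_nonneg c |>.trans hcR).eq_or_lt with hT0 | hT0
    · have : c = 0 := abs_eq_zero.1 (le_antisymm (hcR.trans hT0.ge) (abs_nonneg c))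
      rw [← hT0, this]; simp
    · obtain ⟨hl, hu⟩ := abs_le.1 hcR
      refine ⟨(T - c) / (2 * T), (T + c) / (2 * T), by
        apply div_nonneg <;> linarith, by apply div_nonneg <;> linarith, by field_simp; ring, ?_⟩
      have e1 : (T - c) / (2 * T) + (T + c) / (2 * T) = 1 := by field_simp; ring
      have e2 : -((T - c) / (2 * T) * T) + (T + c) / (2 * T) * T = c := by field_simp; ring
      calc _ = ((T - c) / (2 * T) + (T + c) / (2 * T)) • p +
            (-((T - c) / (2 * T) * T) + (T + c) / (2 * T) * T) • (w : Plane) := by module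
        _ = _ := by rw [e1, e2, one_smul]
  refine (MeasureTheory.measure_mono hsub).trans_lt ?_
  rw [MeasureTheory.hausdorffMeasure_segment]
  exact edist_lt_top _ _

lemma integrable_boundaryMeasure {n : ℕ} {Δ : Set Plane} {L : Fin n → AffFun}
    (hΔ : IsCompact Δ) (hL : IsAffineNormals Δ L) {f : Plane → ℝ} (hf : Continuous f) :
    MeasureTheory.Integrable f (boundaryMeasure Δ L) := by
  unfold boundaryMeasure
  rw [MeasureTheory.integrable_finsetSum_measure]
  intro j _
  refine MeasureTheory.Integrable.smul_measure ?_ ENNReal.ofReal_ne_top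
  have hc : IsCompact (facet Δ (L j)) :=
    hΔ.inter_right (isClosed_eq (continuous_affFun (L j)) continuous_const)
  exact hf.continuousOn.integrableOn_of_subset_isCompact hc hc.measurableSet subset_rfl
    (hausdorffMeasure_facet_lt_top hΔ (hL.linear_ne_zero j)).ne

lemma finiteDimensional_affFun : FiniteDimensional ℝ AffFun :=
  Module.Finite.equiv (AffineMap.toConstProdLinearMap ℝ : AffFun ≃ₗ[ℝ] ℝ × (Plane →ₗ[ℝ] ℝ)).symm

/-- Existence and uniqueness of the extremal affine function. -/
theorem existsUnique_isExtremalAffine {n : ℕ} {Δ : Set Plane} {L : Fin n → AffFun}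
    (hΔ : IsCompact Δ) (hint : (interior Δ).Nonempty) (hL : IsAffineNormals Δ L) :
    ∃! ζ, IsExtremalAffine Δ L ζ := by
  have := finiteDimensional_affFun
  have hI : ∀ a b : AffFun, MeasureTheory.IntegrableOn (fun x => a x * b x) Δ :=
    fun a b => ((continuous_affFun a).mul (continuous_affFun b)).continuousOn.integrableOn_compact hΔ
  let Φ : AffFun →ₗ[ℝ] Module.Dual ℝ AffFun := LinearMap.mk₂ ℝ
    (fun a b => ∫ x in Δ, a x * b x)
    (fun a a' b => by
      rw [← MeasureTheory.integral_add (hI a b) (hI a' b)]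
      simp [add_mul])
    (fun c a b => by
      rw [smul_eq_mul, ← MeasureTheory.integral_const_mul]
      simp [mul_assoc])
    (fun a b b' => by
      rw [← MeasureTheory.integral_add (hI a b) (hI a b')]
      simp [mul_add])
    (fun c a b => by
      rw [smul_eq_mul, ← MeasureTheory.integral_const_mul]
      simp [mul_left_comm])
  let β : Module.Dual ℝ AffFun :=
    { toFun := fun a => 2 * ∫ x, a x ∂(boundaryMeasure Δ L)
      map_add' := fun a b => by
        have := MeasureTheory.integral_add
          (integrable_boundaryMeasure hΔ hL (continuous_affFun a))
          (integrable_boundaryMeasure hΔ hL (continuous_affFun b))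
        simp only [AffineMap.coe_add, Pi.add_apply]
        rw [this, mul_add]
      map_smul' := fun c a => by
        simp only [AffineMap.coe_smul, Pi.smul_apply, smul_eq_mul, RingHom.id_apply]
        rw [MeasureTheory.integral_const_mul]; ring }
  have hinj : Function.Injective Φ := by
    rw [injective_iff_map_eq_zero]
    intro a ha
    have h0 : ∫ x in Δ, a x * a x = 0 := by
      have := LinearMap.congr_fun ha a
      simpa [Φ] using this
    have h1 := (MeasureTheory.setIntegral_eq_zero_iff_of_nonneg_ae
      (Filter.Eventually.of_forall fun x => mul_self_nonneg (a x)) (hI a a)).1 h0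
    have h2 : (fun x => a x) =ᵐ[MeasureTheory.volume.restrict (interior Δ)] fun _ => (0 : ℝ) := by
      filter_upwards [MeasureTheory.ae_restrict_of_ae_restrict_of_subset interior_subset h1]
        with x hx using mul_self_eq_zero.1 hx
    have h3 : Set.EqOn (fun x => a x) (fun _ => (0 : ℝ)) (interior Δ) :=
      MeasureTheory.Measure.eqOn_open_of_ae_eq h2 isOpen_interior
        (continuous_affFun a).continuousOn continuousOn_const
    have hspan : affineSpan ℝ (interior Δ) = ⊤ := isOpen_interior.affineSpan_eq_top hint
    exact AffineMap.ext_on hspan (fun x hx => by simpa using h3 hx)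
  have hsurj : Function.Surjective Φ :=
    (LinearMap.injective_iff_surjective_of_finrank_eq_finrank
      Subspace.dual_finrank_eq.symm).1 hinj
  have hiff : ∀ ζ, IsExtremalAffine Δ L ζ ↔ Φ ζ = β :=
    fun ζ => ⟨fun h => LinearMap.ext h, fun h a => LinearMap.congr_fun h a⟩
  obtain ⟨ζ, hζ⟩ := hsurj β
  exact ⟨ζ, (hiff ζ).2 hζ, fun ζ' h' => hinj (((hiff ζ').1 h').trans hζ.symm)⟩

end LabelledPolygon

/-! Label the vertices cyclically and write `v 2 = v 0 + m • (v 1 - v 0) + n • (v 3 - v 0)`; here `m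
= 1` means that the sides `v 1, v 2` and `v 3, v 0` are parallel, `n = 1` the same for the other
pair. Affine normals are positive multiples `c i` of fixed side functions, so they enter only
through the masses `σ i = sideWeight / c i` that `ν` gives to the sides. The extremal affine
function, and with it the Futaki invariant of a fixed function, is linear in `σ`.

Parallelogram. The extremal function is a function of one coordinate plus a function of the other,
so the Futaki invariant is an average of one-dimensional invariants over the slices in the two
directions (`futaki_parallelogram`). On an interval with positive endpoint weights the invariant of
a convex function is nonnegative and vanishes only on affine functions
(`integral_intervalExtremal_mul_le`). Equality on all slices makes `f` bilinear, and convexity along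
the two diagonals kills the `x y` term.

Stable normals. Give each side the mass of its cone over the centroid `O`. Then `ζ` is the constant
4, by the divergence theorem. Subtract from `f` a supporting affine function at `O`: the difference
`g` is convex, nonnegative and zero at `O`, and on each triangle over a side its integral is at most
two thirds of the area times its mean on the side. This leaves room (4 against 6), so stability
persists for all `σ` in an open cone (`isKPolystable_of_lt`, `exists_cone_isKPolystable`).

Unstable normals. If `m ≠ 1`, put all the mass on the side `v 3, v 0` and let a crease joining this
side to the opposite one converge to the side `v 0, v 1`. The leading term of the invariant is a
quadratic form in the two speeds of approach; its discriminant is a positive multiple of `(m - 1) ^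
2`, and the form is negative at some pair of positive speeds (`exists_sideFutaki_neg`). Negativity
for a fixed simple function is an open linear condition on `σ`, so it survives small positive masses
on the other sides (`exists_cone_futaki_neg`).

Rationality. Both conditions on `σ` define open cones meeting the positive orthant, and multiplying
given normals by suitable positive integers moves `σ` into any such cone (`exists_nat_div_mem`).
Integer multiples stay in the lattice. -/

namespace LabelledPolygon

open MeasureTheory

/-! ### Integrals over triangles and parallelograms -/

/-- The determinant of two plane vectors. -/
noncomputable def cross (u w : Plane) : ℝ := u 0 * w 1 - u 1 * w 0

/-- The identification of `ℝ × ℝ` with the plane. -/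
noncomputable def ofProd : ℝ × ℝ ≃ᵐ Plane :=
  (MeasurableEquiv.finTwoArrow (α := ℝ)).symm.trans (MeasurableEquiv.toLp 2 (Fin 2 → ℝ))

lemma ofProd_zero (p : ℝ × ℝ) : ofProd p 0 = p.1 := rfl

lemma ofProd_one (p : ℝ × ℝ) : ofProd p 1 = p.2 := rfl

lemma measurePreserving_ofProd : MeasurePreserving ofProd volume volume :=
  (PiLp.volume_preserving_toLp (Fin 2)).comp
    ((volume_preserving_finTwoArrow ℝ).symm (MeasurableEquiv.finTwoArrow (α := ℝ)))

lemma setIntegral_ofProd (s : Set Plane) (g : Plane → ℝ) :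
    ∫ z in s, g z = ∫ p in ofProd ⁻¹' s, g (ofProd p) :=
  (measurePreserving_ofProd.setIntegral_preimage_emb ofProd.measurableEmbedding g s).symm

/-- Affine change of variables in the plane. -/
lemma setIntegral_image_affine {o u w : Plane} (h : cross u w ≠ 0) {S : Set (ℝ × ℝ)}
    (hS : MeasurableSet S) (g : Plane → ℝ) :
    ∫ z in (fun p : ℝ × ℝ => o + p.1 • u + p.2 • w) '' S, g z =
      |cross u w| * ∫ p in S, g (o + p.1 • u + p.2 • w) := by
  let φ : ℝ × ℝ → ℝ × ℝ := fun p => (o 0 + p.1 * u 0 + p.2 * w 0, o 1 + p.1 * u 1 + p.2 * w 1)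
  have hφ : ∀ p, ofProd (φ p) = o + p.1 • u + p.2 • w := by
    intro p
    ext i
    fin_cases i
    · simp [ofProd_zero, φ]
    · simp [ofProd_one, φ]
  let A : ℝ × ℝ →L[ℝ] ℝ × ℝ :=
    LinearMap.toContinuousLinearMap
      (Matrix.toLin (.finTwoProd ℝ) (.finTwoProd ℝ) !![u 0, w 0; u 1, w 1])
  have hA : A.det = cross u w := by
    simp only [A, LinearMap.det_toContinuousLinearMap, LinearMap.det_toLin, Matrix.det_fin_two_of,
      cross]
    ring
  have hd : ∀ p ∈ S, HasFDerivWithinAt φ A S p := by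
    intro p _
    have h1 : ∀ q, φ q = A q + (o 0, o 1) := by
      intro q
      simp only [A, φ, Matrix.toLin_finTwoProd_toContinuousLinearMap]
      ext <;> simp <;> ring
    have h2 : φ = fun q => A q + (o 0, o 1) := funext h1
    rw [h2]
    exact (A.hasFDerivWithinAt).add_const _
  have hinj : Function.Injective φ := by
    intro p q hpq
    have e1 : o 0 + p.1 * u 0 + p.2 * w 0 = o 0 + q.1 * u 0 + q.2 * w 0 := congrArg Prod.fst hpq
    have e2 : o 1 + p.1 * u 1 + p.2 * w 1 = o 1 + q.1 * u 1 + q.2 * w 1 := congrArg Prod.snd hpq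
    unfold cross at h
    have e3 : (p.1 - q.1) * (u 0 * w 1 - u 1 * w 0) = 0 := by linear_combination w 1 * e1 - w 0 * e2
    have e4 : (p.2 - q.2) * (u 0 * w 1 - u 1 * w 0) = 0 := by linear_combination u 0 * e2 - u 1 * e1
    ext
    · exact sub_eq_zero.1 ((mul_eq_zero.1 e3).resolve_right h)
    · exact sub_eq_zero.1 ((mul_eq_zero.1 e4).resolve_right h)
  have hset : ofProd ⁻¹' ((fun p : ℝ × ℝ => o + p.1 • u + p.2 • w) '' S) = φ '' S := by
    ext q
    constructor
    · rintro ⟨p, hp, hpq⟩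
      exact ⟨p, hp, ofProd.injective ((hφ p).trans hpq)⟩
    · rintro ⟨p, hp, rfl⟩
      exact ⟨p, hp, (hφ p).symm⟩
  rw [setIntegral_ofProd, hset,
    integral_image_eq_integral_abs_det_fderiv_smul volume hS hd hinj.injOn]
  simp only [hA, hφ, smul_eq_mul]
  rw [integral_const_mul]

/-- The closed triangle `p q s`. -/
def tri (p q s : Plane) : Set Plane :=
  (fun z : ℝ × ℝ => p + z.1 • (q - p) + z.2 • (s - q)) ''
    {z | z.1 ∈ Set.Icc (0 : ℝ) 1 ∧ z.2 ∈ Set.Icc 0 z.1}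

lemma isCompact_tri (p q s : Plane) : IsCompact (tri p q s) := by
  refine IsCompact.image ?_ (by fun_prop)
  have hsub : {z : ℝ × ℝ | z.1 ∈ Set.Icc (0 : ℝ) 1 ∧ z.2 ∈ Set.Icc 0 z.1} ⊆
      Set.Icc (0 : ℝ) 1 ×ˢ Set.Icc (0 : ℝ) 1 := by
    rintro ⟨x, y⟩ ⟨h1, h2⟩
    exact ⟨h1, h2.1, h2.2.trans h1.2⟩
  refine (isCompact_Icc.prod isCompact_Icc).of_isClosed_subset ?_ hsub
  simp only [Set.mem_Icc, Set.ofPred_and]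
  refine ((isClosed_le ?_ ?_).inter (isClosed_le ?_ ?_)).inter
    ((isClosed_le ?_ ?_).inter (isClosed_le ?_ ?_)) <;> fun_prop

/-- The integral over a triangle, in polar form at the vertex `p`. -/
lemma setIntegral_tri {p q s : Plane} (h : cross (q - p) (s - q) ≠ 0) {g : Plane → ℝ}
    (hg : Continuous g) :
    ∫ z in tri p q s, g z = |cross (q - p) (s - q)| *
      ∫ r in (0 : ℝ)..1, r * ∫ t in (0 : ℝ)..1, g (p + r • (q - p + t • (s - q))) := by
  have hmeas : MeasurableSet {z : ℝ × ℝ | z.1 ∈ Set.Icc (0 : ℝ) 1 ∧ z.2 ∈ Set.Icc 0 z.1} := by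
    refine IsClosed.measurableSet ?_
    simp only [Set.mem_Icc, Set.ofPred_and]
    refine ((isClosed_le ?_ ?_).inter (isClosed_le ?_ ?_)).inter
      ((isClosed_le ?_ ?_).inter (isClosed_le ?_ ?_)) <;> fun_prop
  rw [tri, setIntegral_image_affine h hmeas]
  congr 1
  set S : Set (ℝ × ℝ) := {z : ℝ × ℝ | z.1 ∈ Set.Icc (0 : ℝ) 1 ∧ z.2 ∈ Set.Icc 0 z.1} with hSdef
  set G : ℝ × ℝ → ℝ := fun z => g (p + z.1 • (q - p) + z.2 • (s - q)) with hG
  have hGc : Continuous G := by fun_prop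
  have hsub : S ⊆ Set.Icc (0 : ℝ) 1 ×ˢ Set.Icc (0 : ℝ) 1 := by
    rintro ⟨x, y⟩ ⟨h1, h2⟩
    exact ⟨h1, h2.1, h2.2.trans h1.2⟩
  have hint : IntegrableOn G (Set.Icc (0 : ℝ) 1 ×ˢ Set.Icc (0 : ℝ) 1) :=
    hGc.continuousOn.integrableOn_compact (isCompact_Icc.prod isCompact_Icc)
  have h1 : ∫ z in S, G z = ∫ z in Set.Icc (0 : ℝ) 1 ×ˢ Set.Icc (0 : ℝ) 1, S.indicator G z := by
    rw [setIntegral_indicator hmeas, Set.inter_eq_self_of_subset_right hsub]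
  have hint' : IntegrableOn (S.indicator G) (Set.Icc (0 : ℝ) 1 ×ˢ Set.Icc (0 : ℝ) 1) :=
    hint.indicator hmeas
  rw [h1, Measure.volume_eq_prod, setIntegral_prod _ hint',
    intervalIntegral.integral_of_le zero_le_one, ← integral_Icc_eq_integral_Ioc]
  refine setIntegral_congr_fun measurableSet_Icc fun r hr => ?_
  have h2 : ∀ y, S.indicator G (r, y) = (Set.Icc 0 r).indicator (fun y => G (r, y)) y := by
    intro y
    by_cases hy : y ∈ Set.Icc 0 r
    · rw [Set.indicator_of_mem hy, Set.indicator_of_mem]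
      exact ⟨hr, hy⟩
    · rw [Set.indicator_of_notMem hy, Set.indicator_of_notMem]
      exact fun h => hy h.2
  simp only [h2]
  rw [setIntegral_indicator measurableSet_Icc, Set.inter_eq_self_of_subset_right
    (Set.Icc_subset_Icc_right hr.2), integral_Icc_eq_integral_Ioc,
    ← intervalIntegral.integral_of_le hr.1]
  -- The substitution `y = r t` produces the Jacobian factor `r`; in this form it also covers `r =
  -- 0`.
  have h3 := intervalIntegral.mul_integral_comp_mul_left (f := fun y => G (r, y))
    (a := 0) (b := 1) r
  rw [mul_zero, mul_one] at h3
  rw [← h3]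
  congr 1
  refine intervalIntegral.integral_congr fun t _ => ?_
  simp only [G]
  congr 1
  module

/-- The integral over a parallelogram as an iterated integral. -/
lemma setIntegral_parallelogram {o u w : Plane} (h : cross u w ≠ 0) {g : Plane → ℝ}
    (hg : Continuous g) :
    ∫ z in (fun p : ℝ × ℝ => o + p.1 • u + p.2 • w) '' (Set.Icc (0 : ℝ) 1 ×ˢ Set.Icc (0 : ℝ) 1),
      g z = |cross u w| *
      ∫ x in (0 : ℝ)..1, ∫ y in (0 : ℝ)..1, g (o + x • u + y • w) := by
  rw [setIntegral_image_affine h (measurableSet_Icc.prod measurableSet_Icc)]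
  congr 1
  have hint : IntegrableOn (fun z : ℝ × ℝ => g (o + z.1 • u + z.2 • w))
      (Set.Icc (0 : ℝ) 1 ×ˢ Set.Icc (0 : ℝ) 1) :=
    Continuous.continuousOn (by fun_prop) |>.integrableOn_compact
      (isCompact_Icc.prod isCompact_Icc)
  rw [Measure.volume_eq_prod, setIntegral_prod _ hint,
    intervalIntegral.integral_of_le zero_le_one, ← integral_Icc_eq_integral_Ioc]
  refine setIntegral_congr_fun measurableSet_Icc fun r hr => ?_
  simp only
  rw [integral_Icc_eq_integral_Ioc, ← intervalIntegral.integral_of_le zero_le_one]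

lemma apply_add (a : AffFun) (p d : Plane) : a (p + d) = a p + a.linear d := by
  have := a.map_vadd p d
  simp only [vadd_eq_add] at this
  rw [add_comm, this, add_comm]

lemma linear_sub (a : AffFun) (p q : Plane) : a.linear (p - q) = a p - a q := by
  have := a.linearMap_vsub p q
  simpa using this

lemma integral_cubic (A B C D : ℝ) :
    ∫ t in (0 : ℝ)..1, (A + B * t + C * t ^ 2 + D * t ^ 3) = A + B / 2 + C / 3 + D / 4 := by
  have h1 : ∫ t in (0 : ℝ)..1, B * t = B / 2 := by
    rw [intervalIntegral.integral_const_mul, integral_id]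
    ring
  rw [intervalIntegral.integral_add, intervalIntegral.integral_add, intervalIntegral.integral_add]
  · rw [h1, intervalIntegral.integral_const_mul, intervalIntegral.integral_const_mul,
      intervalIntegral.integral_const, integral_pow, integral_pow, smul_eq_mul]
    norm_num
    ring
  all_goals exact Continuous.intervalIntegrable (by fun_prop) _ _

/-- The integral over a triangle of the product of two affine functions. -/
lemma setIntegral_tri_mul {p q s : Plane} (h : cross (q - p) (s - q) ≠ 0) (a b : AffFun) :
    ∫ z in tri p q s, a z * b z = |cross (q - p) (s - q)| / 24 *
      ((a p + a q + a s) * (b p + b q + b s) + a p * b p + a q * b q + a s * b s) := by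
  rw [setIntegral_tri (g := fun z => a z * b z) h ((continuous_affFun a).mul (continuous_affFun b))]
  have e : ∀ (c : AffFun) (r t : ℝ), c (p + r • (q - p + t • (s - q))) =
      c p + r * (c q - c p + t * (c s - c q)) := by
    intro c r t
    rw [apply_add, map_smul, map_add, map_smul, linear_sub, linear_sub]
    simp
  simp only [e]
  have h1 : ∀ r : ℝ, (∫ t in (0 : ℝ)..1, (a p + r * (a q - a p + t * (a s - a q))) *
      (b p + r * (b q - b p + t * (b s - b q)))) =
      (a p + r * (a q - a p)) * (b p + r * (b q - b p)) +
      ((a p + r * (a q - a p)) * (r * (b s - b q)) + (b p + r * (b q - b p)) * (r * (a s - a q))) / 2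
      + (r * (a s - a q)) * (r * (b s - b q)) / 3 := by
    intro r
    have : ∀ t : ℝ, (a p + r * (a q - a p + t * (a s - a q))) *
        (b p + r * (b q - b p + t * (b s - b q))) =
        (a p + r * (a q - a p)) * (b p + r * (b q - b p)) +
        ((a p + r * (a q - a p)) * (r * (b s - b q)) +
          (b p + r * (b q - b p)) * (r * (a s - a q))) * t
        + (r * (a s - a q)) * (r * (b s - b q)) * t ^ 2 := fun t => by ring
    simp only [this]
    have h3 := integral_cubic ((a p + r * (a q - a p)) * (b p + r * (b q - b p)))
      ((a p + r * (a q - a p)) * (r * (b s - b q)) + (b p + r * (b q - b p)) * (r * (a s - a q)))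
      ((r * (a s - a q)) * (r * (b s - b q))) 0
    simp only [zero_mul, add_zero, zero_div] at h3
    exact h3
  simp only [h1]
  have h2 : ∀ r : ℝ, r * ((a p + r * (a q - a p)) * (b p + r * (b q - b p)) +
      ((a p + r * (a q - a p)) * (r * (b s - b q)) + (b p + r * (b q - b p)) * (r * (a s - a q))) / 2
      + (r * (a s - a q)) * (r * (b s - b q)) / 3) =
      0 + a p * b p * r + (a p * (b q - b p) + b p * (a q - a p) + (a p * (b s - b q)
        + b p * (a s - a q)) / 2) * r ^ 2 + ((a q - a p) * (b q - b p) +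
        ((a q - a p) * (b s - b q) + (b q - b p) * (a s - a q)) / 2 +
        (a s - a q) * (b s - b q) / 3) * r ^ 3 := fun r => by ring
  simp only [h2]
  rw [integral_cubic]
  ring

/-- The mean over a triangle of a convex function vanishing at one vertex is controlled by the
opposite side. -/
lemma setIntegral_tri_le {p q s : Plane} (h : cross (q - p) (s - q) ≠ 0) {g : Plane → ℝ}
    (hg : Continuous g) (hconv : ConvexOn ℝ Set.univ g) (h0 : g p = 0) :
    ∫ z in tri p q s, g z ≤ |cross (q - p) (s - q)| / 3 *
      ∫ t in (0 : ℝ)..1, g (q + t • (s - q)) := by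
  rw [setIntegral_tri h hg, div_mul_eq_mul_div, mul_div_assoc]
  refine mul_le_mul_of_nonneg_left ?_ (abs_nonneg _)
  set I := ∫ t in (0 : ℝ)..1, g (q + t • (s - q)) with hI
  -- Convexity and `g p = 0` bound `g` on the slice at height `r` by `r` times its values on the
  -- opposite side. With the Jacobian this gives `I r ^ 2`, whence the constant 1/3.
  have h1 : ∀ r ∈ Set.Icc (0 : ℝ) 1,
      r * (∫ t in (0 : ℝ)..1, g (p + r • (q - p + t • (s - q)))) ≤ I * r ^ 2 := by
    intro r hr
    have h2 : (∫ t in (0 : ℝ)..1, g (p + r • (q - p + t • (s - q)))) ≤ r * I := by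
      rw [hI, ← intervalIntegral.integral_const_mul]
      refine intervalIntegral.integral_mono_on zero_le_one
        (Continuous.intervalIntegrable (by fun_prop) _ _)
        (Continuous.intervalIntegrable (by fun_prop) _ _) fun t _ => ?_
      have := hconv.2 (Set.mem_univ p) (Set.mem_univ (q + t • (s - q)))
        (sub_nonneg.2 hr.2) hr.1 (sub_add_cancel 1 r)
      rw [h0, smul_zero, zero_add, smul_eq_mul] at this
      have e : p + r • (q - p + t • (s - q)) = (1 - r) • p + r • (q + t • (s - q)) := by module
      rw [e]
      exact this
    calc _ ≤ r * (r * I) := mul_le_mul_of_nonneg_left h2 hr.1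
      _ = _ := by ring
  have hc : Continuous fun r : ℝ =>
      r * (∫ t in (0 : ℝ)..1, g (p + r • (q - p + t • (s - q)))) :=
    continuous_id.mul (intervalIntegral.continuous_parametric_intervalIntegral_of_continuous'
      (by fun_prop) 0 1)
  calc _ ≤ ∫ r in (0 : ℝ)..1, I * r ^ 2 :=
        intervalIntegral.integral_mono_on zero_le_one (hc.intervalIntegrable _ _)
          (Continuous.intervalIntegrable (by fun_prop) _ _) h1
    _ = I / 3 := by
        rw [intervalIntegral.integral_const_mul, integral_pow]
        norm_num
        ring

/-! ### Normal form of a convex quadrilateral -/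

/-- The vertices `v 0, v 1, v 2, v 3` of a convex quadrilateral in cyclic order; `(m, n)` are the
coordinates of `v 2` in the frame at `v 0` spanned by the two adjacent sides. -/
structure IsQuad (v : Fin 4 → Plane) (m n : ℝ) : Prop where
  m_pos : 0 < m
  n_pos : 0 < n
  one_lt : 1 < m + n
  cross_ne : cross (v 1 - v 0) (v 3 - v 0) ≠ 0
  eq : v 2 = v 0 + m • (v 1 - v 0) + n • (v 3 - v 0)

/-- The convex hull of four points. -/
def quad (v : Fin 4 → Plane) : Set Plane := convexHull ℝ (Set.range v)

/-- The point with given coordinates in the frame at `v 0`. -/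
def pt (v : Fin 4 → Plane) (x y : ℝ) : Plane := v 0 + x • (v 1 - v 0) + y • (v 3 - v 0)

/-- The affine function with given values at `v 0`, `v 1`, `v 3`. -/
noncomputable def interp (v : Fin 4 → Plane) (a b c : ℝ) : AffFun where
  toFun z := a + ((b - a) * cross (z - v 0) (v 3 - v 0) + (c - a) * cross (v 1 - v 0) (z - v 0)) /
    cross (v 1 - v 0) (v 3 - v 0)
  linear :=
    { toFun := fun z => ((b - a) * cross z (v 3 - v 0) + (c - a) * cross (v 1 - v 0) z) /
        cross (v 1 - v 0) (v 3 - v 0)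
      map_add' := fun x y => by simp only [cross, PiLp.add_apply]; ring
      map_smul' := fun r x => by
        simp only [cross, PiLp.smul_apply, smul_eq_mul, RingHom.id_apply]; ring }
  map_vadd' z w := by
    simp only [cross, vadd_eq_add, PiLp.add_apply, PiLp.sub_apply, LinearMap.coe_mk,
      AddHom.coe_mk]
    ring

lemma apply_pt (f : AffFun) (v : Fin 4 → Plane) (x y : ℝ) :
    f (pt v x y) = f (v 0) + x * (f (v 1) - f (v 0)) + y * (f (v 3) - f (v 0)) := by
  rw [pt, apply_add, apply_add, map_smul, map_smul, linear_sub, linear_sub, smul_eq_mul,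
    smul_eq_mul]

lemma pt_zero_zero (v : Fin 4 → Plane) : pt v 0 0 = v 0 := by simp [pt]

lemma pt_one_zero (v : Fin 4 → Plane) : pt v 1 0 = v 1 := by simp [pt]

lemma pt_zero_one (v : Fin 4 → Plane) : pt v 0 1 = v 3 := by simp [pt]

namespace IsQuad

variable {v : Fin 4 → Plane} {m n : ℝ}

lemma pt_eq (h : IsQuad v m n) : pt v m n = v 2 := h.eq.symm

lemma interp_pt (h : IsQuad v m n) (a b c x y : ℝ) :
    interp v a b c (pt v x y) = a + x * (b - a) + y * (c - a) := by
  have hJ := h.cross_ne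
  change a + ((b - a) * cross (pt v x y - v 0) (v 3 - v 0) +
    (c - a) * cross (v 1 - v 0) (pt v x y - v 0)) / cross (v 1 - v 0) (v 3 - v 0) = _
  have e1 : cross (pt v x y - v 0) (v 3 - v 0) = x * cross (v 1 - v 0) (v 3 - v 0) := by
    simp only [cross, pt, PiLp.add_apply, PiLp.sub_apply, PiLp.smul_apply, smul_eq_mul]
    ring
  have e2 : cross (v 1 - v 0) (pt v x y - v 0) = y * cross (v 1 - v 0) (v 3 - v 0) := by
    simp only [cross, pt, PiLp.add_apply, PiLp.sub_apply, PiLp.smul_apply, smul_eq_mul]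
    ring
  rw [e1, e2]
  field_simp
  ring

lemma interp_zero (h : IsQuad v m n) (a b c : ℝ) : interp v a b c (v 0) = a := by
  rw [← pt_zero_zero v, h.interp_pt]; ring

lemma interp_one (h : IsQuad v m n) (a b c : ℝ) : interp v a b c (v 1) = b := by
  rw [← pt_one_zero v, h.interp_pt]; ring

lemma interp_three (h : IsQuad v m n) (a b c : ℝ) : interp v a b c (v 3) = c := by
  rw [← pt_zero_one v, h.interp_pt]; ring

lemma apply_two (h : IsQuad v m n) (f : AffFun) :
    f (v 2) = f (v 0) + m * (f (v 1) - f (v 0)) + n * (f (v 3) - f (v 0)) := by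
  rw [← h.pt_eq, apply_pt]

lemma exists_pt (h : IsQuad v m n) (z : Plane) : ∃ x y, z = pt v x y := by
  have hJ := h.cross_ne
  refine ⟨cross (z - v 0) (v 3 - v 0) / cross (v 1 - v 0) (v 3 - v 0),
    cross (v 1 - v 0) (z - v 0) / cross (v 1 - v 0) (v 3 - v 0), ?_⟩
  ext i
  simp only [pt, PiLp.add_apply, PiLp.sub_apply, PiLp.smul_apply, smul_eq_mul]
  field_simp
  simp only [cross, PiLp.sub_apply]
  fin_cases i <;> simp only [Fin.zero_eta, Fin.mk_one] <;> ring

lemma affFun_ext (h : IsQuad v m n) {f g : AffFun} (h0 : f (v 0) = g (v 0))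
    (h1 : f (v 1) = g (v 1)) (h3 : f (v 3) = g (v 3)) : f = g := by
  ext z
  obtain ⟨x, y, rfl⟩ := h.exists_pt z
  rw [apply_pt, apply_pt, h0, h1, h3]

end IsQuad

lemma convex_setOf_nonneg (f : AffFun) : Convex ℝ {z | 0 ≤ f z} :=
  (convex_Ici (0 : ℝ)).affine_preimage f

lemma tri_subset {S : Set Plane} (hS : Convex ℝ S) {p q s : Plane} (hp : p ∈ S) (hq : q ∈ S)
    (hs : s ∈ S) : tri p q s ⊆ S := by
  rintro _ ⟨⟨r, y⟩, ⟨hr, hy⟩, rfl⟩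
  have := hS.sum_mem (t := Finset.univ) (w := ![1 - r, r - y, y]) (z := ![p, q, s])
    (by
      intro i _
      fin_cases i
      · simpa using hr.2
      · simpa using hy.2
      · simpa using hy.1)
    (by simp [Fin.sum_univ_three])
    (by intro i _; fin_cases i <;> simpa)
  simp only [Fin.sum_univ_three, Matrix.cons_val_zero, Matrix.cons_val_one, Matrix.cons_val] at this
  convert this using 1
  module

lemma vertex_mem_quad (v : Fin 4 → Plane) (i : Fin 4) : v i ∈ quad v :=
  subset_convexHull ℝ _ (Set.mem_range_self i)

lemma convex_quad (v : Fin 4 → Plane) : Convex ℝ (quad v) := convex_convexHull ℝ _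

lemma isCompact_quad (v : Fin 4 → Plane) : IsCompact (quad v) :=
  (Set.finite_range v).isCompact_convexHull ℝ

lemma nonneg_of_mem_quad {v : Fin 4 → Plane} {f : AffFun} (hf : ∀ i, 0 ≤ f (v i)) {z : Plane}
    (hz : z ∈ quad v) : 0 ≤ f z := by
  refine convexHull_min ?_ (convex_setOf_nonneg f) hz
  rintro _ ⟨i, rfl⟩
  exact hf i

lemma pos_of_mem_quad {v : Fin 4 → Plane} {f : AffFun} (hf : ∀ i, 0 < f (v i)) {z : Plane}
    (hz : z ∈ quad v) : 0 < f z := by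
  refine convexHull_min ?_ ((convex_Ioi (0 : ℝ)).affine_preimage f) hz
  rintro _ ⟨i, rfl⟩
  exact hf i

/-! ### Side functions and the decomposition along a diagonal -/

/-- Affine functions defining the sides `v i, v (i + 1)` of a quadrilateral. -/
noncomputable def sideFun (v : Fin 4 → Plane) (m n : ℝ) : Fin 4 → AffFun :=
  ![interp v 0 0 1, interp v n 0 (m + n - 1), interp v m (m + n - 1) 0, interp v 0 1 0]

namespace IsQuad

variable {v : Fin 4 → Plane} {m n : ℝ}

lemma sideFun_pt (h : IsQuad v m n) (x y : ℝ) (i : Fin 4) :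
    sideFun v m n i (pt v x y) = ![y, n - n * x + (m - 1) * y, m + (n - 1) * x - m * y, x] i := by
  fin_cases i <;> simp [sideFun, h.interp_pt] <;> ring

lemma vertex_eq_pt (h : IsQuad v m n) (j : Fin 4) : v j = pt v (![0, 1, m, 0] j) (![0, 0, n, 1] j) := by
  fin_cases j
  · exact (pt_zero_zero v).symm
  · exact (pt_one_zero v).symm
  · exact h.pt_eq.symm
  · exact (pt_zero_one v).symm

lemma sideFun_vertex (h : IsQuad v m n) (i j : Fin 4) :
    sideFun v m n i (v j) = ![![0, 0, n, 1], ![n, 0, 0, m + n - 1], ![m, m + n - 1, 0, 0],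
      ![0, 1, m, 0]] i j := by
  rw [h.vertex_eq_pt j, h.sideFun_pt]
  fin_cases i <;> fin_cases j <;> simp <;> ring

lemma sideFun_self (h : IsQuad v m n) (i : Fin 4) : sideFun v m n i (v i) = 0 := by
  rw [h.sideFun_vertex]; fin_cases i <;> rfl

lemma sideFun_succ (h : IsQuad v m n) (i : Fin 4) : sideFun v m n i (v (i + 1)) = 0 := by
  rw [h.sideFun_vertex]; fin_cases i <;> rfl

lemma sideFun_pos_two (h : IsQuad v m n) (i : Fin 4) : 0 < sideFun v m n i (v (i + 2)) := by
  have h1 := h.m_pos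
  have h2 := h.n_pos
  have h3 := h.one_lt
  rw [h.sideFun_vertex]
  fin_cases i
  · exact h2
  · change 0 < m + n - 1; linarith
  · exact h1
  · exact one_pos

lemma sideFun_pos_three (h : IsQuad v m n) (i : Fin 4) : 0 < sideFun v m n i (v (i + 3)) := by
  have h1 := h.m_pos
  have h2 := h.n_pos
  have h3 := h.one_lt
  rw [h.sideFun_vertex]
  fin_cases i
  · exact one_pos
  · exact h2
  · change 0 < m + n - 1; linarith
  · exact h1

lemma sideFun_nonneg (h : IsQuad v m n) (i j : Fin 4) : 0 ≤ sideFun v m n i (v j) := by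
  have e : j = i ∨ j = i + 1 ∨ j = i + 2 ∨ j = i + 3 := by decide +revert
  rcases e with rfl | rfl | rfl | rfl
  · exact (h.sideFun_self _).ge
  · exact (h.sideFun_succ _).ge
  · exact (h.sideFun_pos_two _).le
  · exact (h.sideFun_pos_three _).le

lemma setOf_sideFun_subset (h : IsQuad v m n) :
    {z | ∀ i, 0 ≤ sideFun v m n i z} ⊆ tri (v 0) (v 1) (v 2) ∪ tri (v 0) (v 2) (v 3) := by
  have hm := h.m_pos
  have hn := h.n_pos
  intro z hz
  obtain ⟨x, y, rfl⟩ := h.exists_pt z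
  have hz' : ∀ i, 0 ≤ ![y, n - n * x + (m - 1) * y, m + (n - 1) * x - m * y, x] i :=
    fun i => (hz i).trans_eq (h.sideFun_pt x y i)
  have h0 : 0 ≤ y := hz' 0
  have h1 : 0 ≤ n - n * x + (m - 1) * y := hz' 1
  have h2 : 0 ≤ m + (n - 1) * x - m * y := hz' 2
  have h3 : 0 ≤ x := hz' 3
  -- The diagonal from `v 0` to `v 2` is `n x = m y`. The witnesses solve for the triangle
  -- coordinates on either side of it, and the bounds on them are the four side inequalities.
  rcases le_total (m * y) (n * x) with hc | hc
  · left
    refine ⟨((n * x - m * y + y) / n, y / n), ⟨⟨?_, ?_⟩, ?_, ?_⟩, ?_⟩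
    · exact div_nonneg (by linarith) hn.le
    · rw [div_le_one hn]; linarith
    · exact div_nonneg h0 hn.le
    · exact div_le_div_of_nonneg_right (by linarith) hn.le
    · simp only
      rw [h.eq, pt]
      match_scalars <;> field_simp <;> ring
  · right
    refine ⟨((x + (m * y - n * x)) / m, (m * y - n * x) / m), ⟨⟨?_, ?_⟩, ?_, ?_⟩, ?_⟩
    · exact div_nonneg (by linarith) hm.le
    · rw [div_le_one hm]; linarith
    · exact div_nonneg (by linarith) hm.le
    · exact div_le_div_of_nonneg_right (by linarith) hm.le
    · simp only
      rw [h.eq, pt]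
      match_scalars <;> field_simp <;> ring

lemma quad_eq_setOf (h : IsQuad v m n) : quad v = {z | ∀ i, 0 ≤ sideFun v m n i z} := by
  refine Set.Subset.antisymm (fun z hz i => nonneg_of_mem_quad (h.sideFun_nonneg i) hz) ?_
  refine h.setOf_sideFun_subset.trans (Set.union_subset ?_ ?_) <;>
    exact tri_subset (convex_quad v) (vertex_mem_quad v _) (vertex_mem_quad v _)
      (vertex_mem_quad v _)

lemma quad_eq_union (h : IsQuad v m n) :
    quad v = tri (v 0) (v 1) (v 2) ∪ tri (v 0) (v 2) (v 3) := by
  refine Set.Subset.antisymm (h.quad_eq_setOf.subset.trans h.setOf_sideFun_subset)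
    (Set.union_subset ?_ ?_) <;>
    exact tri_subset (convex_quad v) (vertex_mem_quad v _) (vertex_mem_quad v _)
      (vertex_mem_quad v _)

end IsQuad

/-! ### Second moments of a quadrilateral -/

lemma volume_zeroSet {a : AffFun} (ha : a.linear ≠ 0) : volume {z | a z = 0} = 0 := by
  rcases Set.eq_empty_or_nonempty {z | a z = 0} with he | ⟨p, hp⟩
  · rw [he, measure_empty]
  let s : AffineSubspace ℝ Plane := AffineSubspace.mk' p (LinearMap.ker a.linear)
  have hs : s ≠ ⊤ := by
    intro h
    have h1 : s.direction = ⊤ := by rw [h, AffineSubspace.direction_top]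
    rw [AffineSubspace.direction_mk'] at h1
    exact ha (LinearMap.ker_eq_top.1 h1)
  refine measure_mono_null ?_ (Measure.addHaar_affineSubspace volume s hs)
  intro z hz
  change z ∈ AffineSubspace.mk' p _
  rw [AffineSubspace.mem_mk', vsub_eq_sub, LinearMap.mem_ker, linear_sub,
    show a z = 0 from hz, show a p = 0 from hp, sub_zero]

namespace IsQuad

variable {v : Fin 4 → Plane} {m n : ℝ}

/-- The function `n x - m y` is nonnegative on one triangle and nonpositive on the other, so they
meet only along the diagonal. -/
lemma volume_inter_tri (h : IsQuad v m n) :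
    volume (tri (v 0) (v 1) (v 2) ∩ tri (v 0) (v 2) (v 3)) = 0 := by
  have ha : (interp v 0 n (-m)).linear ≠ 0 := by
    intro h0
    have := linear_sub (interp v 0 n (-m)) (v 1) (v 0)
    rw [h0, h.interp_one, h.interp_zero, LinearMap.zero_apply] at this
    linarith [h.n_pos]
  refine measure_mono_null ?_ (volume_zeroSet ha)
  rintro z ⟨hz1, hz2⟩
  have e2 : interp v 0 n (-m) (v 2) = 0 := by rw [← h.pt_eq, h.interp_pt]; ring
  refine le_antisymm ?_ ?_
  · have h2 : 0 ≤ (-interp v 0 n (-m)) z := by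
      refine tri_subset (convex_setOf_nonneg (-interp v 0 n (-m))) ?_ ?_ ?_ hz2
      · simp [h.interp_zero]
      · simp [e2]
      · simpa [h.interp_three] using h.m_pos.le
    simpa using h2
  · refine tri_subset (convex_setOf_nonneg (interp v 0 n (-m))) ?_ ?_ ?_ hz1
    · simp [h.interp_zero]
    · simpa [h.interp_one] using h.n_pos.le
    · simp [e2]

lemma cross_one_two (h : IsQuad v m n) :
    cross (v 1 - v 0) (v 2 - v 1) = n * cross (v 1 - v 0) (v 3 - v 0) := by
  rw [h.eq]
  simp only [cross, PiLp.add_apply, PiLp.sub_apply, PiLp.smul_apply, smul_eq_mul]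
  ring

lemma cross_two_three (h : IsQuad v m n) :
    cross (v 2 - v 0) (v 3 - v 2) = m * cross (v 1 - v 0) (v 3 - v 0) := by
  rw [h.eq]
  simp only [cross, PiLp.add_apply, PiLp.sub_apply, PiLp.smul_apply, smul_eq_mul]
  ring

/-- The integral over a quadrilateral of the product of two affine functions. -/
lemma setIntegral_mul (h : IsQuad v m n) (a b : AffFun) :
    ∫ z in quad v, a z * b z = |cross (v 1 - v 0) (v 3 - v 0)| / 24 *
      (n * ((a (v 0) + a (v 1) + a (v 2)) * (b (v 0) + b (v 1) + b (v 2)) +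
          a (v 0) * b (v 0) + a (v 1) * b (v 1) + a (v 2) * b (v 2)) +
        m * ((a (v 0) + a (v 2) + a (v 3)) * (b (v 0) + b (v 2) + b (v 3)) +
          a (v 0) * b (v 0) + a (v 2) * b (v 2) + a (v 3) * b (v 3))) := by
  have hc : Continuous fun z => a z * b z := (continuous_affFun a).mul (continuous_affFun b)
  rw [h.quad_eq_union, setIntegral_union₀ h.volume_inter_tri
      (isCompact_tri _ _ _).measurableSet.nullMeasurableSet
      (hc.continuousOn.integrableOn_compact (isCompact_tri _ _ _))
      (hc.continuousOn.integrableOn_compact (isCompact_tri _ _ _)),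
    setIntegral_tri_mul, setIntegral_tri_mul, h.cross_one_two, h.cross_two_three, abs_mul, abs_mul,
    abs_of_pos h.n_pos, abs_of_pos h.m_pos]
  · ring
  · rw [h.cross_two_three]
    exact mul_ne_zero h.m_pos.ne' h.cross_ne
  · rw [h.cross_one_two]
    exact mul_ne_zero h.n_pos.ne' h.cross_ne

end IsQuad

lemma exists_weights {v : Fin 4 → Plane} {z : Plane} (hz : z ∈ quad v) :
    ∃ w : Fin 4 → ℝ, (∀ i, 0 ≤ w i) ∧ ∑ i, w i = 1 ∧ z = ∑ i, w i • v i := by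
  let S : Set Plane := {z | ∃ w : Fin 4 → ℝ, (∀ i, 0 ≤ w i) ∧ ∑ i, w i = 1 ∧ z = ∑ i, w i • v i}
  have hS : Convex ℝ S := by
    rintro x ⟨w, hw0, hw1, rfl⟩ y ⟨w', hw0', hw1', rfl⟩ a b ha hb hab
    refine ⟨fun i => a * w i + b * w' i, fun i => ?_, ?_, ?_⟩
    · exact add_nonneg (mul_nonneg ha (hw0 i)) (mul_nonneg hb (hw0' i))
    · rw [Finset.sum_add_distrib, ← Finset.mul_sum, ← Finset.mul_sum, hw1, hw1', mul_one, mul_one,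
        hab]
    · simp only [add_smul, mul_smul, Finset.sum_add_distrib, Finset.smul_sum]
  refine convexHull_min ?_ hS hz
  rintro _ ⟨i, rfl⟩
  refine ⟨Pi.single i 1, fun j => ?_, by simp, ?_⟩
  · by_cases h : j = i
    · subst h; simp
    · simp [h]
  · simp [Pi.single_apply, ite_smul]

lemma apply_sum (a : AffFun) {v : Fin 4 → Plane} {w : Fin 4 → ℝ} (hw : ∑ i, w i = 1) :
    a (∑ i, w i • v i) = ∑ i, w i * a (v i) := by
  have h : ∀ z, a z = a 0 + a.linear z := fun z => by rw [← apply_add, zero_add]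
  rw [h, map_sum]
  simp only [map_smul, smul_eq_mul]
  simp only [h (v _), mul_add, Finset.sum_add_distrib, ← Finset.sum_mul, hw, one_mul]

/-! ### The boundary measure and the classification of affine normals -/

/-- Integration over a segment with respect to length. -/
lemma setIntegral_segment (p q : Plane) (f : Plane → ℝ) :
    ∫ z in segment ℝ p q, f z ∂(Measure.hausdorffMeasure 1) =
      ‖q - p‖ * ∫ t in (0 : ℝ)..1, f (p + t • (q - p)) := by
  rcases eq_or_ne p q with rfl | hpq
  · rw [segment_same, sub_self, norm_zero, zero_mul]
    refine setIntegral_measure_zero _ ?_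
    have := hausdorffMeasure_segment p p
    rwa [segment_same, edist_self] at this
  have hpos : 0 < ‖q - p‖ := norm_pos_iff.2 (sub_ne_zero.2 hpq.symm)
  set l := ‖q - p‖ with hl
  -- The unit-speed parametrization is an isometry, so it carries one-dimensional Hausdorff measure,
  -- which on `ℝ` is Lebesgue measure, to length on the segment.
  let γ : ℝ → Plane := fun t => p + t • (l⁻¹ • (q - p))
  have hγ : Isometry γ := by
    refine Isometry.of_dist_eq fun s t => ?_
    rw [dist_eq_norm, dist_eq_norm]
    have : γ s - γ t = (s - t) • (l⁻¹ • (q - p)) := by simp only [γ]; module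
    rw [this, norm_smul, norm_smul, norm_inv, norm_norm, ← hl, inv_mul_cancel₀ hpos.ne', mul_one]
  have hseg : segment ℝ p q = γ '' Set.Icc 0 l := by
    rw [segment_eq_image']
    ext z
    constructor
    · rintro ⟨t, ht, rfl⟩
      refine ⟨t * l, ⟨mul_nonneg ht.1 hpos.le, mul_le_of_le_one_left hpos.le ht.2⟩, ?_⟩
      simp only [γ, smul_smul]
      rw [mul_assoc, mul_inv_cancel₀ hpos.ne', mul_one]
    · rintro ⟨t, ht, rfl⟩
      refine ⟨t / l, ⟨div_nonneg ht.1 hpos.le, (div_le_one hpos).2 ht.2⟩, ?_⟩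
      simp only [γ, smul_smul, div_eq_mul_inv]
  have hcl : MeasurableSet (γ '' Set.Icc 0 l) :=
    (isCompact_Icc.image hγ.continuous).measurableSet
  have hmap : ((Measure.hausdorffMeasure 1 : Measure Plane)).restrict (γ '' Set.Icc 0 l) =
      (Measure.map γ volume).restrict (γ '' Set.Icc 0 l) := by
    rw [← hausdorffMeasure_real, hγ.map_hausdorffMeasure (Or.inl zero_le_one),
      Measure.restrict_restrict hcl, Set.inter_eq_self_of_subset_left (Set.image_subset_range _ _)]
  rw [hseg, hmap, hγ.isClosedEmbedding.measurableEmbedding.setIntegral_map,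
    Set.preimage_image_eq _ hγ.injective, integral_Icc_eq_integral_Ioc,
    ← intervalIntegral.integral_of_le hpos.le]
  have h3 := intervalIntegral.mul_integral_comp_mul_left (f := fun y => f (γ y))
    (a := 0) (b := 1) l
  rw [mul_zero, mul_one] at h3
  rw [← h3]
  congr 1
  refine intervalIntegral.integral_congr fun t _ => ?_
  simp only [γ, smul_smul]
  rw [mul_right_comm, mul_inv_cancel₀ hpos.ne', one_mul]

/-- The mean of a function over the side from `v i` to `v (i + 1)`. -/
noncomputable def sideInt (v : Fin 4 → Plane) (i : Fin 4) (f : Plane → ℝ) : ℝ :=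
  ∫ t in (0 : ℝ)..1, f (v i + t • (v (i + 1) - v i))

/-- The total mass of the boundary measure on a side, for the standard side functions. -/
noncomputable def sideWeight (v : Fin 4 → Plane) (m n : ℝ) (i : Fin 4) : ℝ :=
  (gradNorm (sideFun v m n i))⁻¹ * ‖v (i + 1) - v i‖

lemma gradNorm_smul {c : ℝ} (hc : 0 < c) (a : AffFun) : gradNorm (c • a) = c * gradNorm a := by
  have : LinearMap.toContinuousLinearMap (c • a).linear =
      c • LinearMap.toContinuousLinearMap a.linear := by ext; rfl
  rw [gradNorm, gradNorm, this, norm_smul, Real.norm_of_nonneg hc.le]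

lemma gradNorm_nonneg (a : AffFun) : 0 ≤ gradNorm a := norm_nonneg _

lemma gradNorm_pos {a : AffFun} (ha : a.linear ≠ 0) : 0 < gradNorm a := by
  refine norm_pos_iff.2 fun h => ha ?_
  ext x
  exact DFunLike.congr_fun h x

lemma facet_smul (Δ : Set Plane) {c : ℝ} (hc : 0 < c) (a : AffFun) :
    facet Δ (c • a) = facet Δ a := by
  ext z
  simp [facet, hc.ne']

namespace IsQuad

variable {v : Fin 4 → Plane} {m n : ℝ}

/-- A zero of the side function in the quadrilateral is a convex combination of the vertices, and
the two vertices off the side, where the function is positive, must carry weight zero. -/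
lemma facet_sideFun (h : IsQuad v m n) (i : Fin 4) :
    facet (quad v) (sideFun v m n i) = segment ℝ (v i) (v (i + 1)) := by
  apply Set.Subset.antisymm
  · rintro z ⟨hz, hz0⟩
    obtain ⟨w, hw0, hw1, rfl⟩ := exists_weights hz
    replace hz0 : sideFun v m n i (∑ j, w j • v j) = 0 := hz0
    have hsum : ∀ g : Fin 4 → ℝ, ∑ j, g j = g i + g (i + 1) + g (i + 2) + g (i + 3) := by
      intro g
      rw [Fin.sum_univ_four]
      fin_cases i
      · rfl
      · change _ = g 1 + g 2 + g 3 + g 0; ring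
      · change _ = g 2 + g 3 + g 0 + g 1; ring
      · change _ = g 3 + g 0 + g 1 + g 2; ring
    have hsum' : ∀ g : Fin 4 → Plane, ∑ j, g j = g i + g (i + 1) + g (i + 2) + g (i + 3) := by
      intro g
      rw [Fin.sum_univ_four]
      fin_cases i
      · rfl
      · change _ = g 1 + g 2 + g 3 + g 0; abel
      · change _ = g 2 + g 3 + g 0 + g 1; abel
      · change _ = g 3 + g 0 + g 1 + g 2; abel
    rw [apply_sum _ hw1, hsum, h.sideFun_self, h.sideFun_succ, mul_zero, mul_zero, add_zero,
      zero_add] at hz0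
    have p2 := h.sideFun_pos_two i
    have p3 := h.sideFun_pos_three i
    have q2 := mul_nonneg (hw0 (i + 2)) p2.le
    have q3 := mul_nonneg (hw0 (i + 3)) p3.le
    have r2 : w (i + 2) = 0 :=
      (mul_eq_zero.1 (le_antisymm (by linarith) q2)).resolve_right p2.ne'
    have r3 : w (i + 3) = 0 :=
      (mul_eq_zero.1 (le_antisymm (by linarith) q3)).resolve_right p3.ne'
    rw [hsum, r2, r3, add_zero, add_zero] at hw1
    refine ⟨w i, w (i + 1), hw0 _, hw0 _, hw1, ?_⟩
    rw [hsum', r2, r3]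
    simp
  · intro z hz
    refine ⟨(convex_quad v).segment_subset (vertex_mem_quad v _) (vertex_mem_quad v _) hz, ?_⟩
    obtain ⟨t, _, rfl⟩ := (segment_eq_image' ℝ (v i) (v (i + 1))).subset hz
    change sideFun v m n i (v i + t • (v (i + 1) - v i)) = 0
    rw [apply_add, map_smul, linear_sub, h.sideFun_self, h.sideFun_succ]
    simp

lemma sideFun_linear_ne_zero (h : IsQuad v m n) (i : Fin 4) : (sideFun v m n i).linear ≠ 0 := by
  intro h0
  have := linear_sub (sideFun v m n i) (v (i + 2)) (v i)
  rw [h0, h.sideFun_self, LinearMap.zero_apply] at this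
  linarith [h.sideFun_pos_two i]

lemma vertex_ne (h : IsQuad v m n) (i : Fin 4) : v (i + 1) ≠ v i := by
  intro he
  have e5 := h.sideFun_self (i + 1)
  have e6 := h.sideFun_pos_three (i + 1)
  have e3 : i + 1 + 3 = i := by clear * -; decide +revert
  rw [e3, ← he, e5] at e6
  exact e6.false

lemma sideWeight_pos (h : IsQuad v m n) (i : Fin 4) : 0 < sideWeight v m n i :=
  mul_pos (inv_pos.2 (gradNorm_pos (h.sideFun_linear_ne_zero i)))
    (norm_pos_iff.2 (sub_ne_zero.2 (h.vertex_ne i)))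

/-- Scaling a normal by `c i` divides the density on its side by `c i`, and the ordering `k` drops
out. Hence the normals matter only through the four numbers `sideWeight v m n i / c i`. -/
lemma integral_boundaryMeasure (h : IsQuad v m n) {L : Fin 4 → AffFun} {k : Equiv.Perm (Fin 4)}
    {c : Fin 4 → ℝ} (hc : ∀ i, 0 < c i) (hL : ∀ i, L (k i) = c i • sideFun v m n i)
    {f : Plane → ℝ} (hf : Continuous f) :
    ∫ z, f z ∂(boundaryMeasure (quad v) L) =
      ∑ i, sideWeight v m n i / c i * sideInt v i f := by
  have hlin : ∀ j, (L j).linear ≠ 0 := by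
    intro j
    obtain ⟨i, rfl⟩ := k.surjective j
    rw [hL, AffineMap.smul_linear]
    exact smul_ne_zero (hc i).ne' (h.sideFun_linear_ne_zero i)
  unfold boundaryMeasure
  rw [integral_finsetSum_measure]
  · rw [← Equiv.sum_comp k]
    refine Finset.sum_congr rfl fun i _ => ?_
    rw [integral_smul_measure, hL, facet_smul _ (hc i), h.facet_sideFun, setIntegral_segment,
      gradNorm_smul (hc i), ENNReal.toReal_ofReal
        (inv_nonneg.2 (mul_nonneg (hc i).le (gradNorm_nonneg _))), sideWeight, sideInt,
      smul_eq_mul, mul_inv]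
    ring
  · intro j _
    refine Integrable.smul_measure ?_ ENNReal.ofReal_ne_top
    have hcm : IsCompact (facet (quad v) (L j)) :=
      (isCompact_quad v).inter_right (isClosed_eq (continuous_affFun (L j)) continuous_const)
    exact hf.continuousOn.integrableOn_of_subset_isCompact hcm hcm.measurableSet subset_rfl
      (hausdorffMeasure_facet_lt_top (isCompact_quad v) (hlin j)).ne

/-- Two opposite side functions have positive sum on the quadrilateral, so at any of its points at
most two side functions vanish, and those belong to adjacent sides. -/
lemma isAffineNormals (h : IsQuad v m n) {L : Fin 4 → AffFun} {k : Equiv.Perm (Fin 4)}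
    {c : Fin 4 → ℝ} (hc : ∀ i, 0 < c i) (hL : ∀ i, L (k i) = c i • sideFun v m n i) :
    IsAffineNormals (quad v) L := by
  have hsum : ∀ i, ∀ z ∈ quad v, 0 < sideFun v m n i z + sideFun v m n (i + 2) z := by
    intro i z hz
    have := pos_of_mem_quad (f := sideFun v m n i + sideFun v m n (i + 2)) (fun j => ?_) hz
    · simpa using this
    have e : j = i ∨ j = i + 1 ∨ j = i + 2 ∨ j = i + 3 := by clear * -; decide +revert
    have e0 : i + 2 + 2 = i := by clear * -; decide +revert
    have e1 : i + 2 + 3 = i + 1 := by clear * -; decide +revert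
    have p1 := h.sideFun_pos_two i
    have p2 := h.sideFun_pos_three i
    have p3 := h.sideFun_pos_two (i + 2)
    have p4 := h.sideFun_pos_three (i + 2)
    rw [e0] at p3
    rw [e1] at p4
    rw [AffineMap.coe_add, Pi.add_apply]
    rcases e with rfl | rfl | rfl | rfl
    · exact add_pos_of_nonneg_of_pos (h.sideFun_nonneg _ _) p3
    · exact add_pos_of_nonneg_of_pos (h.sideFun_nonneg _ _) p4
    · exact add_pos_of_pos_of_nonneg p1 (h.sideFun_nonneg _ _)
    · exact add_pos_of_pos_of_nonneg p2 (h.sideFun_nonneg _ _)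
  refine ⟨?_, ?_, ?_⟩
  · rw [h.quad_eq_setOf]
    ext z
    refine ⟨fun hz j => ?_, fun hz i => ?_⟩
    · obtain ⟨i, rfl⟩ := k.surjective j
      rw [hL]
      exact mul_nonneg (hc i).le (hz i)
    · have := hz (k i)
      rw [hL] at this
      exact nonneg_of_mul_nonneg_right this (hc i)
  · intro j
    obtain ⟨i, rfl⟩ := k.surjective j
    exact ⟨v i, vertex_mem_quad v i, by rw [hL]; simp [h.sideFun_self]⟩
  · intro z hz
    have hzero : ∀ i, L (k i) z = 0 ↔ sideFun v m n i z = 0 := by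
      intro i
      rw [hL]
      simp [(hc i).ne']
    rw [Fintype.linearIndependent_iff]
    rintro g hg ⟨j, hj⟩
    obtain ⟨i, rfl⟩ := k.surjective j
    have hi := (hzero i).1 hj
    -- a direction along which the other active function, if any, is constant
    obtain ⟨d, hd, hd'⟩ : ∃ d : Plane, (sideFun v m n i).linear d ≠ 0 ∧
        ∀ i', i' ≠ i → sideFun v m n i' z = 0 → (sideFun v m n i').linear d = 0 := by
      have h2 : sideFun v m n (i + 2) z ≠ 0 := by
        have := hsum i z hz
        rw [hi, zero_add] at this
        exact this.ne'
      have h13 := hsum (i + 1) z hz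
      have e3 : i + 1 + 2 = i + 3 := by clear * -; decide +revert
      rw [e3] at h13
      by_cases h1 : sideFun v m n (i + 1) z = 0
      · refine ⟨v (i + 2) - v (i + 1), ?_, ?_⟩
        · rw [linear_sub, h.sideFun_succ, sub_zero]
          exact (h.sideFun_pos_two i).ne'
        · intro i' hne hi'
          have e : i' = i ∨ i' = i + 1 ∨ i' = i + 2 ∨ i' = i + 3 := by clear * -; decide +revert
          rcases e with rfl | rfl | rfl | rfl
          · exact absurd rfl hne
          · have e : i + 2 = i + 1 + 1 := by clear * -; decide +revert
            rw [linear_sub, h.sideFun_self, e, h.sideFun_succ, sub_zero]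
          · exact absurd hi' h2
          · rw [h1, hi', add_zero] at h13
            exact absurd h13 (lt_irrefl 0)
      · refine ⟨v (i + 3) - v i, ?_, ?_⟩
        · rw [linear_sub, h.sideFun_self, sub_zero]
          exact (h.sideFun_pos_three i).ne'
        · intro i' hne hi'
          have e : i' = i ∨ i' = i + 1 ∨ i' = i + 2 ∨ i' = i + 3 := by clear * -; decide +revert
          rcases e with rfl | rfl | rfl | rfl
          · exact absurd rfl hne
          · exact absurd hi' h1
          · exact absurd hi' h2
          · have e := h.sideFun_succ (i + 3)
            have e' : i + 3 + 1 = i := by clear * -; decide +revert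
            rw [e'] at e
            rw [linear_sub, h.sideFun_self, e, sub_zero]
    have h1 := LinearMap.congr_fun hg d
    rw [LinearMap.sum_apply, Finset.sum_eq_single ⟨k i, hj⟩] at h1
    · rw [LinearMap.smul_apply, hL, AffineMap.smul_linear, LinearMap.smul_apply, smul_eq_mul,
        smul_eq_mul, LinearMap.zero_apply] at h1
      exact (mul_eq_zero.1 h1).resolve_right (mul_ne_zero (hc i).ne' hd)
    · rintro ⟨j', hj'⟩ _ hne
      obtain ⟨i', rfl⟩ := k.surjective j'
      have hne' : i' ≠ i := fun h => hne (by simp [h])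
      rw [LinearMap.smul_apply, hL, AffineMap.smul_linear, LinearMap.smul_apply,
        hd' i' hne' ((hzero i').1 hj'), smul_zero, smul_zero]
    · exact fun h => absurd (Finset.mem_univ _) h

/-- Affine normals are unique up to order and positive rescaling. -/
lemma exists_of_isAffineNormals (h : IsQuad v m n) {L : Fin 4 → AffFun}
    (hLn : IsAffineNormals (quad v) L) :
    ∃ (k : Equiv.Perm (Fin 4)) (c : Fin 4 → ℝ), (∀ i, 0 < c i) ∧
      ∀ i, L (k i) = c i • sideFun v m n i := by
  have hnn : ∀ j, ∀ z ∈ quad v, 0 ≤ L j z := by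
    intro j z hz
    rw [hLn.eq_setOf] at hz
    exact hz j
  -- Otherwise every `L j` is positive at the midpoint `M` of the side. Then `M` can be pushed
  -- slightly away from `v (i + 2)` without leaving the quadrilateral, although the side function
  -- becomes negative.
  have hex : ∀ i, ∃ j, L j (v i) = 0 ∧ L j (v (i + 1)) = 0 := by
    intro i
    by_contra! hcon
    set M := v i + (2⁻¹ : ℝ) • (v (i + 1) - v i) with hM
    have hMpos : ∀ j, 0 < L j M := by
      intro j
      have h1 := hnn j _ (vertex_mem_quad v i)
      have h2 := hnn j _ (vertex_mem_quad v (i + 1))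
      rw [hM, apply_add, map_smul, linear_sub, smul_eq_mul]
      rcases h1.eq_or_lt with h0 | h0
      · have := lt_of_le_of_ne h2 (hcon j h0.symm).symm
        linarith
      · linarith
    have hev : ∀ᶠ ε : ℝ in nhdsWithin 0 (Set.Ioi 0), ∀ j, 0 < L j (M + ε • (M - v (i + 2))) := by
      rw [Filter.eventually_all]
      intro j
      have hc : Continuous fun ε : ℝ => L j (M + ε • (M - v (i + 2))) :=
        (continuous_affFun (L j)).comp (by fun_prop)
      have h0 : 0 < L j (M + (0 : ℝ) • (M - v (i + 2))) := by simpa using hMpos j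
      exact (hc.continuousAt.eventually (lt_mem_nhds h0)).filter_mono nhdsWithin_le_nhds
    obtain ⟨ε, hε, hε0⟩ := (hev.and self_mem_nhdsWithin).exists
    have hmem : M + ε • (M - v (i + 2)) ∈ quad v := by
      rw [hLn.eq_setOf]
      exact fun j => (hε j).le
    have h3 := (h.quad_eq_setOf.subset hmem) i
    have h4 : sideFun v m n i M = 0 := by
      rw [hM, apply_add, map_smul, linear_sub, h.sideFun_self, h.sideFun_succ]
      simp
    rw [apply_add, map_smul, linear_sub, h4, zero_sub, zero_add, smul_eq_mul] at h3
    nlinarith [h.sideFun_pos_two i, mul_pos (Set.mem_Ioi.1 hε0) (h.sideFun_pos_two i)]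
  choose k hk0 hk1 using hex
  have hprop : ∀ i, ∃ c : ℝ, 0 < c ∧ L (k i) = c • sideFun v m n i := by
    intro i
    set c := L (k i) (v (i + 2)) / sideFun v m n i (v (i + 2)) with hcdef
    have hp := h.sideFun_pos_two i
    have heq : L (k i) = c • sideFun v m n i := by
      have g0 : (L (k i) - c • sideFun v m n i) (v i) = 0 := by
        simp [hk0, h.sideFun_self]
      have g1 : (L (k i) - c • sideFun v m n i) (v (i + 1)) = 0 := by
        simp [hk1, h.sideFun_succ]
      have g2 : (L (k i) - c • sideFun v m n i) (v (i + 2)) = 0 := by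
        simp [hcdef, div_mul_cancel₀ _ hp.ne']
      -- The difference vanishes at three of the four vertices; the relation expressing `v 2` in the
      -- frame at `v 0` gives the fourth.
      have hz : L (k i) - c • sideFun v m n i = 0 := by
        have h2 := h.apply_two (L (k i) - c • sideFun v m n i)
        set G := L (k i) - c • sideFun v m n i with hG
        have hm := h.m_pos
        have hn := h.n_pos
        have hmn := h.one_lt
        refine h.affFun_ext ?_ ?_ ?_ <;> change _ = (0 : ℝ) <;> fin_cases i
        · exact g0
        · replace g0 : G (v 1) = 0 := g0
          replace g1 : G (v 2) = 0 := g1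
          replace g2 : G (v 3) = 0 := g2
          rw [g0, g1, g2] at h2
          have : G (v 0) * (1 - m - n) = 0 := by linear_combination -h2
          exact (mul_eq_zero.1 this).resolve_right (by linarith)
        · exact g2
        · exact g1
        · exact g1
        · exact g0
        · replace g0 : G (v 2) = 0 := g0
          replace g1 : G (v 3) = 0 := g1
          replace g2 : G (v 0) = 0 := g2
          rw [g0, g1, g2] at h2
          have : G (v 1) * m = 0 := by linear_combination -h2
          exact (mul_eq_zero.1 this).resolve_right hm.ne'
        · exact g2
        · replace g0 : G (v 0) = 0 := g0
          replace g1 : G (v 1) = 0 := g1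
          replace g2 : G (v 2) = 0 := g2
          rw [g0, g1, g2] at h2
          have : G (v 3) * n = 0 := by linear_combination -h2
          exact (mul_eq_zero.1 this).resolve_right hn.ne'
        · exact g2
        · exact g1
        · exact g0
      exact sub_eq_zero.1 hz
    refine ⟨c, lt_of_le_of_ne (div_nonneg (hnn _ _ (vertex_mem_quad v _)) hp.le) fun h0 => ?_, heq⟩
    rw [← h0, zero_smul] at heq
    refine hLn.linear_ne_zero (k i) ?_
    rw [heq]
    rfl
  choose c hc hcL using hprop
  -- Proportional side functions vanish at the same vertices, and distinct sides have distinct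
  -- endpoint sets.
  have hinj : Function.Injective k := by
    intro i i' hii
    have hz : ∀ j, sideFun v m n i (v j) = 0 ↔ sideFun v m n i' (v j) = 0 := by
      intro j
      have e : c i * sideFun v m n i (v j) = c i' * sideFun v m n i' (v j) := by
        have := (hcL i).symm.trans ((congrArg L hii).trans (hcL i'))
        exact DFunLike.congr_fun this (v j)
      constructor
      · intro h0
        rw [h0, mul_zero] at e
        exact (mul_eq_zero.1 e.symm).resolve_left (hc i').ne'
      · intro h0
        rw [h0, mul_zero] at e
        exact (mul_eq_zero.1 e).resolve_left (hc i).ne'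
    have e : i' = i ∨ i' = i + 1 ∨ i' = i + 2 ∨ i' = i + 3 := by clear * -; decide +revert
    rcases e with rfl | rfl | rfl | rfl
    · rfl
    · have e : i + 1 + 1 = i + 2 := by clear * -; decide +revert
      exact absurd ((hz (i + 2)).2 (e ▸ h.sideFun_succ (i + 1))) (h.sideFun_pos_two i).ne'
    · exact absurd ((hz (i + 2)).2 (h.sideFun_self (i + 2))) (h.sideFun_pos_two i).ne'
    · exact absurd ((hz (i + 3)).2 (h.sideFun_self (i + 3))) (h.sideFun_pos_three i).ne'
  exact ⟨Equiv.ofBijective k (Finite.injective_iff_bijective.1 hinj), c, hc, hcL⟩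

end IsQuad

/-! ### The Futaki invariant in terms of side masses -/

lemma sideInt_affFun (v : Fin 4 → Plane) (i : Fin 4) (a : AffFun) :
    sideInt v i a = (a (v i) + a (v (i + 1))) / 2 := by
  have h1 : ∀ t : ℝ, a (v i + t • (v (i + 1) - v i)) =
      a (v i) + (a (v (i + 1)) - a (v i)) * t + 0 * t ^ 2 + 0 * t ^ 3 := by
    intro t
    rw [apply_add, map_smul, linear_sub, smul_eq_mul]
    ring
  simp only [sideInt, h1]
  rw [integral_cubic]
  ring

lemma sideInt_sub (v : Fin 4 → Plane) (i : Fin 4) {f g : Plane → ℝ} (hf : Continuous f)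
    (hg : Continuous g) : sideInt v i (fun z => f z - g z) = sideInt v i f - sideInt v i g := by
  simp only [sideInt]
  exact intervalIntegral.integral_sub (Continuous.intervalIntegrable (by fun_prop) _ _)
    (Continuous.intervalIntegrable (by fun_prop) _ _)

lemma sideInt_nonneg (v : Fin 4 → Plane) (i : Fin 4) {f : Plane → ℝ} (hf : ∀ z, 0 ≤ f z) :
    0 ≤ sideInt v i f :=
  intervalIntegral.integral_nonneg zero_le_one fun _ _ => hf _

lemma eq_zero_of_sideInt_eq_zero (v : Fin 4 → Plane) (i : Fin 4) {f : Plane → ℝ}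
    (hf : Continuous f) (h0 : ∀ z, 0 ≤ f z) (h : sideInt v i f = 0) : f (v i) = 0 := by
  by_contra hne
  have hpos : 0 < f (v i) := lt_of_le_of_ne (h0 _) (Ne.symm hne)
  have hc : Continuous fun t : ℝ => f (v i + t • (v (i + 1) - v i)) := by fun_prop
  have : 0 < sideInt v i f := by
    refine intervalIntegral.integral_pos zero_lt_one hc.continuousOn (fun _ _ => h0 _)
      ⟨0, ⟨le_rfl, zero_le_one⟩, ?_⟩
    simpa using hpos
  exact this.ne' h

lemma integrableOn_quad (v : Fin 4 → Plane) {f : Plane → ℝ} (hf : Continuous f) :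
    IntegrableOn f (quad v) :=
  hf.continuousOn.integrableOn_compact (isCompact_quad v)

lemma continuous_affFun_mul (a : AffFun) {f : Plane → ℝ} (hf : Continuous f) :
    Continuous fun z => a z * f z :=
  (continuous_affFun a).mul hf

/-- Both measures live on `Δ`. This allows a PL function, prescribed only on `Δ`, to be replaced by
a maximum of affine functions that is convex and continuous on the whole plane. -/
lemma futaki_congr {k : ℕ} {Δ : Set Plane} (hΔ : IsCompact Δ) (L : Fin k → AffFun)
    {f g : Plane → ℝ} (hfg : ∀ x ∈ Δ, f x = g x) : futaki Δ L f = futaki Δ L g := by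
  have h1 : ∫ x, f x ∂(boundaryMeasure Δ L) = ∫ x, g x ∂(boundaryMeasure Δ L) := by
    refine integral_congr_ae ?_
    have hnull : boundaryMeasure Δ L Δᶜ = 0 := by
      simp only [boundaryMeasure, Measure.coe_finsetSum, Finset.sum_apply, Measure.smul_apply,
        Measure.restrict_apply hΔ.measurableSet.compl]
      refine Finset.sum_eq_zero fun j _ => ?_
      have : Δᶜ ∩ facet Δ (L j) = ∅ :=
        Set.eq_empty_of_forall_notMem fun x hx => hx.1 hx.2.1
      rw [this, measure_empty, smul_zero]
    refine measure_mono_null (fun x hx => ?_) hnull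
    exact fun hxΔ => hx (hfg x hxΔ)
  have h2 : ∫ x in Δ, extremalAffine Δ L x * f x = ∫ x in Δ, extremalAffine Δ L x * g x :=
    setIntegral_congr_fun hΔ.measurableSet fun x hx => by simp only [hfg x hx]
  rw [futaki, futaki, h1, h2]

/-- The maximum of a finite collection of affine functions. -/
noncomputable def supFun (s : Finset AffFun) (hs : s.Nonempty) : Plane → ℝ :=
  fun x => s.sup' hs fun a => a x

lemma continuous_supFun (s : Finset AffFun) (hs : s.Nonempty) : Continuous (supFun s hs) :=
  Continuous.finset_sup'_apply hs fun a _ => continuous_affFun a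

lemma convexOn_affFun (a : AffFun) : ConvexOn ℝ Set.univ a := by
  refine ⟨convex_univ, fun x _ y _ r t _ _ hrt => le_of_eq ?_⟩
  exact Convex.combo_affine_apply hrt

lemma convexOn_supFun (s : Finset AffFun) (hs : s.Nonempty) :
    ConvexOn ℝ Set.univ (supFun s hs) := by
  refine ⟨convex_univ, fun x _ y _ r t hr ht hrt => ?_⟩
  refine Finset.sup'_le _ _ fun a ha => ?_
  refine ((convexOn_affFun a).2 (Set.mem_univ x) (Set.mem_univ y) hr ht hrt).trans ?_
  exact add_le_add (smul_le_smul_of_nonneg_left (Finset.le_sup' (fun a : AffFun => a x) ha) hr)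
    (smul_le_smul_of_nonneg_left (Finset.le_sup' (fun a : AffFun => a y) ha) ht)

lemma exists_support_supFun (s : Finset AffFun) (hs : s.Nonempty) (p : Plane) :
    ∃ a : AffFun, a p = supFun s hs p ∧ ∀ z, a z ≤ supFun s hs z := by
  obtain ⟨a, ha, hap⟩ := s.exists_mem_eq_sup' hs fun a => a p
  exact ⟨a, hap.symm, fun z => Finset.le_sup' (fun a : AffFun => a z) ha⟩

namespace IsQuad

variable {v : Fin 4 → Plane} {m n : ℝ}

lemma interior_nonempty (h : IsQuad v m n) : (interior (quad v)).Nonempty := by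
  have hopen : IsOpen {z | ∀ i, 0 < sideFun v m n i z} := by
    rw [Set.ofPred_forall]
    exact isOpen_iInter_of_finite fun i => isOpen_lt continuous_const (continuous_affFun _)
  refine ⟨∑ i, (4⁻¹ : ℝ) • v i, interior_maximal ?_ hopen ?_⟩
  · intro z hz
    rw [h.quad_eq_setOf]
    exact fun i => (hz i).le
  · intro i
    rw [apply_sum _ (by norm_num)]
    refine Finset.sum_pos' (fun j _ => mul_nonneg (by norm_num) (h.sideFun_nonneg i j))
      ⟨i + 2, Finset.mem_univ _, mul_pos (by norm_num) (h.sideFun_pos_two i)⟩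

/-- Every positive mass vector comes from affine normals: take `c i = sideWeight v m n i / σ i`. -/
lemma exists_extremal (h : IsQuad v m n) {σ : Fin 4 → ℝ} (hσ : ∀ i, 0 < σ i) :
    ∃ ζ : AffFun, ∀ a : AffFun,
      ∫ z in quad v, ζ z * a z = 2 * ∑ i, σ i * sideInt v i a := by
  have hc : ∀ i, 0 < sideWeight v m n i / σ i := fun i => div_pos (h.sideWeight_pos i) (hσ i)
  obtain ⟨ζ, hζ, -⟩ := existsUnique_isExtremalAffine (isCompact_quad v) h.interior_nonempty
    (h.isAffineNormals (k := Equiv.refl _)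
      (L := fun i => (sideWeight v m n i / σ i) • sideFun v m n i) hc fun i => rfl)
  refine ⟨ζ, fun a => ?_⟩
  rw [hζ a, h.integral_boundaryMeasure (k := Equiv.refl _) hc (fun i => rfl) (continuous_affFun a)]
  congr 1
  refine Finset.sum_congr rfl fun i _ => ?_
  rw [div_div_cancel₀ (h.sideWeight_pos i).ne']

/-- The extremal affine function of the unit measure on a single side. -/
lemma exists_sideExtremal (h : IsQuad v m n) (i : Fin 4) :
    ∃ ζ : AffFun, ∀ a : AffFun, ∫ z in quad v, ζ z * a z = 2 * sideInt v i a := by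
  -- The unit mass on one side has zeros elsewhere and is not realized by normals, so it is written
  -- as a difference of two positive mass vectors.
  obtain ⟨ζ, hζ⟩ := h.exists_extremal (σ := fun _ => 1) fun _ => one_pos
  obtain ⟨ζ', hζ'⟩ := h.exists_extremal (σ := fun j => 1 + if j = i then 1 else 0)
    fun j => by split_ifs <;> norm_num
  refine ⟨ζ' - ζ, fun a => ?_⟩
  have e : ∀ z, (ζ' - ζ) z * a z = ζ' z * a z - ζ z * a z := fun z => by
    rw [AffineMap.coe_sub, Pi.sub_apply, sub_mul]
  simp only [e]
  rw [integral_sub (integrableOn_quad v (continuous_affFun_mul ζ' (continuous_affFun a)))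
    (integrableOn_quad v (continuous_affFun_mul ζ (continuous_affFun a))), hζ, hζ']
  simp only [add_mul, one_mul, ite_mul, zero_mul, Finset.sum_add_distrib, Finset.sum_ite_eq',
    Finset.mem_univ, if_true]
  ring

/-- The Futaki invariant in terms of side integrals. -/
lemma futaki_eq (h : IsQuad v m n) {L : Fin 4 → AffFun} {k : Equiv.Perm (Fin 4)}
    {c : Fin 4 → ℝ} (hc : ∀ i, 0 < c i) (hL : ∀ i, L (k i) = c i • sideFun v m n i)
    {ζ : AffFun} (hζ : ∀ a : AffFun, ∫ z in quad v, ζ z * a z =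
      2 * ∑ i, sideWeight v m n i / c i * sideInt v i a)
    {f : Plane → ℝ} (hf : Continuous f) :
    futaki (quad v) L f = ∑ i, sideWeight v m n i / c i * sideInt v i f -
      1 / 2 * ∫ z in quad v, ζ z * f z := by
  have hex : IsExtremalAffine (quad v) L ζ := by
    intro a
    rw [hζ, h.integral_boundaryMeasure hc hL (continuous_affFun a)]
  have huniq := existsUnique_isExtremalAffine (isCompact_quad v) h.interior_nonempty
    (h.isAffineNormals hc hL)
  have he : extremalAffine (quad v) L = ζ := by
    have hE : ∃ ζ, IsExtremalAffine (quad v) L ζ := ⟨ζ, hex⟩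
    rw [extremalAffine, dif_pos hE]
    exact huniq.unique hE.choose_spec hex
  rw [futaki, he, h.integral_boundaryMeasure hc hL hf]

lemma futaki_affFun (h : IsQuad v m n) {L : Fin 4 → AffFun} {k : Equiv.Perm (Fin 4)}
    {c : Fin 4 → ℝ} (hc : ∀ i, 0 < c i) (hL : ∀ i, L (k i) = c i • sideFun v m n i)
    (a : AffFun) : futaki (quad v) L a = 0 := by
  obtain ⟨ζ, hζ⟩ := h.exists_extremal fun i => div_pos (h.sideWeight_pos i) (hc i)
  rw [h.futaki_eq hc hL hζ (continuous_affFun a), hζ]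
  ring

lemma futaki_sub_affFun (h : IsQuad v m n) {L : Fin 4 → AffFun} {k : Equiv.Perm (Fin 4)}
    {c : Fin 4 → ℝ} (hc : ∀ i, 0 < c i) (hL : ∀ i, L (k i) = c i • sideFun v m n i)
    {f : Plane → ℝ} (hf : Continuous f) (a : AffFun) :
    futaki (quad v) L (fun z => f z - a z) = futaki (quad v) L f := by
  obtain ⟨ζ, hζ⟩ := h.exists_extremal fun i => div_pos (h.sideWeight_pos i) (hc i)
  have ha := continuous_affFun a
  have h0 := h.futaki_affFun hc hL a
  rw [h.futaki_eq hc hL hζ ha] at h0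
  have hfa : Continuous fun z => f z - a z := hf.sub ha
  rw [h.futaki_eq hc hL hζ hfa, h.futaki_eq hc hL hζ hf]
  simp only [mul_sub, sideInt_sub v _ hf ha, Finset.sum_sub_distrib]
  rw [integral_sub (integrableOn_quad v (continuous_affFun_mul ζ hf))
    (integrableOn_quad v (continuous_affFun_mul ζ ha))]
  linarith

/-- To prove K-polystability it suffices to consider maxima of affine functions on the plane. -/
lemma isKPolystable_of_supFun (h : IsQuad v m n) {L : Fin 4 → AffFun} {k : Equiv.Perm (Fin 4)}
    {c : Fin 4 → ℝ} (hc : ∀ i, 0 < c i) (hL : ∀ i, L (k i) = c i • sideFun v m n i)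
    (H : ∀ s hs, 0 ≤ futaki (quad v) L (supFun s hs) ∧
      (futaki (quad v) L (supFun s hs) = 0 → IsAffineOn (quad v) (supFun s hs))) :
    IsKPolystable (quad v) L := by
  rintro f ⟨s, hs, hf⟩
  have hcongr : futaki (quad v) L f = futaki (quad v) L (supFun s hs) :=
    futaki_congr (isCompact_quad v) L hf
  rw [hcongr]
  refine ⟨(H s hs).1, fun h0 => ?_, ?_⟩
  · obtain ⟨a, ha⟩ := (H s hs).2 h0
    exact ⟨a, fun x hx => (hf x hx).trans (ha x hx)⟩
  · rintro ⟨a, ha⟩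
    rw [← hcongr, futaki_congr (isCompact_quad v) L ha, h.futaki_affFun hc hL]

/-! ### A criterion for K-polystability -/

lemma sum_sideFun (h : IsQuad v m n) (z : Plane) : ∑ i, sideFun v m n i z = m + n := by
  obtain ⟨x, y, rfl⟩ := h.exists_pt z
  simp only [h.sideFun_pt, Fin.sum_univ_four, Matrix.cons_val_zero, Matrix.cons_val_one,
    Matrix.cons_val]
  ring

lemma ext_sideFun (h : IsQuad v m n) {z w : Plane}
    (hzw : ∀ i, sideFun v m n i z = sideFun v m n i w) : z = w := by
  obtain ⟨x, y, rfl⟩ := h.exists_pt z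
  obtain ⟨x', y', rfl⟩ := h.exists_pt w
  have h0 := hzw 0
  have h3 := hzw 3
  rw [h.sideFun_pt, h.sideFun_pt] at h0 h3
  have e0 : y = y' := h0
  have e3 : x = x' := h3
  rw [e0, e3]

/-- A quadrilateral is covered by the triangles spanned by its sides and an interior point. -/
lemma quad_subset_iUnion_tri (h : IsQuad v m n) {O : Plane} (hO : ∀ i, 0 < sideFun v m n i O) :
    quad v ⊆ ⋃ i, tri O (v i) (v (i + 1)) := by
  intro x hx
  rw [Set.mem_iUnion]
  obtain ⟨i, -, hi⟩ := Finset.univ.exists_min_image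
    (fun i => sideFun v m n i x / sideFun v m n i O) Finset.univ_nonempty
  set ρ := sideFun v m n i x / sideFun v m n i O with hρ
  have hle : ∀ j, ρ * sideFun v m n j O ≤ sideFun v m n j x := fun j =>
    (le_div_iff₀ (hO j)).1 (hi j (Finset.mem_univ j))
  -- The side functions have constant sum, so the least ratio `ρ` is at most 1, and `ρ = 1` forces
  -- `x = O`.
  have hsum : ρ * (m + n) ≤ m + n := by
    calc ρ * (m + n) = ∑ j, ρ * sideFun v m n j O := by
          rw [← Finset.mul_sum, h.sum_sideFun]
      _ ≤ ∑ j, sideFun v m n j x := Finset.sum_le_sum fun j _ => hle j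
      _ = m + n := h.sum_sideFun x
  have hmn : 0 < m + n := add_pos h.m_pos h.n_pos
  have hρ1 : ρ ≤ 1 := le_of_mul_le_mul_right (by rwa [one_mul]) hmn
  rcases hρ1.eq_or_lt with h1 | h1
  · have heq : ∀ j ∈ Finset.univ, sideFun v m n j O = sideFun v m n j x :=
      (Finset.sum_eq_sum_iff_of_le fun j _ => by simpa [h1] using hle j).1
        ((h.sum_sideFun O).trans (h.sum_sideFun x).symm)
    have : O = x := h.ext_sideFun fun j => heq j (Finset.mem_univ j)
    exact ⟨i, (0, 0), by simp, by simp [this]⟩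
  · have hpos : 0 < 1 - ρ := sub_pos.2 h1
    -- The point where the ray from `O` through `x` leaves the quadrilateral; it lies on the side
    -- realizing the least ratio.
    set y := O + (1 - ρ)⁻¹ • (x - O) with hy
    have hval : ∀ j, sideFun v m n j y =
        (1 - ρ)⁻¹ * (sideFun v m n j x - ρ * sideFun v m n j O) := by
      intro j
      rw [hy, apply_add, map_smul, linear_sub, smul_eq_mul]
      field_simp
      ring
    have hyf : y ∈ facet (quad v) (sideFun v m n i) := by
      refine ⟨?_, ?_⟩
      · rw [h.quad_eq_setOf]
        intro j
        rw [hval]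
        exact mul_nonneg (inv_pos.2 hpos).le (sub_nonneg.2 (hle j))
      · change sideFun v m n i y = 0
        rw [hval, hρ, div_mul_cancel₀ _ (hO i).ne', sub_self, mul_zero]
    rw [h.facet_sideFun, segment_eq_image'] at hyf
    obtain ⟨t, ht, hty⟩ := hyf
    have hρ0 : 0 ≤ ρ := div_nonneg (nonneg_of_mem_quad (h.sideFun_nonneg i) hx) (hO i).le
    refine ⟨i, (1 - ρ, (1 - ρ) * t), ⟨⟨hpos.le, by linarith⟩, mul_nonneg hpos.le ht.1,
      mul_le_of_le_one_right hpos.le ht.2⟩, ?_⟩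
    have hx' : x = O + (1 - ρ) • (y - O) := by
      rw [hy, add_sub_cancel_left, smul_smul, mul_inv_cancel₀ hpos.ne', one_smul,
        add_sub_cancel]
    rw [hx', ← hty]
    simp only
    module

/-- This is the purpose of the normalization of the side functions: up to the common factor, which
carries the orientation, `sideFun v m n i O` is twice the area of the triangle over side `i` with
apex `O`. -/
lemma cross_side (h : IsQuad v m n) (O : Plane) (i : Fin 4) :
    cross (v i - O) (v (i + 1) - v i) = cross (v 1 - v 0) (v 3 - v 0) * sideFun v m n i O := by
  obtain ⟨x, y, rfl⟩ := h.exists_pt O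
  have h2 := h.eq
  rw [h.sideFun_pt]
  fin_cases i
  · change cross (v 0 - pt v x y) (v 1 - v 0) = _ * y
    simp only [cross, pt, PiLp.add_apply, PiLp.sub_apply, PiLp.smul_apply, smul_eq_mul]
    ring
  · change cross (v 1 - pt v x y) (v 2 - v 1) = _ * (n - n * x + (m - 1) * y)
    rw [h2]
    simp only [cross, pt, PiLp.add_apply, PiLp.sub_apply, PiLp.smul_apply, smul_eq_mul]
    ring
  · change cross (v 2 - pt v x y) (v 3 - v 2) = _ * (m + (n - 1) * x - m * y)
    rw [h2]
    simp only [cross, pt, PiLp.add_apply, PiLp.sub_apply, PiLp.smul_apply, smul_eq_mul]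
    ring
  · change cross (v 3 - pt v x y) (v 0 - v 3) = _ * x
    simp only [cross, pt, PiLp.add_apply, PiLp.sub_apply, PiLp.smul_apply, smul_eq_mul]
    ring

/-- The triangle estimate is summed over the fan of triangles at `O`. Since `g` is nonnegative, a
covering suffices and overlaps need no discussion. -/
lemma setIntegral_le_of_convexOn (h : IsQuad v m n) {O : Plane}
    (hO : ∀ i, 0 < sideFun v m n i O) {g : Plane → ℝ} (hg : Continuous g)
    (hconv : ConvexOn ℝ Set.univ g) (h0 : g O = 0) (hnn : ∀ z, 0 ≤ g z) :
    ∫ z in quad v, g z ≤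
      ∑ i, |cross (v 1 - v 0) (v 3 - v 0)| * sideFun v m n i O / 3 * sideInt v i g := by
  have hint : ∀ i, IntegrableOn g (tri O (v i) (v (i + 1))) := fun i =>
    hg.continuousOn.integrableOn_compact (isCompact_tri _ _ _)
  have hle : volume.restrict (quad v) ≤ ∑ i, volume.restrict (tri O (v i) (v (i + 1))) := by
    rw [← Measure.sum_fintype]
    exact (Measure.restrict_mono (h.quad_subset_iUnion_tri hO) le_rfl).trans
      Measure.restrict_iUnion_le
  calc ∫ z in quad v, g z
      ≤ ∫ z, g z ∂(∑ i, volume.restrict (tri O (v i) (v (i + 1)))) :=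
        integral_mono_measure hle (Filter.Eventually.of_forall hnn)
          (integrable_finsetSum_measure.2 fun i _ => hint i)
    _ = ∑ i, ∫ z in tri O (v i) (v (i + 1)), g z :=
        integral_finsetSum_measure fun i _ => hint i
    _ ≤ _ := by
        refine Finset.sum_le_sum fun i _ => ?_
        have hcr := h.cross_side O i
        refine (setIntegral_tri_le ?_ hg hconv h0).trans_eq ?_
        · rw [hcr]
          exact mul_ne_zero h.cross_ne (hO i).ne'
        · rw [hcr, abs_mul, abs_of_pos (hO i), sideInt]

/-- A criterion for K-polystability: comparison of the boundary measure with the cone measure of an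
interior point. -/
lemma isKPolystable_of_lt (h : IsQuad v m n) {L : Fin 4 → AffFun} {k : Equiv.Perm (Fin 4)}
    {c : Fin 4 → ℝ} (hc : ∀ i, 0 < c i) (hL : ∀ i, L (k i) = c i • sideFun v m n i)
    {O : Plane} (hO : ∀ i, 0 < sideFun v m n i O) {ζ : AffFun}
    (hζ : ∀ a : AffFun, ∫ z in quad v, ζ z * a z =
      2 * ∑ i, sideWeight v m n i / c i * sideInt v i a)
    (hlt : ∀ i j, ζ (v j) * (|cross (v 1 - v 0) (v 3 - v 0)| * sideFun v m n i O) <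
      6 * (sideWeight v m n i / c i)) :
    IsKPolystable (quad v) L := by
  refine h.isKPolystable_of_supFun hc hL fun s hs => ?_
  obtain ⟨a, haO, hale⟩ := exists_support_supFun s hs O
  set f := supFun s hs with hf
  have hfc : Continuous f := continuous_supFun s hs
  rw [← h.futaki_sub_affFun hc hL hfc a]
  set g : Plane → ℝ := fun z => f z - a z with hg
  have hgc : Continuous g := hfc.sub (continuous_affFun a)
  have hg0 : ∀ z, 0 ≤ g z := fun z => sub_nonneg.2 (hale z)
  have hgO : g O = 0 := sub_eq_zero.2 haO.symm
  have hgconv : ConvexOn ℝ Set.univ g := by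
    have h1 : ConvexOn ℝ Set.univ (-a : AffFun) := convexOn_affFun (-a)
    have h2 := (convexOn_supFun s hs).add h1
    refine h2.congr fun z _ => ?_
    simp [hg, hf, sub_eq_add_neg]
  set J := |cross (v 1 - v 0) (v 3 - v 0)| with hJ
  obtain ⟨j0, -, hj0⟩ := Finset.univ.exists_max_image (fun j => ζ (v j)) Finset.univ_nonempty
  -- The truncation at 0 keeps the upper bound for `ζ` nonnegative, so that it may multiply the
  -- estimate for the integral of `g`.
  set Z := max 0 (ζ (v j0)) with hZ
  have hZ0 : 0 ≤ Z := le_max_left _ _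
  have hζZ : ∀ z ∈ quad v, ζ z ≤ Z := by
    intro z hz
    obtain ⟨w, hw0, hw1, rfl⟩ := exists_weights hz
    rw [apply_sum _ hw1]
    calc ∑ i, w i * ζ (v i) ≤ ∑ i, w i * Z := Finset.sum_le_sum fun i _ =>
          mul_le_mul_of_nonneg_left ((hj0 i (Finset.mem_univ i)).trans (le_max_right _ _)) (hw0 i)
      _ = Z := by rw [← Finset.sum_mul, hw1, one_mul]
  have hlt' : ∀ i, Z * (J * sideFun v m n i O) < 6 * (sideWeight v m n i / c i) := by
    intro i
    rcases max_choice 0 (ζ (v j0)) with e | e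
    · rw [hZ, e, zero_mul]
      exact mul_pos (by norm_num) (div_pos (h.sideWeight_pos i) (hc i))
    · rw [hZ, e]
      exact hlt i j0
  have hI : ∫ z in quad v, ζ z * g z ≤ Z * ∑ i, J * sideFun v m n i O / 3 * sideInt v i g := by
    calc ∫ z in quad v, ζ z * g z ≤ ∫ z in quad v, Z * g z :=
          setIntegral_mono_on (integrableOn_quad v ((continuous_affFun ζ).mul hgc))
            (integrableOn_quad v (continuous_const.mul hgc)) (isCompact_quad v).measurableSet
            fun z hz => mul_le_mul_of_nonneg_right (hζZ z hz) (hg0 z)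
      _ = Z * ∫ z in quad v, g z := integral_const_mul _ _
      _ ≤ _ := mul_le_mul_of_nonneg_left
          (h.setIntegral_le_of_convexOn hO hgc hgconv hgO hg0) hZ0
  -- The 6 combines the factor 1/2 in the Futaki invariant with the 1/3 of the triangle estimate.
  have hF : ∑ i, (sideWeight v m n i / c i - Z * (J * sideFun v m n i O) / 6) * sideInt v i g ≤
      futaki (quad v) L g := by
    rw [h.futaki_eq hc hL hζ hgc]
    have : ∑ i, (sideWeight v m n i / c i - Z * (J * sideFun v m n i O) / 6) * sideInt v i g =
        ∑ i, sideWeight v m n i / c i * sideInt v i g -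
          1 / 2 * (Z * ∑ i, J * sideFun v m n i O / 3 * sideInt v i g) := by
      rw [Finset.mul_sum, Finset.mul_sum, ← Finset.sum_sub_distrib]
      refine Finset.sum_congr rfl fun i _ => ?_
      ring
    rw [this]
    linarith
  have hcoef : ∀ i, 0 < sideWeight v m n i / c i - Z * (J * sideFun v m n i O) / 6 := fun i => by
    linarith [hlt' i]
  have hterm : ∀ i ∈ Finset.univ, 0 ≤
      (sideWeight v m n i / c i - Z * (J * sideFun v m n i O) / 6) * sideInt v i g := fun i _ =>
    mul_nonneg (hcoef i).le (sideInt_nonneg v i hg0)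
  refine ⟨(Finset.sum_nonneg hterm).trans hF, fun hzero => ⟨a, fun z hz => ?_⟩⟩
  rw [hzero] at hF
  have hz0 := (Finset.sum_eq_zero_iff_of_nonneg hterm).1
    (le_antisymm hF (Finset.sum_nonneg hterm))
  -- Equality forces all side means of `g` to vanish, hence its vertex values; convexity then gives
  -- `g ≤ 0` on the hull.
  have hvert : ∀ i, g (v i) = 0 := fun i =>
    eq_zero_of_sideInt_eq_zero v i hgc hg0
      ((mul_eq_zero.1 (hz0 i (Finset.mem_univ i))).resolve_left (hcoef i).ne')
  have hconvS : Convex ℝ {z | g z ≤ 0} := by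
    simpa using hgconv.convex_le 0
  have hgz : g z ≤ 0 := by
    refine convexHull_min ?_ hconvS hz
    rintro _ ⟨i, rfl⟩
    exact (hvert i).le
  exact sub_eq_zero.1 (le_antisymm hgz (hg0 z))

end IsQuad

/-! ### The invariant of an interval -/

lemma eq_zero_of_intervalIntegral_eq_zero {f : ℝ → ℝ} (hf : Continuous f)
    (h0 : ∀ x ∈ Set.Icc (0 : ℝ) 1, 0 ≤ f x) (h : ∫ x in (0 : ℝ)..1, f x = 0) :
    ∀ x ∈ Set.Icc (0 : ℝ) 1, f x = 0 := by
  intro x hx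
  by_contra hne
  have hpos : 0 < f x := lt_of_le_of_ne (h0 x hx) (Ne.symm hne)
  exact (intervalIntegral.integral_pos zero_lt_one hf.continuousOn
    (fun y hy => h0 y ⟨hy.1.le, hy.2⟩) ⟨x, hx, hpos⟩).ne' h

/-- The density of the extremal affine function of a unit interval with weights `p`, `q` at its
endpoints. -/
noncomputable def intervalExtremal (p q x : ℝ) : ℝ := 2 * (p + q) + 12 * (q - p) * (x - 1 / 2)

lemma continuous_intervalExtremal (p q : ℝ) : Continuous (intervalExtremal p q) := by
  unfold intervalExtremal
  fun_prop

lemma integral_intervalExtremal_mul_affine (p q A B : ℝ) :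
    ∫ x in (0 : ℝ)..1, intervalExtremal p q x * (A + B * x) = 2 * (p * A + q * (A + B)) := by
  have h : ∀ x : ℝ, intervalExtremal p q x * (A + B * x) =
      (8 * p - 4 * q) * A + ((8 * p - 4 * q) * B + 12 * (q - p) * A) * x +
        (12 * (q - p) * B) * x ^ 2 + 0 * x ^ 3 := fun x => by
    unfold intervalExtremal
    ring
  simp only [h]
  rw [integral_cubic]
  ring

/-- Let `x₀` be the point where the density passes from nonpositive to nonnegative, and let `l x = A
+ B x` be the line through the graph of `g` at `x₀` and at 1. By convexity `l ≥ g` on `[x₀, 1]` and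
`l ≤ g` to the left of `x₀`, so the density times `l - g` is nonnegative on `[0, 1]`. The integral
against `l` is known exactly, with `l 1 = g 1` and `l 0 ≤ g 0`. -/
lemma integral_intervalExtremal_mul_le_of_le {p q : ℝ} (hp : 0 < p) (hpq : p ≤ q) {g : ℝ → ℝ}
    (hg : Continuous g) (hconv : ConvexOn ℝ Set.univ g) :
    (∫ x in (0 : ℝ)..1, intervalExtremal p q x * g x) ≤ 2 * (p * g 0 + q * g 1) ∧
    ((∫ x in (0 : ℝ)..1, intervalExtremal p q x * g x) = 2 * (p * g 0 + q * g 1) →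
      ∀ x ∈ Set.Icc (0 : ℝ) 1, g x = (1 - x) * g 0 + x * g 1) := by
  have hval : ∀ x, intervalExtremal p q x = 8 * p - 4 * q + 12 * (q - p) * x := fun x => by
    unfold intervalExtremal
    ring
  -- The density at 0 is `8 p - 4 q`. If `q ≤ 2 p` there is no sign change and `x₀ = 0`; otherwise
  -- `x₀` is its zero.
  obtain ⟨x₀, hx0, hx1, hpos, hneg, hzero⟩ : ∃ x₀ : ℝ, 0 ≤ x₀ ∧ x₀ < 1 ∧
      (∀ x, x₀ ≤ x → 0 ≤ intervalExtremal p q x) ∧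
      (∀ x, 0 ≤ x → x < x₀ → intervalExtremal p q x ≤ 0) ∧
      (∀ x, 0 ≤ x → intervalExtremal p q x = 0 → x = x₀) := by
    rcases le_or_gt q (2 * p) with hq | hq
    · refine ⟨0, le_rfl, one_pos, fun x hx => ?_, fun x hx hx' => absurd hx' hx.not_gt,
        fun x hx h0 => ?_⟩
      · rw [hval]
        nlinarith [mul_nonneg (sub_nonneg.2 hpq) hx]
      · rw [hval] at h0
        by_contra hne
        have hx' : 0 < x := lt_of_le_of_ne hx (Ne.symm hne)
        have h1 := mul_nonneg (sub_nonneg.2 hpq) hx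
        have h2 : (q - p) * x = 0 := by nlinarith
        rcases mul_eq_zero.1 h2 with h3 | h3
        · nlinarith
        · exact hne h3
    · have hd : 0 < 12 * (q - p) := by linarith
      refine ⟨(4 * q - 8 * p) / (12 * (q - p)), div_nonneg (by linarith) hd.le, ?_,
        fun x hx => ?_, fun x _ hx => ?_, fun x _ hx => ?_⟩
      · rw [div_lt_one hd]; linarith
      · rw [hval]
        rw [div_le_iff₀ hd] at hx
        linarith
      · rw [hval]
        rw [lt_div_iff₀ hd] at hx
        linarith
      · rw [hval] at hx
        rw [eq_div_iff hd.ne']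
        linarith
  have h1x : 0 < 1 - x₀ := sub_pos.2 hx1
  set B := (g 1 - g x₀) / (1 - x₀) with hB
  set A := g x₀ - B * x₀ with hA
  have hB' : B * (1 - x₀) = g 1 - g x₀ := div_mul_cancel₀ _ h1x.ne'
  have hAB : A + B = g 1 := by rw [hA]; linarith
  have hright : ∀ x, x₀ ≤ x → x ≤ 1 → g x ≤ A + B * x := by
    intro x hx hx'
    have := hconv.2 (Set.mem_univ x₀) (Set.mem_univ (1 : ℝ))
      (div_nonneg (sub_nonneg.2 hx') h1x.le) (div_nonneg (sub_nonneg.2 hx) h1x.le)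
      (by field_simp; ring)
    have e : ((1 - x) / (1 - x₀)) • x₀ + ((x - x₀) / (1 - x₀)) • (1 : ℝ) = x := by
      rw [smul_eq_mul, smul_eq_mul]; field_simp; ring
    rw [e, smul_eq_mul, smul_eq_mul] at this
    refine this.trans_eq ?_
    rw [hA, hB]
    field_simp
    ring
  have hleft : ∀ x, x < x₀ → A + B * x ≤ g x := by
    intro x hx
    have hxx : 0 < 1 - x := by linarith
    have := hconv.2 (Set.mem_univ x) (Set.mem_univ (1 : ℝ))
      (div_nonneg h1x.le hxx.le) (div_nonneg (sub_nonneg.2 hx.le) hxx.le)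
      (by field_simp; ring)
    have e : ((1 - x₀) / (1 - x)) • x + ((x₀ - x) / (1 - x)) • (1 : ℝ) = x₀ := by
      rw [smul_eq_mul, smul_eq_mul]; field_simp; ring
    rw [e, smul_eq_mul, smul_eq_mul, div_mul_eq_mul_div, div_mul_eq_mul_div, ← add_div,
      le_div_iff₀ hxx] at this
    have h3 : (1 - x₀) * (A + B * x) ≤ (1 - x₀) * g x := by
      have : (1 - x₀) * (A + B * x) = g x₀ * (1 - x) - (x₀ - x) * g 1 := by
        rw [hA]; linear_combination (x - x₀) * hB'
      linarith
    exact le_of_mul_le_mul_left h3 h1x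
  have hprod : ∀ x ∈ Set.Icc (0 : ℝ) 1,
      0 ≤ intervalExtremal p q x * (A + B * x) - intervalExtremal p q x * g x := by
    intro x hx
    rw [← mul_sub]
    rcases le_or_gt x₀ x with hc | hc
    · exact mul_nonneg (hpos x hc) (sub_nonneg.2 (hright x hc hx.2))
    · exact mul_nonneg_of_nonpos_of_nonpos (hneg x hx.1 hc) (sub_nonpos.2 (hleft x hc))
  have hce := continuous_intervalExtremal p q
  have hc1 : Continuous fun x => intervalExtremal p q x * (A + B * x) := by fun_prop
  have hc2 : Continuous fun x => intervalExtremal p q x * g x := by fun_prop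
  have hdiff := intervalIntegral.integral_nonneg (μ := volume) zero_le_one hprod
  have hsub := intervalIntegral.integral_sub (μ := volume) (hc1.intervalIntegrable 0 1)
    (hc2.intervalIntegrable 0 1)
  have haff := integral_intervalExtremal_mul_affine p q A B
  rw [hAB] at haff
  have hA0 : A ≤ g 0 := by
    rcases hx0.eq_or_lt with h | h
    · rw [hA, ← h]; simp
    · have := hleft 0 h; linarith
  have hpA := mul_le_mul_of_nonneg_left hA0 hp.le
  refine ⟨by linarith, fun heq => ?_⟩
  -- In the equality case both inequalities used are equalities. The density vanishes at most at
  -- `x₀`, where `g` meets the line anyway.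
  have hAeq : A = g 0 := by
    refine le_antisymm hA0 (le_of_mul_le_mul_left ?_ hp)
    linarith
  have hz := eq_zero_of_intervalIntegral_eq_zero (hc1.sub hc2) hprod (by
    change (∫ x in (0 : ℝ)..1, (intervalExtremal p q x * (A + B * x) -
      intervalExtremal p q x * g x)) = 0
    refine le_antisymm ?_ hdiff
    linarith)
  intro x hx
  have h1 : intervalExtremal p q x * (A + B * x) - intervalExtremal p q x * g x = 0 := hz x hx
  rw [← mul_sub] at h1
  have h2 : g x = A + B * x := by
    rcases mul_eq_zero.1 h1 with h2 | h2
    · rw [hzero x hx.1 h2, hA]; ring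
    · linarith
  rw [h2, ← hAeq, ← hAB]
  ring

/-- The reflection `x ↦ 1 - x` exchanges the weights and reduces to `p ≤ q`. -/
lemma integral_intervalExtremal_mul_le {p q : ℝ} (hp : 0 < p) (hq : 0 < q) {g : ℝ → ℝ}
    (hg : Continuous g) (hconv : ConvexOn ℝ Set.univ g) :
    (∫ x in (0 : ℝ)..1, intervalExtremal p q x * g x) ≤ 2 * (p * g 0 + q * g 1) ∧
    ((∫ x in (0 : ℝ)..1, intervalExtremal p q x * g x) = 2 * (p * g 0 + q * g 1) →
      ∀ x ∈ Set.Icc (0 : ℝ) 1, g x = (1 - x) * g 0 + x * g 1) := by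
  rcases le_total p q with hpq | hpq
  · exact integral_intervalExtremal_mul_le_of_le hp hpq hg hconv
  · have hconv' : ConvexOn ℝ Set.univ fun x => g (1 - x) := by
      refine ⟨convex_univ, fun x _ y _ r t hr ht hrt => ?_⟩
      have := hconv.2 (Set.mem_univ (1 - x)) (Set.mem_univ (1 - y)) hr ht hrt
      refine le_of_eq_of_le ?_ this
      change g (1 - (r • x + t • y)) = _
      congr 1
      simp only [smul_eq_mul]
      linear_combination -hrt
    have hmain := integral_intervalExtremal_mul_le_of_le hq hpq (g := fun x => g (1 - x))
      (by fun_prop) hconv'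
    have e : (∫ x in (0 : ℝ)..1, intervalExtremal q p x * g (1 - x)) =
        ∫ x in (0 : ℝ)..1, intervalExtremal p q x * g x := by
      have := intervalIntegral.integral_comp_sub_left (a := 0) (b := 1)
        (fun x => intervalExtremal p q x * g x) 1
      rw [sub_self, sub_zero] at this
      rw [← this]
      refine intervalIntegral.integral_congr fun x _ => ?_
      simp only [intervalExtremal]
      ring
    rw [e, sub_zero, sub_self, add_comm] at hmain
    refine ⟨hmain.1, fun h x hx => ?_⟩
    have := hmain.2 h (1 - x) ⟨by linarith [hx.2], by linarith [hx.1]⟩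
    rw [sub_sub_cancel] at this
    rw [this]
    ring

lemma intervalIntegral_swap {F : ℝ × ℝ → ℝ} (hF : Continuous F) :
    ∫ x in (0 : ℝ)..1, ∫ y in (0 : ℝ)..1, F (x, y) =
      ∫ y in (0 : ℝ)..1, ∫ x in (0 : ℝ)..1, F (x, y) := by
  have hint : Integrable F ((volume.restrict (Set.Ioc (0 : ℝ) 1)).prod
      (volume.restrict (Set.Ioc (0 : ℝ) 1))) := by
    rw [Measure.prod_restrict]
    exact (hF.continuousOn.integrableOn_compact (isCompact_Icc.prod isCompact_Icc)).mono_set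
      (Set.prod_mono Set.Ioc_subset_Icc_self Set.Ioc_subset_Icc_self)
  simp only [intervalIntegral.integral_of_le zero_le_one]
  exact integral_integral_swap (f := fun x y => F (x, y)) hint

/-! ### Parallelograms -/

namespace IsQuad

variable {v : Fin 4 → Plane}

lemma quad_eq_image (h : IsQuad v 1 1) :
    quad v = (fun p : ℝ × ℝ => v 0 + p.1 • (v 1 - v 0) + p.2 • (v 3 - v 0)) ''
      (Set.Icc (0 : ℝ) 1 ×ˢ Set.Icc (0 : ℝ) 1) := by
  rw [h.quad_eq_setOf]
  ext z
  obtain ⟨x, y, rfl⟩ := h.exists_pt z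
  constructor
  · intro hz
    have hz' : ∀ i, 0 ≤ ![y, 1 - 1 * x + (1 - 1) * y, 1 + (1 - 1) * x - 1 * y, x] i :=
      fun i => (hz i).trans_eq (h.sideFun_pt x y i)
    have h0 : 0 ≤ y := hz' 0
    have h1 : 0 ≤ 1 - 1 * x + (1 - 1) * y := hz' 1
    have h2 : 0 ≤ 1 + (1 - 1) * x - 1 * y := hz' 2
    have h3 : 0 ≤ x := hz' 3
    exact ⟨(x, y), ⟨⟨h3, by linarith⟩, h0, by linarith⟩, rfl⟩
  · rintro ⟨⟨x', y'⟩, ⟨⟨h1, h2⟩, h3, h4⟩, hxy⟩ i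
    replace hxy : pt v x' y' = pt v x y := hxy
    rw [← hxy, h.sideFun_pt]
    simp only at h1 h2 h3 h4
    fin_cases i
    · exact h3
    · change 0 ≤ 1 - 1 * x' + (1 - 1) * y'; linarith
    · change 0 ≤ 1 + (1 - 1) * x' - 1 * y'; linarith
    · exact h1

lemma sideInt_parallelogram (h : IsQuad v 1 1) (f : Plane → ℝ) :
    sideInt v 0 f = ∫ t in (0 : ℝ)..1, f (pt v t 0) ∧
    sideInt v 1 f = ∫ t in (0 : ℝ)..1, f (pt v 1 t) ∧
    sideInt v 2 f = ∫ t in (0 : ℝ)..1, f (pt v t 1) ∧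
    sideInt v 3 f = ∫ t in (0 : ℝ)..1, f (pt v 0 t) := by
  have h2 := h.eq
  refine ⟨?_, ?_, ?_, ?_⟩
  · refine intervalIntegral.integral_congr fun t _ => ?_
    change f (v 0 + t • (v 1 - v 0)) = _
    congr 1
    simp only [pt]
    module
  · refine intervalIntegral.integral_congr fun t _ => ?_
    change f (v 1 + t • (v 2 - v 1)) = _
    congr 1
    simp only [pt, h2]
    module
  · have := intervalIntegral.integral_comp_sub_left (a := 0) (b := 1)
      (fun t => f (pt v t 1)) (1 : ℝ)
    rw [sub_self, sub_zero] at this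
    rw [← this]
    refine intervalIntegral.integral_congr fun t _ => ?_
    change f (v 2 + t • (v 3 - v 2)) = _
    congr 1
    simp only [pt, h2]
    module
  · have := intervalIntegral.integral_comp_sub_left (a := 0) (b := 1)
      (fun t => f (pt v 0 t)) (1 : ℝ)
    rw [sub_self, sub_zero] at this
    rw [← this]
    refine intervalIntegral.integral_congr fun t _ => ?_
    change f (v 3 + t • (v 0 - v 3)) = _
    congr 1
    simp only [pt]
    module

/-- The extremal affine function of a parallelogram splits as a sum of functions of one
coordinate. -/
lemma exists_extremal_parallelogram (h : IsQuad v 1 1) (σ : Fin 4 → ℝ) :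
    ∃ ζ : AffFun, (∀ a : AffFun, ∫ z in quad v, ζ z * a z = 2 * ∑ i, σ i * sideInt v i a) ∧
      ∀ x y, |cross (v 1 - v 0) (v 3 - v 0)| * ζ (pt v x y) =
        intervalExtremal (σ 3) (σ 1) x + intervalExtremal (σ 0) (σ 2) y := by
  set J := |cross (v 1 - v 0) (v 3 - v 0)| with hJ
  have hJ0 : J ≠ 0 := abs_ne_zero.2 h.cross_ne
  refine ⟨interp v ((intervalExtremal (σ 3) (σ 1) 0 + intervalExtremal (σ 0) (σ 2) 0) / J)
    ((intervalExtremal (σ 3) (σ 1) 1 + intervalExtremal (σ 0) (σ 2) 0) / J)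
    ((intervalExtremal (σ 3) (σ 1) 0 + intervalExtremal (σ 0) (σ 2) 1) / J),
    fun a => ?_, fun x y => ?_⟩
  · rw [h.setIntegral_mul, h.apply_two a, h.apply_two (interp v _ _ _), h.interp_zero,
      h.interp_one, h.interp_three, ← hJ]
    simp only [sideInt_affFun, Fin.sum_univ_four]
    change _ = 2 * (σ 0 * ((a (v 0) + a (v 1)) / 2) + σ 1 * ((a (v 1) + a (v 2)) / 2) +
      σ 2 * ((a (v 2) + a (v 3)) / 2) + σ 3 * ((a (v 3) + a (v 0)) / 2))
    rw [h.apply_two a]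
    simp only [intervalExtremal]
    field_simp
    ring
  · rw [h.interp_pt]
    simp only [intervalExtremal]
    field_simp
    ring

lemma convexOn_pt_left (v : Fin 4 → Plane) {f : Plane → ℝ} (hf : ConvexOn ℝ Set.univ f) (y : ℝ) :
    ConvexOn ℝ Set.univ fun x => f (pt v x y) := by
  refine ⟨convex_univ, fun x _ x' _ r t hr ht hrt => ?_⟩
  refine le_of_eq_of_le ?_ (hf.2 (Set.mem_univ (pt v x y)) (Set.mem_univ (pt v x' y)) hr ht hrt)
  change f (pt v (r • x + t • x') y) = _
  congr 1
  obtain rfl : r = 1 - t := by linarith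
  simp only [pt, smul_eq_mul]
  module

lemma convexOn_pt_right (v : Fin 4 → Plane) {f : Plane → ℝ} (hf : ConvexOn ℝ Set.univ f) (x : ℝ) :
    ConvexOn ℝ Set.univ fun y => f (pt v x y) := by
  refine ⟨convex_univ, fun y _ y' _ r t hr ht hrt => ?_⟩
  refine le_of_eq_of_le ?_ (hf.2 (Set.mem_univ (pt v x y)) (Set.mem_univ (pt v x y')) hr ht hrt)
  change f (pt v x (r • y + t • y')) = _
  congr 1
  obtain rfl : r = 1 - t := by linarith
  simp only [pt, smul_eq_mul]
  module

@[fun_prop]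
lemma continuous_pt {α : Type*} [TopologicalSpace α] (v : Fin 4 → Plane) {x y : α → ℝ}
    (hx : Continuous x) (hy : Continuous y) : Continuous fun a => pt v (x a) (y a) := by
  unfold pt
  fun_prop

/-- The Futaki invariant of a parallelogram as an average of one-dimensional invariants. -/
lemma futaki_parallelogram (h : IsQuad v 1 1) {L : Fin 4 → AffFun} {k : Equiv.Perm (Fin 4)}
    {c : Fin 4 → ℝ} (hc : ∀ i, 0 < c i) (hL : ∀ i, L (k i) = c i • sideFun v 1 1 i)
    {f : Plane → ℝ} (hf : Continuous f) {σ : Fin 4 → ℝ} (hσ : σ = fun i => sideWeight v 1 1 i / c i) :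
    futaki (quad v) L f =
      1 / 2 * (∫ y in (0 : ℝ)..1, (2 * (σ 3 * f (pt v 0 y) + σ 1 * f (pt v 1 y)) -
        ∫ x in (0 : ℝ)..1, intervalExtremal (σ 3) (σ 1) x * f (pt v x y))) +
      1 / 2 * ∫ x in (0 : ℝ)..1, (2 * (σ 0 * f (pt v x 0) + σ 2 * f (pt v x 1)) -
        ∫ y in (0 : ℝ)..1, intervalExtremal (σ 0) (σ 2) y * f (pt v x y)) := by
  obtain ⟨ζ, hζ, hζpt⟩ := h.exists_extremal_parallelogram σ
  rw [h.futaki_eq hc hL (ζ := ζ) (by rw [hσ] at hζ; exact hζ) hf]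
  have hσi : ∀ i, sideWeight v 1 1 i / c i = σ i := fun i => by rw [hσ]
  simp only [hσi]
  obtain ⟨s0, s1, s2, s3⟩ := h.sideInt_parallelogram f
  have hG : Continuous fun p : ℝ × ℝ => f (pt v p.1 p.2) := by fun_prop
  have hGx : ∀ y, Continuous fun x => f (pt v x y) := by
    fun_prop
  have hGy : ∀ x, Continuous fun y => f (pt v x y) := by
    fun_prop
  have hX := continuous_intervalExtremal (σ 3) (σ 1)
  have hY := continuous_intervalExtremal (σ 0) (σ 2)
  have hXG : Continuous fun p : ℝ × ℝ => intervalExtremal (σ 3) (σ 1) p.1 * f (pt v p.1 p.2) :=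
    (hX.comp continuous_fst).mul hG
  have hYG : Continuous fun p : ℝ × ℝ => intervalExtremal (σ 0) (σ 2) p.2 * f (pt v p.1 p.2) :=
    (hY.comp continuous_snd).mul hG
  have hXs : ∀ y, Continuous fun x => intervalExtremal (σ 3) (σ 1) x * f (pt v x y) :=
    fun y => hX.mul (hGx y)
  have hXs' : ∀ x, Continuous fun y => intervalExtremal (σ 3) (σ 1) x * f (pt v x y) :=
    fun x => continuous_const.mul (hGy x)
  have hYs : ∀ x, Continuous fun y => intervalExtremal (σ 0) (σ 2) y * f (pt v x y) :=
    fun x => hY.mul (hGy x)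
  have hIX : Continuous fun y => ∫ x in (0 : ℝ)..1, intervalExtremal (σ 3) (σ 1) x * f (pt v x y) :=
    intervalIntegral.continuous_parametric_intervalIntegral_of_continuous'
      (f := fun y x => intervalExtremal (σ 3) (σ 1) x * f (pt v x y)) (by fun_prop) 0 1
  have hIX' : Continuous fun x => ∫ y in (0 : ℝ)..1, intervalExtremal (σ 3) (σ 1) x * f (pt v x y) :=
    intervalIntegral.continuous_parametric_intervalIntegral_of_continuous' hXG 0 1
  have hIY : Continuous fun x => ∫ y in (0 : ℝ)..1, intervalExtremal (σ 0) (σ 2) y * f (pt v x y) :=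
    intervalIntegral.continuous_parametric_intervalIntegral_of_continuous' hYG 0 1
  have hint : ∫ z in quad v, ζ z * f z =
      (∫ y in (0 : ℝ)..1, ∫ x in (0 : ℝ)..1, intervalExtremal (σ 3) (σ 1) x * f (pt v x y)) +
      ∫ x in (0 : ℝ)..1, ∫ y in (0 : ℝ)..1, intervalExtremal (σ 0) (σ 2) y * f (pt v x y) := by
    -- The Jacobian is absorbed in the splitting `hζpt` of `ζ`; Fubini then puts each summand in the
    -- order of integration adapted to its own variable.
    rw [h.quad_eq_image, setIntegral_parallelogram h.cross_ne (continuous_affFun_mul ζ hf),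
      ← intervalIntegral_swap hXG, ← intervalIntegral.integral_add (hIX'.intervalIntegrable _ _)
        (hIY.intervalIntegrable _ _), ← intervalIntegral.integral_const_mul]
    refine intervalIntegral.integral_congr fun x _ => ?_
    rw [← intervalIntegral.integral_add ((hXs' x).intervalIntegrable _ _)
        ((hYs x).intervalIntegrable _ _), ← intervalIntegral.integral_const_mul]
    refine intervalIntegral.integral_congr fun y _ => ?_
    rw [← add_mul, ← hζpt, mul_assoc]
    rfl
  rw [hint, Fin.sum_univ_four, s0, s1, s2, s3,
    intervalIntegral.integral_sub (Continuous.intervalIntegrable (by fun_prop) _ _)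
      (hIX.intervalIntegrable _ _),
    intervalIntegral.integral_sub (Continuous.intervalIntegrable (by fun_prop) _ _)
      (hIY.intervalIntegrable _ _),
    intervalIntegral.integral_const_mul, intervalIntegral.integral_const_mul,
    intervalIntegral.integral_add (Continuous.intervalIntegrable (by fun_prop) _ _)
      (Continuous.intervalIntegrable (by fun_prop) _ _),
    intervalIntegral.integral_add (Continuous.intervalIntegrable (by fun_prop) _ _)
      (Continuous.intervalIntegrable (by fun_prop) _ _),
    intervalIntegral.integral_const_mul, intervalIntegral.integral_const_mul,
    intervalIntegral.integral_const_mul, intervalIntegral.integral_const_mul]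
  ring

/-- Parallelograms are K-polystable for every choice of affine normals. -/
lemma isKPolystable_parallelogram (h : IsQuad v 1 1) {L : Fin 4 → AffFun}
    (hLn : IsAffineNormals (quad v) L) : IsKPolystable (quad v) L := by
  obtain ⟨k, c, hc, hL⟩ := h.exists_of_isAffineNormals hLn
  refine h.isKPolystable_of_supFun hc hL fun s hs => ?_
  set f := supFun s hs with hf
  have hfc : Continuous f := continuous_supFun s hs
  have hfconv : ConvexOn ℝ Set.univ f := convexOn_supFun s hs
  set σ : Fin 4 → ℝ := fun i => sideWeight v 1 1 i / c i with hσ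
  have hσ0 : ∀ i, 0 < σ i := fun i => div_pos (h.sideWeight_pos i) (hc i)
  have hG : Continuous fun p : ℝ × ℝ => f (pt v p.1 p.2) := by fun_prop
  have hGx : ∀ y, Continuous fun x => f (pt v x y) := by
    fun_prop
  have hGy : ∀ x, Continuous fun y => f (pt v x y) := by
    fun_prop
  have hX := continuous_intervalExtremal (σ 3) (σ 1)
  have hY := continuous_intervalExtremal (σ 0) (σ 2)
  have hXG : Continuous fun p : ℝ × ℝ => intervalExtremal (σ 3) (σ 1) p.1 * f (pt v p.1 p.2) :=
    (hX.comp continuous_fst).mul hG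
  have hYG : Continuous fun p : ℝ × ℝ => intervalExtremal (σ 0) (σ 2) p.2 * f (pt v p.1 p.2) :=
    (hY.comp continuous_snd).mul hG
  have hIX : Continuous fun y => ∫ x in (0 : ℝ)..1, intervalExtremal (σ 3) (σ 1) x * f (pt v x y) :=
    intervalIntegral.continuous_parametric_intervalIntegral_of_continuous'
      (f := fun y x => intervalExtremal (σ 3) (σ 1) x * f (pt v x y)) (by fun_prop) 0 1
  have hIY : Continuous fun x => ∫ y in (0 : ℝ)..1, intervalExtremal (σ 0) (σ 2) y * f (pt v x y) :=
    intervalIntegral.continuous_parametric_intervalIntegral_of_continuous' hYG 0 1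
  have hlx := fun y => integral_intervalExtremal_mul_le (hσ0 3) (hσ0 1) (hGx y)
    (convexOn_pt_left v hfconv y)
  have hly := fun x => integral_intervalExtremal_mul_le (hσ0 0) (hσ0 2) (hGy x)
    (convexOn_pt_right v hfconv x)
  have n1 := intervalIntegral.integral_nonneg (μ := volume) zero_le_one
    fun y (_ : y ∈ Set.Icc (0 : ℝ) 1) => sub_nonneg.2 (hlx y).1
  have n2 := intervalIntegral.integral_nonneg (μ := volume) zero_le_one
    fun x (_ : x ∈ Set.Icc (0 : ℝ) 1) => sub_nonneg.2 (hly x).1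
  rw [h.futaki_parallelogram hc hL hfc hσ]
  refine ⟨by linarith, fun h0 => ?_⟩
  have z1 := eq_zero_of_intervalIntegral_eq_zero (by fun_prop)
    (fun y (_ : y ∈ Set.Icc (0 : ℝ) 1) => sub_nonneg.2 (hlx y).1) (by linarith)
  have z2 := eq_zero_of_intervalIntegral_eq_zero (by fun_prop)
    (fun x (_ : x ∈ Set.Icc (0 : ℝ) 1) => sub_nonneg.2 (hly x).1) (by linarith)
  have e1 : ∀ y ∈ Set.Icc (0 : ℝ) 1, ∀ x ∈ Set.Icc (0 : ℝ) 1,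
      f (pt v x y) = (1 - x) * f (pt v 0 y) + x * f (pt v 1 y) := fun y hy =>
    (hlx y).2 (sub_eq_zero.1 (z1 y hy)).symm
  have e2 : ∀ x ∈ Set.Icc (0 : ℝ) 1, ∀ y ∈ Set.Icc (0 : ℝ) 1,
      f (pt v x y) = (1 - y) * f (pt v x 0) + y * f (pt v x 1) := fun x hx =>
    (hly x).2 (sub_eq_zero.1 (z2 x hx)).symm
  have m0 : (0 : ℝ) ∈ Set.Icc (0 : ℝ) 1 := ⟨le_rfl, zero_le_one⟩
  have m1 : (1 : ℝ) ∈ Set.Icc (0 : ℝ) 1 := ⟨zero_le_one, le_rfl⟩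
  have mh : (1 / 2 : ℝ) ∈ Set.Icc (0 : ℝ) 1 := ⟨by norm_num, by norm_num⟩
  -- By `e1` and `e2`, `f` is bilinear. Midpoint convexity on the two diagonals bounds the
  -- coefficient of `x y` from opposite sides by zero.
  have d1 := hfconv.2 (Set.mem_univ (pt v 0 0)) (Set.mem_univ (pt v 1 1))
    (by norm_num : (0 : ℝ) ≤ 1 / 2) (by norm_num : (0 : ℝ) ≤ 1 / 2) (by norm_num)
  have d2 := hfconv.2 (Set.mem_univ (pt v 1 0)) (Set.mem_univ (pt v 0 1))
    (by norm_num : (0 : ℝ) ≤ 1 / 2) (by norm_num : (0 : ℝ) ≤ 1 / 2) (by norm_num)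
  have p1 : (1 / 2 : ℝ) • pt v 0 0 + (1 / 2 : ℝ) • pt v 1 1 = pt v (1 / 2) (1 / 2) := by
    simp only [pt]; module
  have p2 : (1 / 2 : ℝ) • pt v 1 0 + (1 / 2 : ℝ) • pt v 0 1 = pt v (1 / 2) (1 / 2) := by
    simp only [pt]; module
  rw [p1, smul_eq_mul, smul_eq_mul, e1 _ mh _ mh, e2 _ m0 _ mh, e2 _ m1 _ mh] at d1
  rw [p2, smul_eq_mul, smul_eq_mul, e1 _ mh _ mh, e2 _ m0 _ mh, e2 _ m1 _ mh] at d2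
  have hbal : f (pt v 0 0) + f (pt v 1 1) = f (pt v 1 0) + f (pt v 0 1) := by linarith
  refine ⟨interp v (f (pt v 0 0)) (f (pt v 1 0)) (f (pt v 0 1)), fun z hz => ?_⟩
  rw [h.quad_eq_image] at hz
  obtain ⟨⟨x, y⟩, ⟨hx, hy⟩, rfl⟩ := hz
  change f (pt v x y) = interp v _ _ _ (pt v x y)
  rw [h.interp_pt, e1 y hy x hx, e2 0 m0 y hy, e2 1 m1 y hy]
  linear_combination x * y * hbal

end IsQuad

lemma simplePL_eq_supFun (a : AffFun) :
    ∃ s hs, simplePL a = supFun s hs := by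
  classical
  refine ⟨{0, a}, ⟨0, by simp⟩, ?_⟩
  ext x
  change max 0 (a x) = ({0, a} : Finset AffFun).sup' _ fun b => b x
  rw [Finset.sup'_insert (Finset.singleton_nonempty a), Finset.sup'_singleton]
  rfl

lemma continuous_simplePL (a : AffFun) : Continuous (simplePL a) :=
  continuous_const.max (continuous_affFun a)

lemma isPLConvexOn_simplePL (Δ : Set Plane) (a : AffFun) : IsPLConvexOn Δ (simplePL a) := by
  obtain ⟨s, hs, h⟩ := simplePL_eq_supFun a
  exact ⟨s, hs, fun x _ => by rw [h]; rfl⟩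

/-! ### Open cones of side masses -/

/-- Points of the form `κ / N` with `N` a vector of positive integers meet every open cone which
meets the positive orthant. -/
lemma exists_nat_div_mem {ι : Type*} [Finite ι] {U : Set (ι → ℝ)} (hU : IsOpen U)
    (hcone : ∀ t : ℝ, 0 < t → ∀ σ ∈ U, (fun i => t * σ i) ∈ U) {p : ι → ℝ} (hpU : p ∈ U)
    (hp : ∀ i, 0 < p i) {κ : ι → ℝ} (hκ : ∀ i, 0 < κ i) :
    ∃ N : ι → ℕ, (∀ i, 0 < N i) ∧ (fun i => κ i / N i) ∈ U := by
  -- Choose `N i` as `x κ i / p i` rounded up: then `x κ i / N i` tends to `p i`, and the cone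
  -- property removes the factor `x`.
  have hlim : Filter.Tendsto (fun x : ℝ => fun i => x * (κ i / (⌈κ i / p i * x⌉₊ : ℝ)))
      Filter.atTop (nhds p) := by
    rw [tendsto_pi_nhds]
    intro i
    have hpos : 0 < κ i / p i := div_pos (hκ i) (hp i)
    have h1 := (tendsto_nat_ceil_mul_div_atTop hpos.le).inv₀ hpos.ne'
    have h2 := h1.const_mul (κ i)
    have e : κ i * (κ i / p i)⁻¹ = p i := by
      have := (hκ i).ne'
      have := (hp i).ne'
      field_simp
    rw [e] at h2
    refine h2.congr fun x => ?_
    rw [inv_div]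
    ring
  obtain ⟨x, hx, hx0⟩ := ((hlim.eventually (hU.mem_nhds hpU)).and
    (Filter.eventually_gt_atTop 0)).exists
  refine ⟨fun i => ⌈κ i / p i * x⌉₊, fun i => ?_, ?_⟩
  · exact Nat.ceil_pos.2 (mul_pos (div_pos (hκ i) (hp i)) hx0)
  · have := hcone x⁻¹ (inv_pos.2 hx0) _ hx
    convert this using 2 with i
    rw [← mul_assoc, inv_mul_cancel₀ hx0.ne', one_mul]

lemma exists_pos_mem_of_isOpen {ι : Type*} {U : Set (ι → ℝ)} (hU : IsOpen U) {p : ι → ℝ}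
    (hpU : p ∈ U) (hp : ∀ i, 0 ≤ p i) : ∃ q ∈ U, ∀ i, 0 < q i := by
  have hc : Continuous fun ε : ℝ => fun i => p i + ε := by fun_prop
  have hev : ∀ᶠ ε : ℝ in nhdsWithin 0 (Set.Ioi 0), (fun i => p i + ε) ∈ U := by
    refine (hc.continuousAt.eventually (hU.mem_nhds ?_)).filter_mono nhdsWithin_le_nhds
    simpa using hpU
  obtain ⟨ε, hε, hε0⟩ := (hev.and self_mem_nhdsWithin).exists
  exact ⟨_, hε, fun i => add_pos_of_nonneg_of_pos (hp i) hε0⟩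

namespace IsQuad

variable {v : Fin 4 → Plane} {m n : ℝ}

lemma affFun_eq_of_integral_eq (h : IsQuad v m n) {ζ ζ' : AffFun}
    (H : ∀ a : AffFun, ∫ z in quad v, ζ z * a z = ∫ z in quad v, ζ' z * a z) : ζ = ζ' := by
  have huniq := existsUnique_isExtremalAffine (isCompact_quad v) h.interior_nonempty
    (h.isAffineNormals (k := Equiv.refl _) (L := fun i => (1 : ℝ) • sideFun v m n i)
      (fun _ => one_pos) fun i => rfl)
  obtain ⟨ξ, hξ, hun⟩ := huniq
  -- Nondegeneracy of the pairing is read off from uniqueness: adding `ζ - ζ'` to an extremal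
  -- function gives another one.
  have hξ' : IsExtremalAffine (quad v) (fun i => (1 : ℝ) • sideFun v m n i) (ξ + (ζ - ζ')) := by
    intro a
    rw [← hξ a]
    have e : ∀ z, (ξ + (ζ - ζ')) z * a z = ξ z * a z + (ζ z * a z - ζ' z * a z) := fun z => by
      rw [AffineMap.coe_add, Pi.add_apply, AffineMap.coe_sub, Pi.sub_apply]
      ring
    have hi : ∀ b : AffFun, IntegrableOn (fun z => b z * a z) (quad v) := fun b =>
      integrableOn_quad v (continuous_affFun_mul b (continuous_affFun a))
    have hd : IntegrableOn (fun z => ζ z * a z - ζ' z * a z) (quad v) := (hi ζ).sub (hi ζ')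
    simp only [e]
    rw [integral_add (hi ξ) hd, integral_sub (hi ζ) (hi ζ'), H a, sub_self,
      add_zero]
  have := hun _ hξ'
  exact sub_eq_zero.1 (add_eq_left.1 this)

lemma integral_sum_smul_mul (v : Fin 4 → Plane) (Z : Fin 4 → AffFun) (σ : Fin 4 → ℝ)
    {f : Plane → ℝ} (hf : Continuous f) :
    ∫ z in quad v, (∑ i, σ i • Z i) z * f z = ∑ i, σ i * ∫ z in quad v, Z i z * f z := by
  have e : ∀ z, (∑ i, σ i • Z i) z * f z = ∑ i, σ i * (Z i z * f z) := by
    intro z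
    simp only [Fin.sum_univ_four, AffineMap.coe_add, AffineMap.coe_smul, Pi.add_apply,
      Pi.smul_apply, smul_eq_mul]
    ring
  simp only [e]
  rw [integral_finsetSum _ fun i _ =>
    (integrableOn_quad v (continuous_affFun_mul (Z i) hf)).const_mul (σ i)]
  simp only [integral_const_mul]

/-- The centroid of a quadrilateral. -/
noncomputable def centroid (v : Fin 4 → Plane) (m n : ℝ) : Plane :=
  pt v ((n + (m + n) * m) / (3 * (m + n))) ((m + (m + n) * n) / (3 * (m + n)))

lemma sideFun_centroid_pos (h : IsQuad v m n) (i : Fin 4) :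
    0 < sideFun v m n i (centroid v m n) := by
  have hm := h.m_pos
  have hn := h.n_pos
  have hmn := h.one_lt
  have h1 : 0 < m + n - 1 := by linarith
  rw [centroid, h.sideFun_pt]
  fin_cases i
  · change 0 < (m + (m + n) * n) / (3 * (m + n))
    positivity
  · change 0 < n - n * ((n + (m + n) * m) / (3 * (m + n))) +
      (m - 1) * ((m + (m + n) * n) / (3 * (m + n)))
    have : n - n * ((n + (m + n) * m) / (3 * (m + n))) +
      (m - 1) * ((m + (m + n) * n) / (3 * (m + n))) =
      ((m + n) * n + m * (m + n - 1)) / (3 * (m + n)) := by field_simp; ring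
    rw [this]
    positivity
  · change 0 < m + (n - 1) * ((n + (m + n) * m) / (3 * (m + n))) -
      m * ((m + (m + n) * n) / (3 * (m + n)))
    have : m + (n - 1) * ((n + (m + n) * m) / (3 * (m + n))) -
      m * ((m + (m + n) * n) / (3 * (m + n))) =
      ((m + n) * m + n * (m + n - 1)) / (3 * (m + n)) := by field_simp; ring
    rw [this]
    positivity
  · change 0 < (n + (m + n) * m) / (3 * (m + n))
    positivity

/-- The extremal affine function of the cone measure of the centroid is constant. -/
lemma integral_centroid (h : IsQuad v m n) (a : AffFun) :
    ∫ z in quad v, interp v 4 4 4 z * a z = 2 * ∑ i, |cross (v 1 - v 0) (v 3 - v 0)| *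
      sideFun v m n i (centroid v m n) * sideInt v i a := by
  -- Conceptually, the divergence theorem for `a` times the radial field from `O` gives the
  -- cone-measure integral of `a` as the integral of `3 a - a O`, which is that of `2 a` when `O` is
  -- the centroid. The proof checks the resulting identity in the vertex values.
  have hmn : m + n ≠ 0 := (add_pos h.m_pos h.n_pos).ne'
  rw [h.setIntegral_mul, h.apply_two (interp v _ _ _), h.interp_zero, h.interp_one,
    h.interp_three]
  simp only [sideInt_affFun, Fin.sum_univ_four, centroid, h.sideFun_pt]
  change _ = 2 * (|cross (v 1 - v 0) (v 3 - v 0)| * ((m + (m + n) * n) / (3 * (m + n))) *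
      ((a (v 0) + a (v 1)) / 2) +
    |cross (v 1 - v 0) (v 3 - v 0)| * (n - n * ((n + (m + n) * m) / (3 * (m + n))) +
      (m - 1) * ((m + (m + n) * n) / (3 * (m + n)))) * ((a (v 1) + a (v 2)) / 2) +
    |cross (v 1 - v 0) (v 3 - v 0)| * (m + (n - 1) * ((n + (m + n) * m) / (3 * (m + n))) -
      m * ((m + (m + n) * n) / (3 * (m + n)))) * ((a (v 2) + a (v 3)) / 2) +
    |cross (v 1 - v 0) (v 3 - v 0)| * ((n + (m + n) * m) / (3 * (m + n))) *
      ((a (v 3) + a (v 0)) / 2))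
  rw [h.apply_two a]
  field_simp
  ring

/-- The side masses of K-polystable affine normals contain a nonempty open cone. -/
lemma exists_cone_isKPolystable (h : IsQuad v m n) :
    ∃ U : Set (Fin 4 → ℝ), IsOpen U ∧ (∀ t : ℝ, 0 < t → ∀ σ ∈ U, (fun i => t * σ i) ∈ U) ∧
      (∃ p ∈ U, ∀ i, 0 < p i) ∧
      ∀ (L : Fin 4 → AffFun) (k : Equiv.Perm (Fin 4)) (c : Fin 4 → ℝ), (∀ i, 0 < c i) →
        (∀ i, L (k i) = c i • sideFun v m n i) → (fun i => sideWeight v m n i / c i) ∈ U →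
        IsKPolystable (quad v) L := by
  choose Z hZ using h.exists_sideExtremal
  set J := |cross (v 1 - v 0) (v 3 - v 0)| with hJ
  set O := centroid v m n with hO
  have hJ0 : 0 < J := abs_pos.2 h.cross_ne
  have hval : ∀ (σ : Fin 4 → ℝ) (z : Plane), (∑ i, σ i • Z i) z = ∑ i, σ i * Z i z := by
    intro σ z
    simp only [Fin.sum_univ_four, AffineMap.coe_add, AffineMap.coe_smul, Pi.add_apply,
      Pi.smul_apply, smul_eq_mul]
  have hext : ∀ (σ : Fin 4 → ℝ) (a : AffFun), ∫ z in quad v, (∑ i, σ i • Z i) z * a z =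
      2 * ∑ i, σ i * sideInt v i a := by
    intro σ a
    rw [integral_sum_smul_mul v Z σ (continuous_affFun a), Finset.mul_sum]
    refine Finset.sum_congr rfl fun i _ => ?_
    rw [hZ]
    ring
  -- With `O` fixed at the centroid, the hypothesis of the criterion is a finite system of strict
  -- homogeneous linear inequalities in `σ`.
  refine ⟨{σ | ∀ i j, (∑ l, σ l * Z l (v j)) * (J * sideFun v m n i O) < 6 * σ i}, ?_, ?_,
    ⟨fun i => J * sideFun v m n i O, ?_, fun i => mul_pos hJ0 (h.sideFun_centroid_pos i)⟩, ?_⟩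
  · simp only [Set.ofPred_forall]
    exact isOpen_iInter_of_finite fun i => isOpen_iInter_of_finite fun j =>
      isOpen_lt (by fun_prop) (by fun_prop)
  · intro t ht σ hσ i j
    have h1 : ∑ l, t * σ l * Z l (v j) = t * ∑ l, σ l * Z l (v j) := by
      rw [Finset.mul_sum]
      exact Finset.sum_congr rfl fun l _ => mul_assoc _ _ _
    rw [h1, mul_assoc]
    have := mul_lt_mul_of_pos_left (hσ i j) ht
    linarith
  · intro i j
    have h1 : (∑ i, (J * sideFun v m n i O) • Z i) = interp v 4 4 4 := by
      refine h.affFun_eq_of_integral_eq fun a => ?_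
      rw [hext fun i => J * sideFun v m n i O, h.integral_centroid]
    have hj : interp v 4 4 4 (v j) = 4 := by
      rw [h.vertex_eq_pt j, h.interp_pt]
      ring
    simp only
    rw [← hval fun i => J * sideFun v m n i O, h1, hj]
    -- For the cone masses of the centroid the inequality is `4 κ < 6 κ` with `κ > 0`.
    have := mul_pos hJ0 (h.sideFun_centroid_pos i)
    linarith
  · intro L k c hc hL hU
    refine h.isKPolystable_of_lt hc hL h.sideFun_centroid_pos
      (hext fun i => sideWeight v m n i / c i) fun i j => ?_
    rw [hval]
    exact hU i j

/-- If the Futaki invariant of the unit measure on one side is negative on a simple PL function,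
then so is that of all affine normals whose side masses lie in some open cone meeting the positive
orthant. -/
lemma exists_cone_futaki_neg (h : IsQuad v m n) {i₀ : Fin 4} {ζ a : AffFun}
    (hζ : ∀ b : AffFun, ∫ z in quad v, ζ z * b z = 2 * sideInt v i₀ b)
    (hneg : sideInt v i₀ (simplePL a) - 1 / 2 * ∫ z in quad v, ζ z * simplePL a z < 0) :
    ∃ U : Set (Fin 4 → ℝ), IsOpen U ∧ (∀ t : ℝ, 0 < t → ∀ σ ∈ U, (fun i => t * σ i) ∈ U) ∧
      (∃ p ∈ U, ∀ i, 0 < p i) ∧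
      ∀ (L : Fin 4 → AffFun) (k : Equiv.Perm (Fin 4)) (c : Fin 4 → ℝ), (∀ i, 0 < c i) →
        (∀ i, L (k i) = c i • sideFun v m n i) → (fun i => sideWeight v m n i / c i) ∈ U →
        futaki (quad v) L (simplePL a) < 0 := by
  choose Z hZ using h.exists_sideExtremal
  have hZ0 : Z i₀ = ζ := h.affFun_eq_of_integral_eq fun b => by rw [hZ, hζ]
  have hext : ∀ (σ : Fin 4 → ℝ) (a : AffFun), ∫ z in quad v, (∑ i, σ i • Z i) z * a z =
      2 * ∑ i, σ i * sideInt v i a := by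
    intro σ a
    rw [integral_sum_smul_mul v Z σ (continuous_affFun a), Finset.mul_sum]
    refine Finset.sum_congr rfl fun i _ => ?_
    rw [hZ]
    ring
  set F : Fin 4 → ℝ := fun i =>
    sideInt v i (simplePL a) - 1 / 2 * ∫ z in quad v, Z i z * simplePL a z with hF
  have hopen : IsOpen {σ : Fin 4 → ℝ | ∑ i, σ i * F i < 0} :=
    isOpen_lt (by fun_prop) continuous_const
  -- An open half-space containing the basis vector at `i₀`. That vector lies on the boundary of the
  -- positive orthant and is pushed inside it.
  refine ⟨{σ | ∑ i, σ i * F i < 0}, hopen, ?_,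
    exists_pos_mem_of_isOpen hopen (p := Pi.single i₀ 1) ?_ ?_, ?_⟩
  · intro t ht σ hσ
    have h1 : ∑ i, t * σ i * F i = t * ∑ i, σ i * F i := by
      rw [Finset.mul_sum]
      exact Finset.sum_congr rfl fun l _ => mul_assoc _ _ _
    exact h1.trans_lt (mul_neg_of_pos_of_neg ht hσ)
  · change ∑ i, (Pi.single i₀ 1 : Fin 4 → ℝ) i * F i < 0
    rw [Finset.sum_eq_single i₀ (fun j _ hj => by rw [Pi.single_eq_of_ne hj, zero_mul])
      (fun hn => absurd (Finset.mem_univ _) hn), Pi.single_eq_same, one_mul, hF]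
    simp only
    rw [hZ0]
    exact hneg
  · intro j
    by_cases hj : j = i₀
    · rw [hj, Pi.single_eq_same]; exact zero_le_one
    · rw [Pi.single_eq_of_ne hj]
  · intro L k c hc hL hU
    rw [h.futaki_eq hc hL (hext fun i => sideWeight v m n i / c i) (continuous_simplePL a),
      integral_sum_smul_mul v Z _ (continuous_simplePL a)]
    refine lt_of_eq_of_lt ?_ hU
    rw [Finset.mul_sum, ← Finset.sum_sub_distrib]
    refine Finset.sum_congr rfl fun i _ => ?_
    simp only [hF]
    ring

/-- Affine normals can be rescaled by positive integers so that their side masses lie in a given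
open cone. -/
lemma exists_nat_smul (h : IsQuad v m n) {L : Fin 4 → AffFun}
    (hLn : IsAffineNormals (quad v) L) {U : Set (Fin 4 → ℝ)} (hU : IsOpen U)
    (hcone : ∀ t : ℝ, 0 < t → ∀ σ ∈ U, (fun i => t * σ i) ∈ U) (hpU : ∃ p ∈ U, ∀ i, 0 < p i) :
    ∃ (N : Fin 4 → ℕ) (k : Equiv.Perm (Fin 4)) (c : Fin 4 → ℝ), (∀ i, 0 < c i) ∧
      (∀ i, ((N (k i) : ℝ) • L (k i)) = c i • sideFun v m n i) ∧
      (fun i => sideWeight v m n i / c i) ∈ U := by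
  obtain ⟨k, c, hc, hL⟩ := h.exists_of_isAffineNormals hLn
  obtain ⟨p, hpU, hp⟩ := hpU
  obtain ⟨N, hN, hNU⟩ := exists_nat_div_mem hU hcone hpU hp
    (κ := fun i => sideWeight v m n i / c i) fun i => div_pos (h.sideWeight_pos i) (hc i)
  refine ⟨fun j => N (k.symm j), k, fun i => N i * c i, fun i =>
    mul_pos (Nat.cast_pos.2 (hN i)) (hc i), fun i => ?_, ?_⟩
  · simp only [Equiv.symm_apply_apply]
    rw [hL, smul_smul]
  · convert hNU using 2 with i
    rw [div_div, mul_comm (c i)]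

end IsQuad

/-! ### Destabilization by a crease close to a side -/

lemma integral_max_zero {δ : ℝ} (h0 : 0 ≤ δ) (h1 : δ ≤ 1) :
    ∫ t in (0 : ℝ)..1, max 0 (δ - 1 + t) = δ ^ 2 / 2 := by
  have hc : Continuous fun t : ℝ => max 0 (δ - 1 + t) := by fun_prop
  rw [← intervalIntegral.integral_add_adjacent_intervals (hc.intervalIntegrable 0 (1 - δ))
    (hc.intervalIntegrable (1 - δ) 1)]
  have e1 : ∫ t in (0 : ℝ)..(1 - δ), max 0 (δ - 1 + t) = ∫ _ in (0 : ℝ)..(1 - δ), (0 : ℝ) := by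
    refine intervalIntegral.integral_congr fun t ht => ?_
    rw [Set.uIcc_of_le (by linarith)] at ht
    exact max_eq_left (by linarith [ht.2])
  have e2 : ∫ t in (1 - δ)..1, max 0 (δ - 1 + t) = ∫ t in (1 - δ)..1, (δ - 1 + t) := by
    refine intervalIntegral.integral_congr fun t ht => ?_
    rw [Set.uIcc_of_le (by linarith)] at ht
    exact max_eq_right (by linarith [ht.1])
  rw [e1, e2, intervalIntegral.integral_zero, intervalIntegral.integral_add
    (Continuous.intervalIntegrable (by fun_prop) _ _)
    (Continuous.intervalIntegrable (by fun_prop) _ _), intervalIntegral.integral_const,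
    integral_id, smul_eq_mul]
  ring

namespace IsQuad

variable {v : Fin 4 → Plane} {m n : ℝ}

/-- The part of a quadrilateral on one side of a line which meets the sides `v 1, v 2` and
`v 3, v 0` is again a quadrilateral. -/
lemma cut (h : IsQuad v m n) {δ τ : ℝ} (hδ0 : 0 < δ) (hδ1 : δ < 1) (hτ0 : 0 < τ) (hτ1 : τ < 1)
    (hq : 0 < 1 + τ * (m - 1)) (hd : 0 < δ * (m - 1) + n) :
    IsQuad ![v 0, v 1, pt v (1 + τ * (m - 1)) (τ * n), pt v 0 δ] (1 + τ * (m - 1)) (τ * n / δ) ∧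
    quad ![v 0, v 1, pt v (1 + τ * (m - 1)) (τ * n), pt v 0 δ] = quad v ∩
      {z | 0 ≤ interp v δ (τ * (δ * (m - 1) + n) / (1 + τ * (m - 1))) (δ - 1) z} := by
  have hn := h.n_pos
  -- The crease joins the point at parameter `δ` from `v 0` on `v 0, v 3` to the point at parameter
  -- `τ` from `v 1` on `v 1, v 2`, whose frame coordinates are `(q, τ n)`. The affine function has
  -- slope `-1` along `v 0, v 3`; its value at `v 1` is forced by vanishing at the second point.
  set q := 1 + τ * (m - 1) with hqdef
  set w : Fin 4 → Plane := ![v 0, v 1, pt v q (τ * n), pt v 0 δ] with hw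
  have w0 : w 0 = v 0 := rfl
  have w1 : w 1 = v 1 := rfl
  have w2 : w 2 = pt v q (τ * n) := rfl
  have w3 : w 3 = pt v 0 δ := rfl
  -- The frame of the cut quadrilateral has the same first axis and its second axis shrunk by `δ`.
  have hpt : ∀ x y, pt v x y = pt w x (y / δ) := by
    intro x y
    simp only [pt, w0, w1, w3]
    match_scalars <;> field_simp <;> ring
  have hwq : IsQuad w q (τ * n / δ) := by
    refine ⟨hq, div_pos (mul_pos hτ0 hn) hδ0, ?_, ?_, ?_⟩
    · have : q + τ * n / δ = 1 + τ * (δ * (m - 1) + n) / δ := by rw [hqdef]; field_simp; ring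
      rw [this]
      have := div_pos (mul_pos hτ0 hd) hδ0
      linarith
    · have : cross (w 1 - w 0) (w 3 - w 0) = δ * cross (v 1 - v 0) (v 3 - v 0) := by
        rw [w0, w1, w3]
        simp only [cross, pt, PiLp.add_apply, PiLp.sub_apply, PiLp.smul_apply, smul_eq_mul]
        ring
      rw [this]
      exact mul_ne_zero hδ0.ne' h.cross_ne
    · rw [w2, hpt]
      rfl
  refine ⟨hwq, Set.Subset.antisymm ?_ ?_⟩
  · refine convexHull_min ?_ ((convex_quad v).inter (convex_setOf_nonneg _))
    rintro _ ⟨i, rfl⟩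
    have ha : ∀ x y, interp v δ (τ * (δ * (m - 1) + n) / q) (δ - 1) (pt v x y) =
        δ + x * (τ * (δ * (m - 1) + n) / q - δ) - y := fun x y => by rw [h.interp_pt]; ring
    fin_cases i
    · refine ⟨vertex_mem_quad v 0, ?_⟩
      change 0 ≤ interp v _ _ _ (v 0)
      rw [h.interp_zero]
      exact hδ0.le
    · refine ⟨vertex_mem_quad v 1, ?_⟩
      change 0 ≤ interp v _ _ _ (v 1)
      rw [h.interp_one]
      exact (div_pos (mul_pos hτ0 hd) hq).le
    · refine ⟨?_, ?_⟩
      · change pt v q (τ * n) ∈ quad v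
        refine (convex_quad v).segment_subset (vertex_mem_quad v 1) (vertex_mem_quad v 2)
          ⟨1 - τ, τ, by linarith, hτ0.le, by ring, ?_⟩
        rw [h.eq, pt, hqdef]
        module
      · change 0 ≤ interp v _ _ _ (pt v q (τ * n))
        rw [ha]
        have : δ + q * (τ * (δ * (m - 1) + n) / q - δ) - τ * n = 0 := by
          field_simp
          rw [hqdef]
          ring
        rw [this]
    · refine ⟨?_, ?_⟩
      · change pt v 0 δ ∈ quad v
        refine (convex_quad v).segment_subset (vertex_mem_quad v 0) (vertex_mem_quad v 3)
          ⟨1 - δ, δ, by linarith, hδ0.le, by ring, ?_⟩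
        rw [pt]
        module
      · change 0 ≤ interp v _ _ _ (pt v 0 δ)
        rw [ha]
        linarith
  · rintro z ⟨hz, hza⟩
    rw [h.quad_eq_setOf] at hz
    obtain ⟨x, y, rfl⟩ := h.exists_pt z
    have hz' : ∀ i, 0 ≤ ![y, n - n * x + (m - 1) * y, m + (n - 1) * x - m * y, x] i :=
      fun i => (hz i).trans_eq (h.sideFun_pt x y i)
    have h0 : 0 ≤ y := hz' 0
    have h1 : 0 ≤ n - n * x + (m - 1) * y := hz' 1
    have h3 : 0 ≤ x := hz' 3
    have h4 : 0 ≤ interp v δ (τ * (δ * (m - 1) + n) / q) (δ - 1) (pt v x y) := hza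
    rw [h.interp_pt] at h4
    rw [hwq.quad_eq_setOf]
    intro i
    rw [hpt, hwq.sideFun_pt]
    fin_cases i
    · exact div_nonneg h0 hδ0.le
    · change 0 ≤ τ * n / δ - τ * n / δ * x + (q - 1) * (y / δ)
      have : τ * n / δ - τ * n / δ * x + (q - 1) * (y / δ) =
          τ / δ * (n - n * x + (m - 1) * y) := by rw [hqdef]; field_simp; ring
      rw [this]
      exact mul_nonneg (div_pos hτ0 hδ0).le h1
    · change 0 ≤ q + (τ * n / δ - 1) * x - q * (y / δ)
      have : q + (τ * n / δ - 1) * x - q * (y / δ) = q / δ *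
          (δ + x * (τ * (δ * (m - 1) + n) / q - δ) + y * (δ - 1 - δ)) := by
        field_simp
        rw [hqdef]
        ring
      rw [this]
      exact mul_nonneg (div_pos hq hδ0).le h4
    · exact h3

/-- The invariant of the unit measure on the side `v 3, v 0`, for a simple PL function whose crease
meets this side and the opposite one. -/
lemma sideFutaki_simplePL (h : IsQuad v m n) (ζ : AffFun) {δ τ : ℝ} (hδ0 : 0 < δ) (hδ1 : δ < 1)
    (hτ0 : 0 < τ) (hτ1 : τ < 1) (hq : 0 < 1 + τ * (m - 1)) (hd : 0 < δ * (m - 1) + n) :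
    ∃ a : AffFun, sideInt v 3 (simplePL a) = δ ^ 2 / 2 ∧
      ∫ z in quad v, ζ z * simplePL a z = |cross (v 1 - v 0) (v 3 - v 0)| / 24 *
        (τ * n * ((ζ (v 0) + ζ (v 1) + (ζ (v 0) + (1 + τ * (m - 1)) * (ζ (v 1) - ζ (v 0)) +
              τ * n * (ζ (v 3) - ζ (v 0)))) *
            (δ + τ * (δ * (m - 1) + n) / (1 + τ * (m - 1))) + ζ (v 0) * δ +
            ζ (v 1) * (τ * (δ * (m - 1) + n) / (1 + τ * (m - 1)))) +
          δ ^ 2 * (1 + τ * (m - 1)) * (2 * ζ (v 0) + (ζ (v 0) + (1 + τ * (m - 1)) *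
              (ζ (v 1) - ζ (v 0)) + τ * n * (ζ (v 3) - ζ (v 0))) +
            (ζ (v 0) + δ * (ζ (v 3) - ζ (v 0))))) := by
  obtain ⟨hwq, hset⟩ := h.cut hδ0 hδ1 hτ0 hτ1 hq hd
  set q := 1 + τ * (m - 1) with hqdef
  set a := interp v δ (τ * (δ * (m - 1) + n) / q) (δ - 1) with ha
  set w : Fin 4 → Plane := ![v 0, v 1, pt v q (τ * n), pt v 0 δ] with hw
  refine ⟨a, ?_, ?_⟩
  · rw [← integral_max_zero hδ0.le hδ1.le]
    refine intervalIntegral.integral_congr fun t _ => ?_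
    change max 0 (a (v 3 + t • (v 0 - v 3))) = max 0 (δ - 1 + t)
    rw [apply_add, map_smul, linear_sub, ha, h.interp_three, h.interp_zero, smul_eq_mul]
    congr 1
    ring
  · have h1 : ∀ z, ζ z * simplePL a z = {z | 0 ≤ a z}.indicator (fun z => ζ z * a z) z := by
      intro z
      by_cases hz : 0 ≤ a z
      · rw [Set.indicator_of_mem (show z ∈ {z | 0 ≤ a z} from hz), simplePL, max_eq_right hz]
      · rw [Set.indicator_of_notMem (show z ∉ {z | 0 ≤ a z} from hz), simplePL,
          max_eq_left (not_le.1 hz).le, mul_zero]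
    have hcr : |cross (w 1 - w 0) (w 3 - w 0)| = δ * |cross (v 1 - v 0) (v 3 - v 0)| := by
      have : cross (w 1 - w 0) (w 3 - w 0) = δ * cross (v 1 - v 0) (v 3 - v 0) := by
        change cross (v 1 - v 0) (pt v 0 δ - v 0) = _
        simp only [cross, pt, PiLp.add_apply, PiLp.sub_apply, PiLp.smul_apply, smul_eq_mul]
        ring
      rw [this, abs_mul, abs_of_pos hδ0]
    have e0 : a (w 0) = δ := h.interp_zero _ _ _
    have e1 : a (w 1) = τ * (δ * (m - 1) + n) / q := h.interp_one _ _ _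
    have e2 : a (w 2) = 0 := by
      change a (pt v q (τ * n)) = 0
      rw [ha, h.interp_pt]
      field_simp
      rw [hqdef]
      ring
    have e3 : a (w 3) = 0 := by
      change a (pt v 0 δ) = 0
      rw [ha, h.interp_pt]
      ring
    have z0 : ζ (w 0) = ζ (v 0) := rfl
    have z1 : ζ (w 1) = ζ (v 1) := rfl
    have z2 : ζ (w 2) = ζ (v 0) + q * (ζ (v 1) - ζ (v 0)) + τ * n * (ζ (v 3) - ζ (v 0)) :=
      apply_pt ζ v q (τ * n)
    have z3 : ζ (w 3) = ζ (v 0) + δ * (ζ (v 3) - ζ (v 0)) := by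
      refine (apply_pt ζ v 0 δ).trans ?_
      ring
    simp only [h1]
    rw [setIntegral_indicator (isClosed_le continuous_const (continuous_affFun a)).measurableSet,
      ← hset, hwq.setIntegral_mul, hcr, e0, e1, e2, e3, z0, z1, z2, z3]
    field_simp
    ring

/-- The extremal affine function of the unit measure on the side `v 3, v 0`. -/
lemma exists_sideExtremal_three (h : IsQuad v m n) (hm1 : m ≠ 1) :
    ∃ ζ : AffFun, (∀ b : AffFun, ∫ z in quad v, ζ z * b z = 2 * sideInt v 3 b) ∧
      ∃ z₀ z₁ : ℝ, |cross (v 1 - v 0) (v 3 - v 0)| * ζ (v 0) = z₀ ∧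
        |cross (v 1 - v 0) (v 3 - v 0)| * ζ (v 1) = z₁ ∧ 0 < z₀ + z₁ ∧
        0 < 12 * z₀ + 36 * z₁ - z₀ ^ 2 - 4 * z₀ * z₁ - z₁ ^ 2 := by
  have hm := h.m_pos
  have hn := h.n_pos
  have hmn := h.one_lt
  set J := |cross (v 1 - v 0) (v 3 - v 0)| with hJ
  have hJ0 : 0 < J := abs_pos.2 h.cross_ne
  -- The common denominator in the solution of the linear system for the values of `ζ` at `v 0`, `v
  -- 1`, `v 3`. Its positivity uses `4 m n = (m + n) ^ 2 - (m - n) ^ 2`.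
  obtain ⟨E, hE⟩ : ∃ E, E = (m + n) ^ 4 - 4 * m * n * (m + n - 1) := ⟨_, rfl⟩
  have hE0 : 0 < E := by
    have h1 : 0 ≤ (m - n) ^ 2 * (m + n - 1) := mul_nonneg (sq_nonneg _) (by linarith)
    have h2 : 0 < (m + n) ^ 2 * ((m + n) ^ 2 - (m + n) + 1) :=
      mul_pos (by positivity) (by nlinarith)
    rw [hE]
    nlinarith
  set z₀ := 12 * (-2 * n ^ 2 + 3 * n ^ 3 + 2 * m * n + 3 * m * n ^ 2 + m ^ 2 * n + m ^ 3) / E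
    with hz₀
  set z₁ := 12 * (m + n) * (m ^ 2 - 2 * m - n ^ 2) / E with hz₁
  refine ⟨interp v (z₀ / J) (z₁ / J) ((z₀ + 48 * n * (m - 1) * (m + n - 1) / E) / J),
    fun b => ?_, z₀, z₁, ?_, ?_, ?_, ?_⟩
  · rw [h.setIntegral_mul, h.apply_two b, h.apply_two (interp v _ _ _), h.interp_zero,
      h.interp_one, h.interp_three, ← hJ, sideInt_affFun]
    change _ = 2 * ((b (v 3) + b (v 0)) / 2)
    rw [hz₀, hz₁]
    field_simp
    rw [hE]
    ring
  · rw [h.interp_zero, mul_div_cancel₀ _ hJ0.ne']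
  · rw [h.interp_one, mul_div_cancel₀ _ hJ0.ne']
  · have : z₀ + z₁ = 24 * (m + n - 1) * (m ^ 2 + n ^ 2) / E := by
      rw [hz₀, hz₁]
      field_simp
      ring
    rw [this]
    have : 0 < m + n - 1 := by linarith
    positivity
  -- This is where nonparallel sides enter: the expression is, up to a positive factor, the
  -- discriminant of the quadratic form below, and it vanishes exactly for `m = 1`.
  · have : 12 * z₀ + 36 * z₁ - z₀ ^ 2 - 4 * z₀ * z₁ - z₁ ^ 2 =
        576 * ((m - 1) ^ 2 * (m + n - 1) * (m + n) ^ 4) / E ^ 2 := by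
      rw [hz₀, hz₁]
      field_simp
      rw [hE]
      ring
    rw [this]
    have h1 : 0 < m + n - 1 := by linarith
    have h2 : 0 < (m - 1) ^ 2 := by
      have := sub_ne_zero.2 hm1
      positivity
    positivity

/-- Positive discriminant makes the form take negative values somewhere, and the negative cross term
allows both variables to be positive. -/
lemma exists_pos_quadratic_neg {z₀ z₁ : ℝ} (hs : 0 < z₀ + z₁)
    (hd : 0 < 12 * z₀ + 36 * z₁ - z₀ ^ 2 - 4 * z₀ * z₁ - z₁ ^ 2) :
    ∃ α β : ℝ, 0 < α ∧ 0 < β ∧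
      (24 - 3 * z₀ - z₁) * α ^ 2 - 2 * (z₀ + z₁) * α * β - (z₀ + 3 * z₁) * β ^ 2 < 0 := by
  rcases lt_or_ge (z₀ + 3 * z₁) 0 with hC | hC
  · refine ⟨-(z₀ + 3 * z₁), z₀ + z₁, by linarith, hs, ?_⟩
    have h1 : (24 - 3 * z₀ - z₁) * (-(z₀ + 3 * z₁)) ^ 2 - 2 * (z₀ + z₁) * (-(z₀ + 3 * z₁)) *
        (z₀ + z₁) - (z₀ + 3 * z₁) * (z₀ + z₁) ^ 2 =
        (z₀ + 3 * z₁) * (2 * (12 * z₀ + 36 * z₁ - z₀ ^ 2 - 4 * z₀ * z₁ - z₁ ^ 2)) := by ring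
    rw [h1]
    exact mul_neg_of_neg_of_pos hC (by linarith)
  -- The `β ^ 2` term is now nonpositive, so a large `β` lets the cross term win.
  · refine ⟨1, (|24 - 3 * z₀ - z₁| + 1) / (z₀ + z₁), one_pos, by positivity, ?_⟩
    set β := (|24 - 3 * z₀ - z₁| + 1) / (z₀ + z₁) with hβ
    have h1 : (z₀ + z₁) * β = |24 - 3 * z₀ - z₁| + 1 := by
      rw [hβ, mul_div_cancel₀ _ hs.ne']
    have h2 := le_abs_self (24 - 3 * z₀ - z₁)
    have h3 := abs_nonneg (24 - 3 * z₀ - z₁)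
    have h4 : 0 ≤ (z₀ + 3 * z₁) * β ^ 2 := mul_nonneg hC (sq_nonneg _)
    linarith

/-- Take `δ = ε α` and `τ = ε b` and let `ε` tend to 0. The boundary term and the integral both have
order `ε ^ 2`, and the limit of their rescaled difference is the quadratic form at `(α, b n)`. -/
lemma exists_sideFutaki_neg (h : IsQuad v m n) (hm1 : m ≠ 1) :
    ∃ ζ a : AffFun, (∀ b : AffFun, ∫ z in quad v, ζ z * b z = 2 * sideInt v 3 b) ∧
      sideInt v 3 (simplePL a) - 1 / 2 * ∫ z in quad v, ζ z * simplePL a z < 0 := by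
  have hn := h.n_pos
  obtain ⟨ζ, hζ, z₀, z₁, hz₀, hz₁, hs, hdisc⟩ := h.exists_sideExtremal_three hm1
  obtain ⟨α, β, hα, hβ, hneg⟩ := exists_pos_quadratic_neg hs hdisc
  obtain ⟨z₃, hz₃⟩ : ∃ z₃, |cross (v 1 - v 0) (v 3 - v 0)| * ζ (v 3) = z₃ := ⟨_, rfl⟩
  set b := β / n with hb
  have hb0 : 0 < b := div_pos hβ hn
  have hbn : b * n = β := div_mul_cancel₀ _ hn.ne'
  let Q : ℝ → ℝ := fun ε => 1 + ε * b * (m - 1)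
  let A : ℝ → ℝ := fun ε => b * (ε * α * (m - 1) + n) / Q ε
  -- The invariant divided by `ε ^ 2 / 48`, in a form continuous at `ε = 0`.
  let Ψ : ℝ → ℝ := fun ε => 24 * α ^ 2 -
    (b * n * ((z₀ + z₁ + (z₀ + Q ε * (z₁ - z₀) + ε * b * n * (z₃ - z₀))) * (α + A ε) + z₀ * α +
        z₁ * A ε) +
      α ^ 2 * Q ε * (2 * z₀ + (z₀ + Q ε * (z₁ - z₀) + ε * b * n * (z₃ - z₀)) +
        (z₀ + ε * α * (z₃ - z₀))))
  have hQc : Continuous Q := by fun_prop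
  have hQ0 : Q 0 = 1 := by simp [Q]
  have hAc : ContinuousAt A 0 := by
    refine ContinuousAt.div (by fun_prop) hQc.continuousAt ?_
    rw [hQ0]
    exact one_ne_zero
  have hA0 : A 0 = β := by
    change b * (0 * α * (m - 1) + n) / Q 0 = β
    rw [hQ0, ← hbn]
    ring
  have hΨc : ContinuousAt Ψ 0 := by
    have := hQc.continuousAt (x := 0)
    fun_prop
  have hΨ0 : Ψ 0 < 0 := by
    refine lt_of_eq_of_lt ?_ hneg
    simp only [Ψ]
    rw [hA0, hQ0, hbn]
    ring
  have hev : ∀ᶠ ε : ℝ in nhdsWithin 0 (Set.Ioi 0), Ψ ε < 0 ∧ 0 < Q ε ∧ ε * α < 1 ∧ ε * b < 1 ∧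
      0 < ε * α * (m - 1) + n := by
    refine Filter.Eventually.filter_mono nhdsWithin_le_nhds ?_
    have c1 : ContinuousAt (fun ε : ℝ => ε * α) 0 := by fun_prop
    have c2 : ContinuousAt (fun ε : ℝ => ε * b) 0 := by fun_prop
    have c3 : ContinuousAt (fun ε : ℝ => ε * α * (m - 1) + n) 0 := by fun_prop
    refine (hΨc.eventually (gt_mem_nhds hΨ0)).and
      ((hQc.continuousAt.eventually (lt_mem_nhds (by rw [hQ0]; exact one_pos))).and
      ((c1.eventually (gt_mem_nhds (by simp))).and
      ((c2.eventually (gt_mem_nhds (by simp))).and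
      (c3.eventually (lt_mem_nhds (by simpa using hn))))))
  obtain ⟨ε, ⟨hΨ, hQ, hεα, hεb, hd⟩, hε⟩ := (hev.and self_mem_nhdsWithin).exists
  replace hε : 0 < ε := hε
  obtain ⟨a, ha1, ha2⟩ := h.sideFutaki_simplePL ζ (mul_pos hε hα) hεα (mul_pos hε hb0) hεb hQ hd
  refine ⟨ζ, a, hζ, ?_⟩
  have hQ' : 1 + ε * b * (m - 1) = Q ε := rfl
  have hA' : ε * b * (ε * α * (m - 1) + n) / Q ε = ε * A ε := by
    simp only [A]
    ring
  have key : sideInt v 3 (simplePL a) - 1 / 2 * ∫ z in quad v, ζ z * simplePL a z =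
      ε ^ 2 / 48 * Ψ ε := by
    rw [ha1, ha2, hQ', hA']
    simp only [Ψ]
    rw [← hz₀, ← hz₁, ← hz₃]
    ring
  rw [key]
  exact mul_neg_of_pos_of_neg (by positivity) hΨ

end IsQuad

/-! ### Cyclic labelling of the vertices -/

lemma exists_smul_of_cross_eq_zero {u w : Plane} (hu : u ≠ 0) (h : cross u w = 0) :
    ∃ r : ℝ, w = r • u := by
  unfold cross at h
  by_cases h0 : u 0 = 0
  · have h1 : u 1 ≠ 0 := by
      intro h1
      refine hu ?_
      ext i
      fin_cases i
      · exact h0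
      · exact h1
    refine ⟨w 1 / u 1, ?_⟩
    have hw0 : w 0 = 0 := by
      rw [h0, zero_mul, zero_sub, neg_eq_zero] at h
      exact (mul_eq_zero.1 h).resolve_left h1
    ext i
    fin_cases i
    · change w 0 = w 1 / u 1 * u 0
      rw [hw0, h0, mul_zero]
    · change w 1 = w 1 / u 1 * u 1
      rw [div_mul_cancel₀ _ h1]
  · refine ⟨w 0 / u 0, ?_⟩
    ext i
    fin_cases i
    · change w 0 = w 0 / u 0 * u 0
      rw [div_mul_cancel₀ _ h0]
    · change w 1 = w 0 / u 0 * u 1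
      field_simp
      linarith

/-- Reversing the labelling about `v 0` exchanges the two pairs of opposite sides, so either pair
can be made the one governed by `m`. -/
lemma IsQuad.swap {v : Fin 4 → Plane} {m n : ℝ} (h : IsQuad v m n) :
    IsQuad ![v 0, v 3, v 2, v 1] n m where
  m_pos := h.n_pos
  n_pos := h.m_pos
  one_lt := by linarith [h.one_lt]
  cross_ne := by
    have e : cross (v 3 - v 0) (v 1 - v 0) = -cross (v 1 - v 0) (v 3 - v 0) := by
      unfold cross; ring
    change cross (v 3 - v 0) (v 1 - v 0) ≠ 0
    rw [e]
    exact neg_ne_zero.2 h.cross_ne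
  eq := by
    change v 2 = v 0 + n • (v 3 - v 0) + m • (v 1 - v 0)
    rw [h.eq]
    module

lemma quad_comp (v : Fin 4 → Plane) {p : Fin 4 → Fin 4} (hp : Function.Injective p) :
    quad (v ∘ p) = quad v := by
  rw [quad, quad, (Finite.injective_iff_surjective.1 hp).range_comp]

lemma quad_swap (v : Fin 4 → Plane) : quad ![v 0, v 3, v 2, v 1] = quad v := by
  have e : ![v 0, v 3, v 2, v 1] = v ∘ ![0, 3, 2, 1] := by
    ext i : 1
    fin_cases i <;> rfl
  rw [e]
  exact quad_comp v (by decide)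

/-- Applied to a Radon partition: the unbalanced cases contradict strict convexity, and in the
balanced one `{a, b}` and `{c, d}` are the diagonals, so `a, c, b, d` is a cyclic order. -/
lemma exists_fin_four_partition (s : Finset (Fin 4)) :
    (∃ a, s ⊆ {a}) ∨ (∃ a, sᶜ ⊆ {a}) ∨
      ∃ a b c d : Fin 4, s = {a, b} ∧ sᶜ = {c, d} ∧ Function.Injective ![a, c, b, d] := by
  revert s
  decide

/-- Four points in strictly convex position can be put in cyclic order. -/
lemma exists_isQuad {v : Fin 4 → Plane} (hv : ConvexIndependent ℝ v) :
    ∃ (w : Fin 4 → Plane) (m n : ℝ), IsQuad w m n ∧ quad w = quad v := by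
  classical
  have hdep : ¬ AffineIndependent ℝ v := by
    intro hi
    have := hi.card_le_finrank_succ
    have h2 := (Submodule.finrank_le (vectorSpan ℝ (Set.range v)))
    rw [finrank_euclideanSpace_fin] at h2
    rw [Fintype.card_fin] at this
    omega
  obtain ⟨I, X, hX1, hX2⟩ := Convex.radon_partition hdep
  obtain ⟨s, rfl⟩ : ∃ s : Finset (Fin 4), I = s := ⟨I.toFinset, by simp⟩
  rw [← Finset.coe_compl] at hX2
  have hsmall : ∀ (s t : Finset (Fin 4)) (a : Fin 4), Disjoint s t → s ⊆ {a} →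
      X ∈ convexHull ℝ (v '' s) → X ∈ convexHull ℝ (v '' t) → False := by
    intro s t a hst hs h1 h2
    rcases Finset.subset_singleton_iff.1 hs with rfl | rfl
    · simp at h1
    · rw [Finset.coe_singleton, Set.image_singleton, convexHull_singleton,
        Set.mem_singleton_iff] at h1
      rw [h1] at h2
      have : a ∈ t := Finset.mem_coe.1 (hv _ _ h2)
      exact (Finset.disjoint_singleton_left.1 hst) this
  have hpair : ∀ {i j k : Fin 4}, v k ∈ segment ℝ (v i) (v j) → k = i ∨ k = j := by
    intro i j k hk
    rw [← convexHull_pair, ← Set.image_pair] at hk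
    simpa using hv _ _ hk
  rcases exists_fin_four_partition s with ⟨a, ha⟩ | ⟨a, ha⟩ | ⟨a, b, c, d, hs, hsc, hinj⟩
  · exact (hsmall _ _ a disjoint_compl_right ha hX1 hX2).elim
  · exact (hsmall _ _ a disjoint_compl_left ha hX2 hX1).elim
  rw [hsc, Finset.coe_pair, Set.image_pair, convexHull_pair] at hX2
  rw [hs, Finset.coe_pair, Set.image_pair, convexHull_pair] at hX1
  have hac : a ≠ c := fun h => absurd (hinj (a₁ := 0) (a₂ := 1) h) (by decide)
  have hab : a ≠ b := fun h => absurd (hinj (a₁ := 0) (a₂ := 2) h) (by decide)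
  have had : a ≠ d := fun h => absurd (hinj (a₁ := 0) (a₂ := 3) h) (by decide)
  have hcb : c ≠ b := fun h => absurd (hinj (a₁ := 1) (a₂ := 2) h) (by decide)
  have hcd : c ≠ d := fun h => absurd (hinj (a₁ := 1) (a₂ := 3) h) (by decide)
  have hbd : b ≠ d := fun h => absurd (hinj (a₁ := 2) (a₂ := 3) h) (by decide)
  obtain ⟨s₀, s₁, hs₀, hs₁, hs, hXs⟩ := hX1
  obtain ⟨t₀, t₁, ht₀, ht₁, ht, hXt⟩ := hX2
  -- The diagonals cross in their relative interiors, since otherwise a vertex would lie on a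
  -- segment joining two others.
  have hs₀' : 0 < s₀ := by
    refine lt_of_le_of_ne hs₀ fun h0 => ?_
    rw [← h0, zero_add] at hs
    rw [← h0, hs, zero_smul, one_smul, zero_add] at hXs
    have := hpair (i := c) (j := d) (k := b) (hXs ▸ ⟨t₀, t₁, ht₀, ht₁, ht, hXt⟩)
    exact this.elim hcb.symm hbd
  have hs₁' : 0 < s₁ := by
    refine lt_of_le_of_ne hs₁ fun h0 => ?_
    rw [← h0, add_zero] at hs
    rw [← h0, hs, zero_smul, one_smul, add_zero] at hXs
    have := hpair (i := c) (j := d) (k := a) (hXs ▸ ⟨t₀, t₁, ht₀, ht₁, ht, hXt⟩)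
    exact this.elim hac had
  have ht₀' : 0 < t₀ := by
    refine lt_of_le_of_ne ht₀ fun h0 => ?_
    rw [← h0, zero_add] at ht
    rw [← h0, ht, zero_smul, one_smul, zero_add] at hXt
    have := hpair (i := a) (j := b) (k := d) (hXt ▸ ⟨s₀, s₁, hs₀, hs₁, hs, hXs⟩)
    exact this.elim had.symm hbd.symm
  have ht₁' : 0 < t₁ := by
    refine lt_of_le_of_ne ht₁ fun h0 => ?_
    rw [← h0, add_zero] at ht
    rw [← h0, ht, zero_smul, one_smul, add_zero] at hXt
    have := hpair (i := a) (j := b) (k := c) (hXt ▸ ⟨s₀, s₁, hs₀, hs₁, hs, hXs⟩)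
    exact this.elim hac.symm hcb
  have hw : ![v a, v c, v b, v d] = v ∘ ![a, c, b, d] := by
    ext i : 1
    fin_cases i <;> rfl
  -- Solving `s₀ a + s₁ b = t₀ c + t₁ d` for `b` in the frame at `a`. The coordinates sum to `1 /
  -- s₁`, which exceeds 1 because `s₀ > 0`.
  refine ⟨![v a, v c, v b, v d], t₀ / s₁, t₁ / s₁, ⟨div_pos ht₀' hs₁', div_pos ht₁' hs₁', ?_, ?_,
    ?_⟩, ?_⟩
  · rw [← add_div, ht, lt_div_iff₀ hs₁']
    linarith
  · change cross (v c - v a) (v d - v a) ≠ 0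
    intro h0
    have hne : v c - v a ≠ 0 := sub_ne_zero.2 fun h => hac (hv.injective h).symm
    obtain ⟨r, hr⟩ := exists_smul_of_cross_eq_zero hne h0
    have hd : v d = v a + r • (v c - v a) := by rw [← hr]; abel
    -- Of three collinear points one lies between the other two; the position of `r` relative to 0
    -- and 1 tells which.
    rcases le_or_gt r 0 with h1 | h1
    · have hpos : 0 < 1 - r := by linarith
      have := hpair (i := c) (j := d) (k := a) ⟨-r / (1 - r), 1 / (1 - r),
        div_nonneg (by linarith) hpos.le, div_nonneg zero_le_one hpos.le, by field_simp; ring, by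
          rw [hd]
          match_scalars
          all_goals field_simp
          all_goals ring⟩
      exact this.elim hac had
    · rcases le_or_gt r 1 with h2 | h2
      · have := hpair (i := a) (j := c) (k := d) ⟨1 - r, r, by linarith, h1.le, by ring, by
          rw [hd]; module⟩
        exact this.elim had.symm hcd.symm
      · have := hpair (i := a) (j := d) (k := c) ⟨1 - 1 / r, 1 / r,
          by rw [sub_nonneg, div_le_one h1]; exact h2.le, by positivity, by ring, by
            rw [hd]
            match_scalars <;> field_simp
            ring⟩
        exact this.elim hac.symm hcd
  · change v b = v a + (t₀ / s₁) • (v c - v a) + (t₁ / s₁) • (v d - v a)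
    have h1 : s₁ • v b = t₀ • v c + t₁ • v d - s₀ • v a := by rw [hXt, ← hXs]; abel
    have h2 : v b = s₁⁻¹ • (s₁ • v b) := by
      rw [smul_smul, inv_mul_cancel₀ hs₁'.ne', one_smul]
    have e0 : s₀ = 1 - s₁ := by linarith
    have e1 : t₀ = 1 - t₁ := by linarith
    rw [h2, h1, e0, e1]
    match_scalars <;> field_simp
    ring
  · rw [hw]
    exact quad_comp v hinj

lemma IsParallelogram.exists_isQuad {Δ : Set Plane} (h : IsParallelogram Δ) :
    ∃ v, IsQuad v 1 1 ∧ Δ = quad v := by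
  obtain ⟨p, a, b, hab, rfl⟩ := h
  refine ⟨![p, p + a, p + a + b, p + b], ⟨one_pos, one_pos, by norm_num, ?_, ?_⟩, ?_⟩
  · change cross (p + a - p) (p + b - p) ≠ 0
    rw [add_sub_cancel_left, add_sub_cancel_left]
    intro h0
    rw [LinearIndependent.pair_iff] at hab
    have ha : a ≠ 0 := by
      rintro rfl
      exact one_ne_zero (hab 1 0 (by simp)).1
    obtain ⟨r, rfl⟩ := exists_smul_of_cross_eq_zero ha h0
    exact one_ne_zero (neg_eq_zero.1 (hab r (-1) (by simp)).2)
  · change p + a + b = p + (1 : ℝ) • (p + a - p) + (1 : ℝ) • (p + b - p)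
    module
  · rw [quad]
    congr 1
    ext z
    simp only [Set.mem_insert_iff, Set.mem_singleton_iff, Set.mem_range, Fin.exists_fin_succ,
      Matrix.cons_val_zero, Matrix.cons_val_succ, eq_comm (b := z)]
    simp
    tauto

lemma IsQuad.isParallelogram {v : Fin 4 → Plane} (h : IsQuad v 1 1) :
    IsParallelogram (quad v) := by
  refine ⟨v 0, v 1 - v 0, v 3 - v 0, ?_, ?_⟩
  · rw [LinearIndependent.pair_iff]
    intro s t hst
    have h0 := congrArg (fun z : Plane => z 0) hst
    have h1 := congrArg (fun z : Plane => z 1) hst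
    simp only [PiLp.add_apply, PiLp.smul_apply, smul_eq_mul, PiLp.zero_apply] at h0 h1
    have hJ := h.cross_ne
    unfold cross at hJ
    constructor
    · refine (mul_eq_zero.1 (?_ : s * _ = 0)).resolve_right hJ
      linear_combination (v 3 - v 0) 1 * h0 - (v 3 - v 0) 0 * h1
    · refine (mul_eq_zero.1 (?_ : t * _ = 0)).resolve_right hJ
      linear_combination (v 1 - v 0) 0 * h1 - (v 1 - v 0) 1 * h0
  · have e1 : v 0 + (v 1 - v 0) = v 1 := by abel
    have e3 : v 0 + (v 3 - v 0) = v 3 := by abel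
    have e2 : v 1 + (v 3 - v 0) = v 2 := by rw [h.eq]; module
    rw [e1, e3, e2, quad]
    congr 1
    ext z
    constructor
    · rintro ⟨i, rfl⟩
      fin_cases i <;> simp
    · rintro (rfl | rfl | rfl | rfl)
      exacts [⟨0, rfl⟩, ⟨1, rfl⟩, ⟨3, rfl⟩, ⟨2, rfl⟩]

/-! ### Conclusion -/

/-- A convex quadrilateral which is not a parallelogram has a labelling of its vertices for which
two given opposite sides are not parallel. -/
lemma exists_isQuad_of_not_isParallelogram {Δ : Set Plane} (hΔ : IsConvexQuadrilateral Δ)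
    (hP : ¬ IsParallelogram Δ) : ∃ v m n, IsQuad v m n ∧ m ≠ 1 ∧ Δ = quad v := by
  obtain ⟨v', hv', hΔv'⟩ := hΔ
  obtain ⟨v, m, n, h, hq⟩ := exists_isQuad hv'
  have hΔv : Δ = quad v := hΔv'.trans hq.symm
  by_cases hm : m = 1
  · by_cases hn : n = 1
    · subst hm hn
      exact absurd (hΔv ▸ h.isParallelogram) hP
    · exact ⟨_, n, m, h.swap, hn, by rw [quad_swap, hΔv]⟩
  · exact ⟨v, m, n, h, hm, hΔv⟩

/-- Rescaling given normals by natural numbers serves the real and the lattice statements at once.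
-/
lemma IsQuad.exists_nat_smul_isKPolystable {v : Fin 4 → Plane} {m n : ℝ} (h : IsQuad v m n)
    {L : Fin 4 → AffFun} (hL : IsAffineNormals (quad v) L) :
    ∃ N : Fin 4 → ℕ, IsAffineNormals (quad v) (fun j => (N j : ℝ) • L j) ∧
      IsKPolystable (quad v) fun j => (N j : ℝ) • L j := by
  obtain ⟨U, hU, hcone, hp, hstab⟩ := h.exists_cone_isKPolystable
  obtain ⟨N, k, c, hc, hNL, hmem⟩ := h.exists_nat_smul hL hU hcone hp
  exact ⟨N, h.isAffineNormals hc hNL, hstab _ k c hc hNL hmem⟩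

lemma IsQuad.exists_nat_smul_isKUnstable {v : Fin 4 → Plane} {m n : ℝ} (h : IsQuad v m n)
    (hm : m ≠ 1) {L : Fin 4 → AffFun} (hL : IsAffineNormals (quad v) L) :
    ∃ N : Fin 4 → ℕ, IsAffineNormals (quad v) (fun j => (N j : ℝ) • L j) ∧
      IsKUnstable (quad v) (fun j => (N j : ℝ) • L j) ∧
      ∃ a : AffFun, futaki (quad v) (fun j => (N j : ℝ) • L j) (simplePL a) < 0 := by
  obtain ⟨ζ, a, hζ, hneg⟩ := h.exists_sideFutaki_neg hm
  obtain ⟨U, hU, hcone, hp, hF⟩ := h.exists_cone_futaki_neg hζ hneg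
  obtain ⟨N, k, c, hc, hNL, hmem⟩ := h.exists_nat_smul hL hU hcone hp
  have hlt := hF (fun j => (N j : ℝ) • L j) k c hc hNL hmem
  exact ⟨N, h.isAffineNormals hc hNL, ⟨_, isPLConvexOn_simplePL _ a, hlt⟩, a, hlt⟩

lemma IsRationalDelzant.nat_smul {Λ : Submodule ℤ (Module.Dual ℝ Plane)} {Δ : Set Plane}
    {L : Fin 4 → AffFun} (hL : IsRationalDelzant Λ Δ L) {N : Fin 4 → ℕ}
    (hN : IsAffineNormals Δ fun j => (N j : ℝ) • L j) :
    IsRationalDelzant Λ Δ fun j => (N j : ℝ) • L j := by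
  refine ⟨hN, fun j => ?_⟩
  rw [AffineMap.smul_linear, Nat.cast_smul_eq_nsmul]
  exact nsmul_mem (hL.mem_lattice j) (N j)

end LabelledPolygon

theorem propositionB1 (Δ : Set LabelledPolygon.Plane)
    (hΔ : LabelledPolygon.IsConvexQuadrilateral Δ) :
    (LabelledPolygon.IsParallelogram Δ →
      ∀ L : Fin 4 → LabelledPolygon.AffFun, LabelledPolygon.IsAffineNormals Δ L →
        LabelledPolygon.IsKPolystable Δ L) ∧
    (¬ LabelledPolygon.IsParallelogram Δ →
      ((∃ L : Fin 4 → LabelledPolygon.AffFun, LabelledPolygon.IsAffineNormals Δ L ∧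
          LabelledPolygon.IsKPolystable Δ L) ∧
        (∃ L : Fin 4 → LabelledPolygon.AffFun, LabelledPolygon.IsAffineNormals Δ L ∧
          LabelledPolygon.IsKUnstable Δ L ∧
          ∃ a : LabelledPolygon.AffFun,
            LabelledPolygon.futaki Δ L (LabelledPolygon.simplePL a) < 0)) ∧
      ∀ Λ : Submodule ℤ (Module.Dual ℝ LabelledPolygon.Plane),
        LabelledPolygon.IsDualLattice Λ →
        (∃ L : Fin 4 → LabelledPolygon.AffFun, LabelledPolygon.IsRationalDelzant Λ Δ L) →
        (∃ L : Fin 4 → LabelledPolygon.AffFun, LabelledPolygon.IsRationalDelzant Λ Δ L ∧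
          LabelledPolygon.IsKPolystable Δ L) ∧
        (∃ L : Fin 4 → LabelledPolygon.AffFun, LabelledPolygon.IsRationalDelzant Λ Δ L ∧
          LabelledPolygon.IsKUnstable Δ L ∧
          ∃ a : LabelledPolygon.AffFun,
            LabelledPolygon.futaki Δ L (LabelledPolygon.simplePL a) < 0)) := by
  refine ⟨fun hP L hL => ?_, fun hP => ?_⟩
  · obtain ⟨v, h, rfl⟩ := hP.exists_isQuad
    exact h.isKPolystable_parallelogram hL
  · obtain ⟨v, m, n, h, hm, rfl⟩ :=
      LabelledPolygon.exists_isQuad_of_not_isParallelogram hΔ hP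
    -- Without a lattice any starting normals will do; the side functions themselves are used.
    have h₀ : LabelledPolygon.IsAffineNormals (LabelledPolygon.quad v)
        fun i => (1 : ℝ) • LabelledPolygon.sideFun v m n i :=
      h.isAffineNormals (k := Equiv.refl _) (fun _ => one_pos) fun _ => rfl
    refine ⟨⟨?_, ?_⟩, fun Λ _ ⟨L, hL⟩ => ⟨?_, ?_⟩⟩
    · obtain ⟨N, hN, hs⟩ := h.exists_nat_smul_isKPolystable h₀
      exact ⟨_, hN, hs⟩
    · obtain ⟨N, hN, hu⟩ := h.exists_nat_smul_isKUnstable hm h₀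
      exact ⟨_, hN, hu⟩
    · obtain ⟨N, hN, hs⟩ := h.exists_nat_smul_isKPolystable hL.isAffineNormals
      exact ⟨_, hL.nat_smul hN, hs⟩
    · obtain ⟨N, hN, hu⟩ := h.exists_nat_smul_isKUnstable hm hL.isAffineNormals
      exact ⟨_, hL.nat_smul hN, hu⟩
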